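/- Let $0<n<d$ be integers. For $x\in\mathbb R^d$, a linear subspace $V\subset\mathbb R^d$, $\alpha\in(0,1)$ and $r>0$ put $$K(x,V,\alpha,r)=\{y\in B(x,r):\operatorname{dist}(y,V+x)<\alpha|x-y|\},$$ where $B(x,r)$ is the open ball. For a Radon measure $\mu$ on $\mathbb R^d$ and $1\le p<\infty$ put $\Theta_\mu(B(x,r))=\mu(B(x,r))r^{-n}$ and $$\mathcal E_{\mu,p}(\mathbb R^d,V,\alpha)=\int_{\mathbb R^d}\int_0^\infty\Big(\frac{\mu(K(x,V,\alpha,r))}{r^n}\Big)^p\frac{dr}{r}\,d\mu(x).$$ **David–Mattila lattices.** Let $C_0>1$, $A_0>5000C_0$, $\rho>0$, and let $\mu$ be a Radon measure on $\mathbb R^d$ with support $E$. A David–Mattila lattice of $\mu$ with parameters $C_0,A_0$ and base scale $\rho$ is a family $\mathcal D=\bigcup_{k\ge0}\mathcal D_k$ of Borel sets $Q\subset E$ ("cubes"; the same set occurring in two generations counts as two cubes), each $Q\in\mathcal D_k$ carrying its generation $J(Q)=k$ and a ball $B(Q)=B(x_Q,r(Q))$, such that: * (a) for every $k\ge0$,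 $E$ is the disjoint union of the cubes of $\mathcal D_k$; and if $k<l$, $R\in\mathcal D_k$, $Q\in\mathcal D_l$, then $Q\cap R=\varnothing$ or $Q\subset R$; * (b) for $Q\in\mathcal D_k$: $x_Q\in Q$, $\rho A_0^{-k}\le r(Q)\le C_0\rho A_0^{-k}$ and $E\cap B(Q)\subset Q\subset E\cap 28B(Q)$; the balls $5B(Q)$, $Q\in\mathcal D_k$, are disjoint; * (c) with $\mathcal D^{db}$ the family of doubling cubes, i.e. of those $Q\in\mathcal D$ with $\mu(100B(Q))\le C_0\,\mu(B(Q))$: every $R\in\mathcal D$ is covered up to a $\mu$-null set by doubling cubes contained in $R$; * (d) if $Q,R\in\mathcal D$, $Q\subset R$, and no cube strictly between $Q$ and $R$ is doubling, then $\Theta_\mu(100B(Q))\le(C_0A_0)^dA_0^{-9d(J(Q)-J(R)-1)}\Theta_\mu(100B(R))$. Here and below, containment of cubes $Q\subset R$ includes $J(Q)\ge J(R)$, and strict containment means moreover $J(Q)>J(R)$. Put $B_Q=28B(Q)$. Given $\mathrm{Top}\subset\mathcal D^{db}$ and $R\in\mathrm{Top}$, let $\mathrm{Next}(R)$ be the family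 of maximal cubes of $\mathrm{Top}$ strictly contained in $R$, let $\mathrm{Tr}(R)$ be the family of cubes of $\mathcal D$ contained in $R$ but in no cube of $\mathrm{Next}(R)$, and let $\mathrm{Good}(R)=R\setminus\bigcup_{Q\in\mathrm{Next}(R)}Q$. An $n$-dimensional Lipschitz graph with constant $L$ is a set $\{w+f(w):w\in W\}$ where $W\subset\mathbb R^d$ is an $n$-dimensional linear subspace and $f:W\to W^\perp$ is $L$-Lipschitz. **Lemma.** There are constants $C_0>1$, $A_0>5000C_0$ and $C$ depending only on $n,d$, constants $L(\alpha)$ depending only on $n,d,\alpha$, and constants $C'(\alpha,p)$ depending only on $n,d,\alpha,p$, such that the following holds. Let $\mu\ne0$ be a compactly supported Radon measure on $\mathbb R^d$, and let $\rho>0$ satisfy $\rho\ge\operatorname{diam}(\operatorname{supp}\mu)$. Then $\mu$ has a David–Mattila lattice $\mathcal D$ with parameters $C_0,A_0$ and base scale $\rho$, with $R_0:=\operatorname{supp}\mu\in\mathcal D_0$, for which the following is true. Suppose that $C_1\ge0$ and $r_0>0$ are such that $\mu(B(x,r))\le C_1r^n$ for all $x\in\operatorname{supp}\mu$ and $0<r\le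 r_0$, and that $V$ is a $(d-n)$-dimensional linear subspace, $\alpha\in(0,1)$, $1\le p<\infty$ and $\mathcal E_{\mu,p}(\mathbb R^d,V,\alpha)<\infty$. Then there are a family $\mathrm{Top}\subset\mathcal D^{db}$ with $R_0\in\mathrm{Top}$ and $n$-dimensional Lipschitz graphs $\Gamma_R$, $R\in\mathrm{Top}$, such that for all $R\in\mathrm{Top}$: * (i) $\Gamma_R$ has Lipschitz constant at most $L(\alpha)$; * (ii) $\mu(\mathrm{Good}(R)\setminus\Gamma_R)=0$; * (iii) $\Theta_\mu(2B_Q)\le C\,\Theta_\mu(2B_R)$ for all $Q\in\mathrm{Tr}(R)$. Moreover, $$\sum_{R\in\mathrm{Top}}\Theta_\mu(2B_R)^p\mu(R)\le C'(\alpha,p)\big(C_1^p\,\mu(\mathbb R^d)+\mathcal E_{\mu,p}(\mathbb R^d,V,\alpha)\big).$$ -/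

import Mathlib

open MeasureTheory Set Metric
open scoped ENNReal NNReal

noncomputable section

/-- `ℝ^d` with its Euclidean norm. -/
abbrev Eucl (d : ℕ) : Type := EuclideanSpace ℝ (Fin d)

/-- The open cone `K(x, V, α) = {y : dist(y, V + x) < α |x - y|}`. -/
def cone {d : ℕ} (x : Eucl d) (V : Submodule ℝ (Eucl d)) (α : ℝ) : Set (Eucl d) :=
  {y | infDist y ((fun v => v + x) '' (V : Set (Eucl d))) < α * dist x y}

/-- The truncated cone `K(x, V, α, r) = K(x, V, α) ∩ B(x, r)`. -/
def truncCone {d : ℕ} (x : Eucl d) (V : Submodule ℝ (Eucl d)) (α r : ℝ) : Set (Eucl d) :=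
  cone x V α ∩ ball x r

/-- The `n`-dimensional density `Θ_μ(x, r) = μ(B(x, r)) / r ^ n`, used for `r > 0`. -/
def density {d : ℕ} (n : ℕ) (μ : Measure (Eucl d)) (x : Eucl d) (r : ℝ) : ℝ≥0∞ :=
  μ (ball x r) / ENNReal.ofReal (r ^ n)

/-- The global `n`-dimensional conical energy
`∫ ∫_0^∞ (μ(K(x, V, α, r)) / r ^ n) ^ p dr / r dμ(x)`, with values in `[0, ∞]`. -/
def conicalEnergy {d : ℕ} (n : ℕ) (p : ℝ) (μ : Measure (Eucl d))
    (V : Submodule ℝ (Eucl d)) (α : ℝ) : ℝ≥0∞ :=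
  ∫⁻ x, ∫⁻ r in Ioi (0 : ℝ),
    (μ (truncCone x V α r) / ENNReal.ofReal (r ^ n)) ^ p / ENNReal.ofReal r ∂volume ∂μ

/-- `Γ` is an `n`-dimensional Lipschitz graph with constant `L`: the graph
`{w + f w : w ∈ W}` of an `L`-Lipschitz map `f : W → Wᗮ` over an `n`-dimensional subspace `W`. -/
def IsLipschitzGraph {d : ℕ} (n : ℕ) (L : ℝ≥0) (Γ : Set (Eucl d)) : Prop :=
  ∃ W : Submodule ℝ (Eucl d), Module.finrank ℝ W = n ∧
    ∃ f : W → Wᗮ, LipschitzWith L f ∧ Γ = range fun w : W => (w : Eucl d) + (f w : Eucl d)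

/-- A "cube": a set together with its generation `J(Q)` and its ball `B(Q) = B(x_Q, r(Q))`.
The same set may occur as a cube of several generations; these count as different cubes. -/
structure Cube (d : ℕ) where
  gen : ℕ
  carrier : Set (Eucl d)
  center : Eucl d
  radius : ℝ

namespace Cube

variable {d : ℕ}

/-- Containment of cubes: `Q` is contained in `R` and is of the same or of a later generation. -/
def Sub (Q R : Cube d) : Prop := R.gen ≤ Q.gen ∧ Q.carrier ⊆ R.carrier

/-- Strict containment of cubes: `Q` is a descendant of `R` of a later generation. -/
def SSub (Q R : Cube d) : Prop := R.gen < Q.gen ∧ Q.carrier ⊆ R.carrier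

/-- The dilated open ball `λ B(Q)`. -/
def ballB (lam : ℝ) (Q : Cube d) : Set (Eucl d) := ball Q.center (lam * Q.radius)

/-- `Θ_μ(λ B(Q))`. -/
def densB (n : ℕ) (μ : Measure (Eucl d)) (lam : ℝ) (Q : Cube d) : ℝ≥0∞ :=
  density n μ Q.center (lam * Q.radius)

/-- `Θ_μ(2 B_Q)`, where `B_Q = 28 B(Q)`. -/
def dens2 (n : ℕ) (μ : Measure (Eucl d)) (Q : Cube d) : ℝ≥0∞ := Q.densB n μ (2 * 28)

/-- `Q` is doubling: `μ(100 B(Q)) ≤ C₀ μ(B(Q))`. -/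
def Doubling (C₀ : ℝ) (μ : Measure (Eucl d)) (Q : Cube d) : Prop :=
  μ (Q.ballB 100) ≤ ENNReal.ofReal C₀ * μ (Q.ballB 1)

end Cube

/-- The doubling cubes of a family `D`. -/
def doublingCubes {d : ℕ} (C₀ : ℝ) (μ : Measure (Eucl d)) (D : Set (Cube d)) : Set (Cube d) :=
  {Q | Q ∈ D ∧ Q.Doubling C₀ μ}

/-- `D` is a lattice of David-Mattila cubes for `μ` with parameters `C₀`, `A₀`, the cubes of
generation `k` having size comparable to `ρ A₀ ^ (-k)`. -/
structure IsDavidMattilaLattice {d : ℕ} (n : ℕ) (C₀ A₀ ρ : ℝ) (μ : Measure (Eucl d))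
    (D : Set (Cube d)) : Prop where
  measurableSet : ∀ Q ∈ D, MeasurableSet Q.carrier
  /-- The cubes of each generation cover `supp μ` (and are contained in it). -/
  cover : ∀ k : ℕ, (⋃ Q ∈ {Q ∈ D | Q.gen = k}, Q.carrier) = μ.support
  /-- The cubes of one generation are pairwise disjoint. -/
  disjoint : ∀ Q ∈ D, ∀ R ∈ D, Q.gen = R.gen → Q ≠ R → Disjoint Q.carrier R.carrier
  /-- A cube of a later generation is either disjoint from a given cube or contained in it. -/
  nested : ∀ Q ∈ D, ∀ R ∈ D, R.gen < Q.gen →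
    Disjoint Q.carrier R.carrier ∨ Q.carrier ⊆ R.carrier
  center_mem : ∀ Q ∈ D, Q.center ∈ Q.carrier
  le_radius : ∀ Q ∈ D, ρ * (A₀ ^ Q.gen)⁻¹ ≤ Q.radius
  radius_le : ∀ Q ∈ D, Q.radius ≤ C₀ * (ρ * (A₀ ^ Q.gen)⁻¹)
  /-- `supp μ ∩ B(Q) ⊆ Q`. -/
  ball_subset : ∀ Q ∈ D, μ.support ∩ Q.ballB 1 ⊆ Q.carrier
  /-- `Q ⊆ supp μ ∩ 28 B(Q)`. -/
  subset_ball : ∀ Q ∈ D, Q.carrier ⊆ μ.support ∩ Q.ballB 28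
  /-- The balls `5 B(Q)` of one generation are pairwise disjoint. -/
  disjoint_balls : ∀ Q ∈ D, ∀ R ∈ D, Q.gen = R.gen → Q ≠ R →
    Disjoint (Q.ballB 5) (R.ballB 5)
  /-- Doubling cubes contained in a given cube cover `μ`-almost all of it. -/
  doubling_cover : ∀ R ∈ D, ∃ F ⊆ doublingCubes C₀ μ D,
    (∀ Q ∈ F, Q.Sub R) ∧ μ (R.carrier \ ⋃ Q ∈ F, Q.carrier) = 0
  /-- The density drops quickly along chains of non-doubling cubes. -/
  density_drop : ∀ Q ∈ D, ∀ R ∈ D, Q.Sub R →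
    (∀ S ∈ D, Q.SSub S → S.SSub R → ¬ S.Doubling C₀ μ) →
    Q.densB n μ 100 ≤
      ENNReal.ofReal
        ((C₀ * A₀) ^ d * A₀ ^ (-(9 * (d : ℤ) * ((Q.gen : ℤ) - (R.gen : ℤ) - 1)))) *
        R.densB n μ 100

/-- `Next(R)`: the maximal cubes of `Top` strictly contained in `R`. -/
def nextCubes {d : ℕ} (Top : Set (Cube d)) (R : Cube d) : Set (Cube d) :=
  {Q | Q ∈ Top ∧ Q.SSub R ∧ ∀ P ∈ Top, P.SSub R → ¬ Q.SSub P}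

/-- `Tr(R)`: the cubes of `D` contained in `R` but in no cube of `Next(R)`. -/
def treeCubes {d : ℕ} (D Top : Set (Cube d)) (R : Cube d) : Set (Cube d) :=
  {Q | Q ∈ D ∧ Q.Sub R ∧ ∀ P ∈ nextCubes Top R, ¬ Q.Sub P}

/-- `Good(R)`: the part of `R` outside all cubes of `Next(R)`. -/
def goodSet {d : ℕ} (Top : Set (Cube d)) (R : Cube d) : Set (Eucl d) :=
  R.carrier \ ⋃ Q ∈ nextCubes Top R, Q.carrier

end

/-! The argument has two halves: the lattice, and a corona decomposition by stopping times.

The lattice. Set `C₀ = 100 ^ N` with `N = 100 * d`, and `A₀ = 5001 * C₀`. Around each point and at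
each scale `a`, either one of the radii `100 ^ i * a` with `i < N` is doubling, or the measure
decays by the factor `C₀ ^ (N - 1) ≥ A₀ ^ (10 * d)` between two fixed multiples of `a`. Vitali
coverings give nets at all scales. A parent map organises them into a tree, and a measurable choice
of branches converging to each point gives nested partitions. The decay at non-doubling cubes beats
both the change of scale (`density_drop`) and the number of cubes of a generation
(`doubling_cover`).

The corona. Below a top cube `R`, a cube is bad if it is doubling with more than 4 times the density
of `R`, or if its density is less than `τ` times that of `R`, or if at each of its points the energy
between its scale and that of `R` is at least `ε Θ(R) ^ p`. The successors of `R` are the maximal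
doubling cubes inside bad cubes. All else rests on one observation, `energy_lower_bound`: if `x`
lies in the narrow cone of `z`, and the cubes around `x` of size about `|x - z|` do not have low
density, then the wide cone at `z` contains a ball of substantial mass, so the energy at `z` is
large.

Hence two points in no bad cube are never in vertical position, and such points lie on a Lipschitz
graph over the orthogonal complement of `V` (`exists_graph`). Almost all of the good part of `R`
consists of such points. The density bound on the tree follows from the high density stopping rule
and `density_drop`.

For the packing estimate, `R` is split into its good part, the stopping cubes of large energy, those
of high density, and the remaining low density ones. The last ones carry at most half of the mass of
`R`. Indeed, by the observation, low density stopping cubes with nearby projections to the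
complement of `V` are close to each other, so their mass is controlled by an `n`-dimensional packing
of projections times `τ Θ(R)`, and `τ` is chosen small (`measure_lowDensity_le`). High density cubes
are successors with weight larger by the factor 4, so `weighted_mass_le` bounds the weight of `R` by
its good and energy terms plus half the weight of its successors. Summing over all top cubes and
absorbing (`tsum_top_le`) leaves the good sets, which are disjoint and on which the growth of `μ`
bounds `Θ(R)`, and the energy terms, which overlap at most three times. -/

section Packing

/-! ### Packing of disjoint balls and measurable selections -/

variable {W : Type*} [NormedAddCommGroup W] [NormedSpace ℝ W] [FiniteDimensional ℝ W]

/-- Disjoint balls inside a ball: the sum of the `n`-th powers of the radii is controlled. -/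
theorem tsum_radius_pow_le {ι : Type*} (s : Set ι) (x : ι → W) (r : ι → ℝ)
    (hr : ∀ i ∈ s, 0 < r i) (disj : s.PairwiseDisjoint fun i => ball (x i) (r i))
    {y : W} {R : ℝ} (hR : 0 < R) (hsub : ∀ i ∈ s, ball (x i) (r i) ⊆ ball y R) :
    ∑' i : s, ENNReal.ofReal (r i ^ Module.finrank ℝ W) ≤
      ENNReal.ofReal (R ^ Module.finrank ℝ W) := by
  borelize W
  let ν : Measure W := Measure.addHaar
  have h1 : ∑' i : s, ν (ball (x i) (r i)) ≤ ν (⋃ i : s, ball (x i) (r i)) := by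
    apply tsum_meas_le_meas_iUnion_of_disjoint ν (fun i => measurableSet_ball)
    intro i j hij
    exact disj i.2 j.2 (fun h => hij (Subtype.ext h))
  have h2 : ν (⋃ i : s, ball (x i) (r i)) ≤ ν (ball y R) :=
    measure_mono (iUnion_subset fun i => hsub i i.2)
  have h3 := h1.trans h2
  have hpos : ν (ball (0 : W) 1) ≠ 0 := (measure_ball_pos ν 0 one_pos).ne'
  have hfin : ν (ball (0 : W) 1) ≠ ∞ := measure_ball_lt_top.ne
  rw [Measure.addHaar_ball_of_pos ν _ hR] at h3
  have h4 : ∀ i : s, ν (ball (x i) (r i)) =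
      ENNReal.ofReal (r i ^ Module.finrank ℝ W) * ν (ball 0 1) :=
    fun i => Measure.addHaar_ball_of_pos ν _ (hr i i.2)
  simp_rw [h4] at h3
  rw [ENNReal.tsum_mul_right] at h3
  exact (ENNReal.mul_le_mul_iff_left hpos hfin).1 h3

/-- The number of disjoint balls of radius at least `δ` inside a ball of radius `R` is at most
`(R / δ) ^ n`. -/
theorem tsum_const_le_of_disjoint_balls {ι : Type*} (s : Set ι) (x : ι → W) (r : ι → ℝ) {δ : ℝ}
    (hδ : 0 < δ) (hr : ∀ i ∈ s, δ ≤ r i) (disj : s.PairwiseDisjoint fun i => ball (x i) (r i))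
    {y : W} {R : ℝ} (hR : 0 < R) (hsub : ∀ i ∈ s, ball (x i) δ ⊆ ball y R) (c : ℝ≥0∞) :
    ∑' _ : s, c ≤ ENNReal.ofReal ((R / δ) ^ Module.finrank ℝ W) * c := by
  have h := tsum_radius_pow_le s x (fun _ => δ) (fun _ _ => hδ)
    (fun i hi j hj hij => (disj hi hj hij).mono (ball_subset_ball (hr i hi))
      (ball_subset_ball (hr j hj))) hR hsub
  have hδ' : 0 < δ ^ Module.finrank ℝ W := pow_pos hδ _
  have e : ENNReal.ofReal (R ^ Module.finrank ℝ W) =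
      ENNReal.ofReal ((R / δ) ^ Module.finrank ℝ W) * ENNReal.ofReal (δ ^ Module.finrank ℝ W) := by
    rw [← ENNReal.ofReal_mul (by positivity), div_pow, div_mul_cancel₀ _ hδ'.ne']
  rw [e] at h
  have h1 : ∑' _ : s, (1 : ℝ≥0∞) ≤ ENNReal.ofReal ((R / δ) ^ Module.finrank ℝ W) := by
    have : ∑' _ : s, ENNReal.ofReal (δ ^ Module.finrank ℝ W) =
        (∑' _ : s, (1 : ℝ≥0∞)) * ENNReal.ofReal (δ ^ Module.finrank ℝ W) := by
      rw [← ENNReal.tsum_mul_right]; simp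
    rw [this] at h
    exact (ENNReal.mul_le_mul_iff_left (by simpa using hδ') ENNReal.ofReal_ne_top).1 h
  calc ∑' _ : s, c = (∑' _ : s, (1 : ℝ≥0∞)) * c := by
        rw [← ENNReal.tsum_mul_right]; simp
    _ ≤ _ := by gcongr

theorem finite_of_disjoint_balls {ι : Type*} (s : Set ι) (x : ι → W) (r : ι → ℝ) {δ : ℝ}
    (hδ : 0 < δ) (hr : ∀ i ∈ s, δ ≤ r i) (disj : s.PairwiseDisjoint fun i => ball (x i) (r i))
    {y : W} {R : ℝ} (hR : 0 < R) (hsub : ∀ i ∈ s, ball (x i) δ ⊆ ball y R) : s.Finite := by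
  have h := tsum_const_le_of_disjoint_balls s x r hδ hr disj hR hsub 1
  rw [mul_one] at h
  by_contra hs
  have : Infinite s := Set.infinite_coe_iff.2 hs
  rw [ENNReal.tsum_const_eq_top_of_ne_zero one_ne_zero] at h
  exact absurd h (by simp)

end Packing

/-- A finite measurable cover of a measurable set has a measurable selection. -/
theorem exists_measurable_selection {α β : Type*} [MeasurableSpace α] [Nonempty β] {I : Set β}
    (hI : I.Finite) (S : β → Set α) (hS : ∀ b ∈ I, MeasurableSet (S b)) :
    ∀ A : Set α, MeasurableSet A → A ⊆ ⋃ b ∈ I, S b → ∃ t : α → β,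
      (∀ z ∈ A, t z ∈ I ∧ z ∈ S (t z)) ∧ ∀ b, MeasurableSet {z ∈ A | t z = b} := by
  classical
  induction I, hI using Set.Finite.induction_on with
  | empty =>
    intro A _ hA
    simp only [mem_empty_iff_false, iUnion_of_empty, iUnion_empty, subset_empty_iff] at hA
    subst hA
    exact ⟨fun _ => Classical.arbitrary β, by simp, by simp⟩
  | @insert a J _ _ ih =>
    intro A hAm hA
    have hSa := hS a (mem_insert _ _)
    obtain ⟨t, ht, htm⟩ := ih (fun b hb => hS b (mem_insert_of_mem _ hb)) (A \ S a)
      (hAm.diff hSa) (by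
        intro z hz
        have := hA hz.1
        simp only [mem_iUnion, mem_insert_iff] at this ⊢
        obtain ⟨b, rfl | hb, hz'⟩ := this
        · exact absurd hz' hz.2
        · exact ⟨b, hb, hz'⟩)
    refine ⟨fun z => if z ∈ S a then a else t z, ?_, ?_⟩
    · intro z hz
      by_cases h : z ∈ S a
      · simp [h]
      · simp only [h, if_false]
        exact ⟨mem_insert_of_mem _ (ht z ⟨hz, h⟩).1, (ht z ⟨hz, h⟩).2⟩
    · intro b
      by_cases hb : b = a
      · subst hb
        have : {z ∈ A | (if z ∈ S b then b else t z) = b} =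
            (A ∩ S b) ∪ {z ∈ A \ S b | t z = b} := by
          ext z; by_cases h : z ∈ S b <;> simp [h]
        rw [this]
        exact (hAm.inter hSa).union (htm b)
      · have : {z ∈ A | (if z ∈ S a then a else t z) = b} = {z ∈ A \ S a | t z = b} := by
          ext z
          by_cases h : z ∈ S a
          · simp [h, Ne.symm hb]
          · simp [h]
        rw [this]
        exact htm b

/-! ### Nested partitions from a tree of nets -/

section Tree

/-- The ancestor of generation `k` of a point of generation `k + i`. -/
def treeAncestor {X : Type*} (par : ℕ → X → X) (k : ℕ) : ℕ → X → X
  | 0, x => x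
  | i + 1, x => treeAncestor par k i (par (k + i) x)

/-- The definition climbs from the youngest generation; this form splits off the oldest step, which
relates ancestors of generation `k` to those of generation `k + 1`. -/
theorem treeAncestor_succ {X : Type*} (par : ℕ → X → X) (k i : ℕ) (x : X) :
    treeAncestor par k (i + 1) x = par k (treeAncestor par (k + 1) i x) := by
  induction i generalizing x with
  | zero => rfl
  | succ i ih =>
    rw [treeAncestor, ih, treeAncestor]
    congr 3
    omega

theorem treeAncestor_mem {X : Type*} {I : ℕ → Set X} {par : ℕ → X → X}
    (hpar : ∀ k, ∀ x ∈ I (k + 1), par k x ∈ I k) (k i : ℕ) (x : X) (hx : x ∈ I (k + i)) :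
    treeAncestor par k i x ∈ I k := by
  induction i generalizing x with
  | zero => exact hx
  | succ i ih => exact ih _ (hpar _ _ hx)

variable {X : Type*} [PseudoMetricSpace X]

/-- The points that are limits of descendants of `y`. -/
def limitCell (E : Set X) (I : ℕ → Set X) (r : ℕ → X → ℝ) (par : ℕ → X → X) (k : ℕ) (y : X) :
    Set X :=
  {z ∈ E | ∃ᶠ i in Filter.atTop,
    ∃ x ∈ I (k + i), treeAncestor par k i x = y ∧ dist z x ≤ 25 * r (k + i) x}

theorem measurableSet_limitCell [MeasurableSpace X] [OpensMeasurableSpace X] {E : Set X}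
    (hE : MeasurableSet E) {I : ℕ → Set X} (hfin : ∀ k, (I k).Finite) (r : ℕ → X → ℝ)
    (par : ℕ → X → X) (k : ℕ) (y : X) : MeasurableSet (limitCell E I r par k y) := by
  have : limitCell E I r par k y = E ∩ ⋂ n : ℕ, ⋃ i ≥ n,
      ⋃ x ∈ {x ∈ I (k + i) | treeAncestor par k i x = y}, closedBall x (25 * r (k + i) x) := by
    ext z
    simp only [limitCell, Filter.frequently_atTop, mem_ofPred_eq, mem_inter_iff, mem_iInter,
      mem_iUnion, mem_closedBall, exists_prop, and_assoc]
  rw [this]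
  refine hE.inter (MeasurableSet.iInter fun n => MeasurableSet.iUnion fun i =>
    MeasurableSet.iUnion fun _ => ?_)
  exact ((hfin _).subset (sep_subset _ _)).measurableSet_biUnion
    fun x _ => measurableSet_closedBall

/-- Pigeonhole: infinitely many approximating descendants of `y` are shared among finitely many
children, so some child has infinitely many of them. -/
theorem limitCell_subset {E : Set X} {I : ℕ → Set X} (hfin : ∀ k, (I k).Finite)
    (r : ℕ → X → ℝ) {par : ℕ → X → X}
    (hpar : ∀ k, ∀ x ∈ I (k + 1), par k x ∈ I k) (k : ℕ) (y : X) :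
    limitCell E I r par k y ⊆
      ⋃ y' ∈ {y' ∈ I (k + 1) | par k y' = y}, limitCell E I r par (k + 1) y' := by
  rintro z ⟨hzE, hz⟩
  simp only [mem_iUnion, exists_prop]
  by_contra hcon
  push Not at hcon
  have h1 : ∀ y' ∈ {y' ∈ I (k + 1) | par k y' = y}, ∀ᶠ i in Filter.atTop,
      ¬ ∃ x ∈ I (k + 1 + i), treeAncestor par (k + 1) i x = y' ∧
        dist z x ≤ 25 * r (k + 1 + i) x := by
    intro y' hy'
    have := hcon y' hy'
    rw [limitCell, mem_ofPred_eq, not_and] at this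
    exact Filter.not_frequently.1 (this hzE)
  have h2 := (Filter.eventually_all_finite ((hfin (k + 1)).subset (sep_subset _ _))).2 h1
  obtain ⟨n, hn⟩ := Filter.eventually_atTop.1 h2
  obtain ⟨m, hm, x, hx, hxy, hzx⟩ := Filter.frequently_atTop.1 hz (n + 1)
  obtain ⟨i, rfl⟩ : ∃ i, m = i + 1 := ⟨m - 1, by omega⟩
  have e : k + (i + 1) = k + 1 + i := by omega
  rw [e] at hx hzx
  rw [treeAncestor_succ] at hxy
  exact hn i (by omega) (treeAncestor par (k + 1) i x)
    ⟨treeAncestor_mem hpar _ _ _ hx, hxy⟩ ⟨x, hx, rfl, hzx⟩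

/-- The parental distances form a rapidly convergent geometric series: `25 + 25.5 / 5000 ≤ 25.5`. -/
theorem dist_treeAncestor_le {I : ℕ → Set X} {r : ℕ → X → ℝ} {par : ℕ → X → X}
    (hpos : ∀ k x, 0 < r k x) (hscale : ∀ k x y, 5000 * r (k + 1) x ≤ r k y)
    (hpar : ∀ k, ∀ x ∈ I (k + 1), par k x ∈ I k ∧ dist x (par k x) ≤ 25 * r k (par k x))
    (i : ℕ) : ∀ (k : ℕ) (x : X), x ∈ I (k + i) →
      dist x (treeAncestor par k i x) ≤ 25.5 * r k (treeAncestor par k i x) := by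
  induction i with
  | zero =>
    intro k x _
    rw [treeAncestor, dist_self]
    have := hpos k x
    positivity
  | succ i ih =>
    intro k x hx
    have e : k + (i + 1) = k + 1 + i := by omega
    rw [e] at hx
    rw [treeAncestor_succ]
    set u := treeAncestor par (k + 1) i x
    have h1 := ih (k + 1) x hx
    have hu : u ∈ I (k + 1) := treeAncestor_mem (fun k x hx => (hpar k x hx).1) _ _ _ hx
    have h2 := (hpar k u hu).2
    have h3 := hscale k u (par k u)
    have h4 := hpos (k + 1) u
    linarith [dist_triangle x u (par k u)]

theorem dist_le_of_mem_limitCell {E : Set X} {I : ℕ → Set X} {r : ℕ → X → ℝ} {par : ℕ → X → X}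
    (hpos : ∀ k x, 0 < r k x) (hscale : ∀ k x y, 5000 * r (k + 1) x ≤ r k y)
    (hpar : ∀ k, ∀ x ∈ I (k + 1), par k x ∈ I k ∧ dist x (par k x) ≤ 25 * r k (par k x))
    {k : ℕ} {y z : X} (hz : z ∈ limitCell E I r par k y) : dist z y ≤ 26 * r k y := by
  -- Asking for at least one generation below `y` makes the last error `25 * r (k + m) x` at most
  -- `25 / 5000` times the radius of `y`, so the total stays below 26.
  obtain ⟨m, hm, x, hx, hxy, hzx⟩ := Filter.frequently_atTop.1 hz.2 1
  have h1 := dist_treeAncestor_le hpos hscale hpar m k x hx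
  rw [hxy] at h1
  have h2 : ∀ j, 5000 * r (k + (j + 1)) x ≤ r k y := by
    intro j
    induction j with
    | zero => exact hscale k x y
    | succ j ih =>
      have := hscale (k + (j + 1)) x x
      have h0 := hpos (k + (j + 1) + 1) x
      have e : k + (j + 1 + 1) = k + (j + 1) + 1 := by omega
      rw [e]; linarith [hpos (k + (j + 1)) x]
  have h3 := h2 (m - 1)
  rw [Nat.sub_add_cancel hm] at h3
  have := hpos (k + m) x
  linarith [dist_triangle z x y]

/-- Nested measurable partitions of `E` adapted to separated nets at rapidly decreasing scales. -/
theorem exists_nested_partitions [MeasurableSpace X] [OpensMeasurableSpace X] {E : Set X}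
    (hE : MeasurableSet E) (I : ℕ → Set X) (r : ℕ → X → ℝ) (hsub : ∀ k, I k ⊆ E)
    (hfin : ∀ k, (I k).Finite) (hpos : ∀ k x, 0 < r k x)
    (hscale : ∀ k x y, 5000 * r (k + 1) x ≤ r k y)
    (hdisj : ∀ k, (I k).PairwiseDisjoint fun x => ball x (5 * r k x))
    (hcover : ∀ k, ∀ z ∈ E, ∃ y ∈ I k, dist z y ≤ 25 * r k y) (x₀ : X) (h0 : I 0 = {x₀}) :
    ∃ (T : ℕ → X → X) (par : ℕ → X → X),
      (∀ k, ∀ z ∈ E, T k z ∈ I k ∧ dist z (T k z) ≤ 26 * r k (T k z)) ∧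
      (∀ k y, MeasurableSet {z ∈ E | T k z = y}) ∧
      (∀ k, ∀ z ∈ E, par k (T (k + 1) z) = T k z) ∧
      (∀ k, ∀ z ∈ E, ∀ y ∈ I k, dist z y < r k y → T k z = y) := by
  have : Nonempty X := ⟨x₀⟩
  -- The parent is forced on the doubled ball, not only on the ball of radius `r k y'`: a point of
  -- the latter is represented by a net point of the next generation, which may lie slightly
  -- outside.
  have hp : ∀ k (x : X), ∃ y, x ∈ E → (y ∈ I k ∧ dist x y ≤ 25 * r k y ∧
      ∀ y' ∈ I k, dist x y' < 2 * r k y' → y = y') := by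
    intro k x
    by_cases hx : x ∈ E
    · by_cases hex : ∃ y' ∈ I k, dist x y' < 2 * r k y'
      · obtain ⟨y, hy, hxy⟩ := hex
        refine ⟨y, fun _ => ⟨hy, by linarith [hpos k y], fun y' hy' hxy' => ?_⟩⟩
        by_contra hne
        exact Set.disjoint_left.1 (hdisj k hy hy' hne)
          (show dist x y < 5 * r k y by linarith [hpos k y])
          (show dist x y' < 5 * r k y' by linarith [hpos k y'])
      · obtain ⟨y, hy, hxy⟩ := hcover k x hx
        exact ⟨y, fun _ => ⟨hy, hxy, fun y' hy' hxy' => absurd ⟨y', hy', hxy'⟩ hex⟩⟩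
    · exact ⟨x, fun h => absurd h hx⟩
  choose par hpar using hp
  have hpar1 : ∀ k, ∀ x ∈ I (k + 1), par k x ∈ I k := fun k x hx => (hpar k x (hsub _ hx)).1
  have hpar2 : ∀ k, ∀ x ∈ I (k + 1),
      par k x ∈ I k ∧ dist x (par k x) ≤ 25 * r k (par k x) :=
    fun k x hx => ⟨(hpar k x (hsub _ hx)).1, (hpar k x (hsub _ hx)).2.1⟩
  let F := limitCell E I r par
  let P : ℕ → (X → X) → Prop := fun k t =>
    (∀ z ∈ E, t z ∈ I k ∧ z ∈ F k (t z)) ∧ ∀ y, MeasurableSet {z ∈ E | t z = y}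
  have start : P 0 fun _ => x₀ := by
    refine ⟨fun z hz => ⟨by simp [h0], hz, ?_⟩, fun y => ?_⟩
    -- Generation 0 has the single centre `x₀`, so every net point near `z` descends from it.
    · refine Filter.Eventually.frequently (Filter.Eventually.of_forall fun i => ?_)
      obtain ⟨x, hx, hzx⟩ := hcover (0 + i) z hz
      refine ⟨x, hx, ?_, hzx⟩
      have := treeAncestor_mem hpar1 0 i x hx
      rw [h0] at this
      exact this
    · by_cases h : x₀ = y
      · simpa [h] using hE
      · simp [h]
  -- Among the children of `t z`, a child whose limit cell still contains `z` is selected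
  -- measurably; this invariant lets the recursion continue.
  have step : ∀ k t, P k t → ∃ t', P (k + 1) t' ∧ ∀ z ∈ E, par k (t' z) = t z := by
    rintro k t ⟨ht, htm⟩
    obtain ⟨t', h1, h2⟩ := exists_measurable_selection (hfin (k + 1))
      (fun y' => {z ∈ E | t z = par k y'} ∩ F (k + 1) y')
      (fun y' _ => (htm _).inter (measurableSet_limitCell hE hfin r par _ _)) E hE (by
        intro z hz
        have := limitCell_subset hfin r hpar1 k (t z) (ht z hz).2
        simp only [mem_iUnion, exists_prop] at this ⊢
        obtain ⟨y', hy', hzy'⟩ := this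
        exact ⟨y', hy'.1, ⟨hz, hy'.2.symm⟩, hzy'⟩)
    exact ⟨t', ⟨fun z hz => ⟨(h1 z hz).1, (h1 z hz).2.2⟩, h2⟩, fun z hz => (h1 z hz).2.1.2.symm⟩
  choose! next hnext using step
  let T : ℕ → X → X := fun k => Nat.rec (fun _ => x₀) (fun k t => next k t) k
  have hT : ∀ k, P k (T k) := by
    intro k
    induction k with
    | zero => exact start
    | succ k ih => exact (hnext k (T k) ih).1
  have hTp : ∀ k, ∀ z ∈ E, par k (T (k + 1) z) = T k z := fun k => (hnext k (T k) (hT k)).2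
  have hd : ∀ k, ∀ z ∈ E, dist z (T k z) ≤ 26 * r k (T k z) := fun k z hz =>
    dist_le_of_mem_limitCell hpos hscale hpar2 ((hT k).1 z hz).2
  refine ⟨T, par, fun k z hz => ⟨((hT k).1 z hz).1, hd k z hz⟩, fun k => (hT k).2, hTp, ?_⟩
  intro k z hz y hy hzy
  rw [← hTp k z hz]
  have hu := ((hT (k + 1)).1 z hz).1
  refine (hpar k _ (hsub _ hu)).2.2 y hy ?_
  have h1 := hd (k + 1) z hz
  have h2 := hscale k (T (k + 1) z) y
  have h3 := hpos (k + 1) (T (k + 1) z)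
  linarith [dist_triangle (T (k + 1) z) z y, dist_comm z (T (k + 1) z)]

end Tree

/-! ### Doubling radii, nets and their nested partitions -/

theorem isFiniteMeasure_of_isCompact_support {d : ℕ} (μ : Measure (Eucl d))
    [IsLocallyFiniteMeasure μ] (hc : IsCompact μ.support) : IsFiniteMeasure μ := by
  refine ⟨?_⟩
  rw [← union_compl_self μ.support]
  refine (measure_union_le _ _).trans_lt ?_
  rw [Measure.measure_compl_support, add_zero]
  exact hc.measure_lt_top

/-- Either some radius `r ∈ [a, 100 ^ N * a]` is doubling, or `μ` decays very fast around `x`. -/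
theorem exists_doubling_radius {d : ℕ} (μ : Measure (Eucl d)) (x : Eucl d) {a : ℝ} (ha : 0 < a)
    {N : ℕ} (hN : 1 ≤ N) :
    ∃ r, a ≤ r ∧ r ≤ 100 ^ N * a ∧
      (μ (ball x (100 * r)) ≤ ENNReal.ofReal (100 ^ N) * μ (ball x r) ∨
        ENNReal.ofReal (100 ^ N) ^ (N - 1) * μ (ball x (100 * r)) ≤
          μ (ball x (100 ^ N * a))) := by
  by_cases h : ∃ i < N, μ (ball x (100 * (100 ^ i * a))) ≤
      ENNReal.ofReal (100 ^ N) * μ (ball x (100 ^ i * a))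
  · obtain ⟨i, hi, h⟩ := h
    refine ⟨100 ^ i * a, ?_, ?_, Or.inl h⟩
    · exact le_mul_of_one_le_left ha.le (one_le_pow₀ (by norm_num))
    · gcongr; norm_num
  · push Not at h
    refine ⟨a, le_rfl, le_mul_of_one_le_left ha.le (one_le_pow₀ (by norm_num)), Or.inr ?_⟩
    -- The radii `100 * a, …, 100 ^ (N - 1) * a` each gain a factor `100 ^ N`. The radius `a` is not
    -- used, since the count starts from the ball of radius `100 * a`; hence the exponent `N - 1`.
    have key : ∀ j, j + 1 ≤ N → ENNReal.ofReal (100 ^ N) ^ j * μ (ball x (100 * a)) ≤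
        μ (ball x (100 ^ (j + 1) * a)) := by
      intro j
      induction j with
      | zero => intro _; simp
      | succ j ih =>
        intro hj
        have h1 := ih (by omega)
        have h2 := (h (j + 1) (by omega)).le
        calc ENNReal.ofReal (100 ^ N) ^ (j + 1) * μ (ball x (100 * a))
            = ENNReal.ofReal (100 ^ N) * (ENNReal.ofReal (100 ^ N) ^ j * μ (ball x (100 * a))) := by
              rw [pow_succ]; ring
          _ ≤ ENNReal.ofReal (100 ^ N) * μ (ball x (100 ^ (j + 1) * a)) := by gcongr
          _ ≤ _ := h2
          _ = _ := by congr 2; ring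
    have := key (N - 1) (by omega)
    rwa [Nat.sub_add_cancel hN] at this

/-- The centers `I` and radii `r` of one generation of cubes at scale `a`. -/
structure IsNet {d : ℕ} (μ : Measure (Eucl d)) (N : ℕ) (a : ℝ) (I : Set (Eucl d))
    (r : Eucl d → ℝ) : Prop where
  sub : I ⊆ μ.support
  fin : I.Finite
  le : ∀ x, a ≤ r x
  le' : ∀ x, r x ≤ 100 ^ N * a
  disj : I.PairwiseDisjoint fun x => ball x (5 * r x)
  cover : ∀ z ∈ μ.support, ∃ y ∈ I, dist z y ≤ 25 * r y
  doubling : ∀ y, μ (ball y (100 * r y)) ≤ ENNReal.ofReal (100 ^ N) * μ (ball y (r y)) ∨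
    ENNReal.ofReal (100 ^ N) ^ (N - 1) * μ (ball y (100 * r y)) ≤ μ (ball y (100 ^ N * a))

theorem exists_isNet {d : ℕ} (μ : Measure (Eucl d)) (hc : IsCompact μ.support) {N : ℕ}
    (hN : 1 ≤ N) {a : ℝ} (ha : 0 < a) : ∃ I r, IsNet μ N a I r := by
  choose r h1 h2 h3 using fun x => exists_doubling_radius μ x ha hN
  -- Vitali is applied to the balls of radius `5 * r`, which are to be disjoint; enlarging by 5
  -- gives the covering radius `25 * r`.
  obtain ⟨I, hI, hdisj, hcov⟩ := Vitali.exists_disjoint_subfamily_covering_enlargement_closedBall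
    μ.support id (fun x => 5 * r x) (5 * (100 ^ N * a)) (fun x _ => by gcongr; exact h2 x) 5
    (by norm_num)
  have hdisj' : I.PairwiseDisjoint fun x => ball x (5 * r x) :=
    fun x hx y hy hxy => (hdisj hx hy hxy).mono ball_subset_closedBall ball_subset_closedBall
  obtain ⟨R, hR⟩ := hc.isBounded.subset_ball 0
  refine ⟨I, r, hI, ?_, h1, h2, hdisj', ?_, h3⟩
  · refine finite_of_disjoint_balls I id (fun x => 5 * r x) (δ := a) (y := 0) (R := |R| + a) ha
      (fun x _ => by linarith [h1 x]) hdisj' (by positivity) (fun x hx => ?_)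
    have := hR (hI hx)
    rw [mem_ball] at this
    refine ball_subset_ball' ?_
    simp only [id]
    linarith [le_abs_self R]
  · intro z hz
    obtain ⟨y, hy, hzy⟩ := hcov z hz
    refine ⟨y, hy, ?_⟩
    have : z ∈ closedBall y (5 * (5 * r y)) := hzy (mem_closedBall_self (by linarith [h1 z]))
    rw [mem_closedBall] at this
    linarith

/-- Nets at the scales `ρ A₀ ^ (-k)`, together with nested partitions of `supp μ`. -/
structure IsNestedNet {d : ℕ} (μ : Measure (Eucl d)) (N : ℕ) (A₀ ρ : ℝ) (I : ℕ → Set (Eucl d))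
    (r : ℕ → Eucl d → ℝ) (T : ℕ → Eucl d → Eucl d) : Prop where
  net : ∀ k, IsNet μ N (ρ * (A₀ ^ k)⁻¹) (I k) (r k)
  root_doubling : ∀ y ∈ I 0,
    μ (ball y (100 * r 0 y)) ≤ ENNReal.ofReal (100 ^ N) * μ (ball y (r 0 y))
  mem : ∀ k, ∀ z ∈ μ.support, T k z ∈ I k
  dist_le : ∀ k, ∀ z ∈ μ.support, dist z (T k z) ≤ 26 * r k (T k z)
  meas : ∀ k y, MeasurableSet {z ∈ μ.support | T k z = y}
  nested : ∀ k m, ∀ z ∈ μ.support, ∀ z' ∈ μ.support, T (k + m) z = T (k + m) z' → T k z = T k z'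
  eq_of_dist_lt : ∀ k, ∀ z ∈ μ.support, ∀ y ∈ I k, dist z y < r k y → T k z = y

/-- The nets are taken independently at all scales, except that the top one is replaced by a single
centre of radius `100 ^ N * ρ`. Its ball contains the whole support, as the diameter is at most `ρ`,
so it is doubling for trivial reasons. -/
theorem exists_isNestedNet {d : ℕ} (μ : Measure (Eucl d)) [IsLocallyFiniteMeasure μ]
    (hc : IsCompact μ.support) (hμ : μ ≠ 0) {N : ℕ} (hN : 1 ≤ N) {A₀ ρ : ℝ}
    (hA : 5000 * 100 ^ N < A₀) (hρ : 0 < ρ) (hdiam : diam μ.support ≤ ρ) :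
    ∃ (I : ℕ → Set (Eucl d)) (r : ℕ → Eucl d → ℝ) (T : ℕ → Eucl d → Eucl d) (x₀ : Eucl d),
      IsNestedNet μ N A₀ ρ I r T ∧ I 0 = {x₀} := by
  have hA0 : 0 < A₀ := lt_trans (by positivity) hA
  have h100 : (100 : ℝ) ≤ 100 ^ N := le_self_pow₀ (by norm_num) (by omega)
  obtain ⟨x₀, hx₀⟩ := Measure.nonempty_support hμ
  have hsupp : μ.support ⊆ ball x₀ (100 ^ N * ρ) := fun z hz => by
    have := dist_le_diam_of_mem hc.isBounded hz hx₀
    rw [mem_ball]; nlinarith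
  have hball : ∀ s, 100 ^ N * ρ ≤ s → μ (ball x₀ s) = μ univ := by
    intro s hs
    refine le_antisymm (measure_mono (subset_univ _)) ?_
    rw [← union_compl_self μ.support]
    refine (measure_union_le _ _).trans ?_
    rw [Measure.measure_compl_support, add_zero]
    exact measure_mono (hsupp.trans (ball_subset_ball hs))
  have hroot : μ (ball x₀ (100 * (100 ^ N * ρ))) ≤
      ENNReal.ofReal (100 ^ N) * μ (ball x₀ (100 ^ N * ρ)) := by
    rw [hball _ le_rfl, hball _ (by nlinarith)]
    refine le_mul_of_one_le_left' ?_
    rw [ENNReal.one_le_ofReal]; linarith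
  have hnet : ∀ k, ∃ (I : Set (Eucl d)) (r : Eucl d → ℝ), IsNet μ N (ρ * (A₀ ^ k)⁻¹) I r ∧
      (k = 0 → I = {x₀} ∧ r x₀ = 100 ^ N * ρ) := by
    intro k
    obtain ⟨I, r, h⟩ := exists_isNet μ hc hN (a := ρ * (A₀ ^ k)⁻¹) (by positivity)
    cases k with
    | succ k => exact ⟨I, r, h, fun h => absurd h (by simp)⟩
    | zero =>
      classical
      refine ⟨{x₀}, Function.update r x₀ (100 ^ N * ρ), ?_, by simp⟩
      refine ⟨by simpa using hx₀, by simp, fun x => ?_, fun x => ?_, by simp, ?_, fun y => ?_⟩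
      · by_cases hx : x = x₀
        · subst hx; simp; nlinarith
        · rw [Function.update_of_ne hx]; exact h.le x
      · by_cases hx : x = x₀
        · subst hx; simp
        · rw [Function.update_of_ne hx]; exact h.le' x
      · intro z hz
        refine ⟨x₀, rfl, ?_⟩
        have := hsupp hz
        rw [mem_ball] at this
        rw [Function.update_self]
        have : 0 < 100 ^ N * ρ := by positivity
        linarith
      · by_cases hx : y = x₀
        · subst hx; left; rw [Function.update_self]; exact hroot
        · rw [Function.update_of_ne hx]; exact h.doubling y
  choose I r hnet hzero using hnet
  obtain ⟨hI0, hr0⟩ := hzero 0 rfl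
  have hpos : ∀ k x, 0 < r k x := fun k x => lt_of_lt_of_le (by positivity) ((hnet k).le x)
  obtain ⟨T, par, hT, hTm, hTp, hTe⟩ := exists_nested_partitions
    Measure.isClosed_support.measurableSet I r (fun k => (hnet k).sub) (fun k => (hnet k).fin) hpos
    (fun k x y => by
      refine le_trans ?_ ((hnet k).le y)
      have h1 := (hnet (k + 1)).le' x
      have h2 : 5000 * (100 ^ N * (ρ * (A₀ ^ (k + 1))⁻¹)) ≤ ρ * (A₀ ^ k)⁻¹ := by
        have e : 5000 * (100 ^ N * (ρ * (A₀ ^ (k + 1))⁻¹)) =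
            (5000 * 100 ^ N) / A₀ * (ρ * (A₀ ^ k)⁻¹) := by
          field_simp
          ring
        rw [e]
        exact mul_le_of_le_one_left (by positivity) ((div_le_one hA0).2 hA.le)
      linarith) (fun k => (hnet k).disj) (fun k => (hnet k).cover) x₀ hI0
  refine ⟨I, r, T, x₀, ⟨hnet, ?_, fun k z hz => (hT k z hz).1, fun k z hz => (hT k z hz).2, hTm, ?_,
    hTe⟩, hI0⟩
  · intro y hy
    rw [hI0] at hy
    obtain rfl : y = x₀ := hy
    rw [hr0]; exact hroot
  · intro k m z hz z' hz' h
    induction m with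
    | zero => exact h
    | succ m ih =>
      apply ih
      rw [← hTp _ z hz, ← hTp _ z' hz']
      congr 1

/-! ### The cubes of a nested net form a David–Mattila lattice -/

noncomputable section

/-- The cube of generation `k` with centre `y` of a nested net. -/
def netCube {d : ℕ} (μ : Measure (Eucl d)) (r : ℕ → Eucl d → ℝ) (T : ℕ → Eucl d → Eucl d)
    (k : ℕ) (y : Eucl d) : Cube d :=
  ⟨k, {z ∈ μ.support | T k z = y}, y, r k y⟩

/-- All cubes of a nested net. -/
def netCubes {d : ℕ} (μ : Measure (Eucl d)) (I : ℕ → Set (Eucl d)) (r : ℕ → Eucl d → ℝ)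
    (T : ℕ → Eucl d → Eucl d) : Set (Cube d) :=
  {Q | ∃ k, ∃ y ∈ I k, Q = netCube μ r T k y}

namespace IsNestedNet

variable {d : ℕ} {μ : Measure (Eucl d)} {N : ℕ} {A₀ ρ : ℝ} {I : ℕ → Set (Eucl d)}
  {r : ℕ → Eucl d → ℝ} {T : ℕ → Eucl d → Eucl d}

theorem radius_pos (h : IsNestedNet μ N A₀ ρ I r T) (hA : 5000 * 100 ^ N < A₀) (hρ : 0 < ρ)
    (k : ℕ) (y : Eucl d) : 0 < r k y := by
  have hA0 : 0 < A₀ := lt_trans (by positivity) hA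
  exact lt_of_lt_of_le (by positivity) ((h.net k).le y)

theorem self_eq (h : IsNestedNet μ N A₀ ρ I r T) (hA : 5000 * 100 ^ N < A₀) (hρ : 0 < ρ)
    {k : ℕ} {y : Eucl d} (hy : y ∈ I k) : T k y = y :=
  h.eq_of_dist_lt k y ((h.net k).sub hy) y hy (by
    rw [dist_self]; exact h.radius_pos hA hρ k y)

theorem ball_succ_subset (h : IsNestedNet μ N A₀ ρ I r T) (hA : 5000 * 100 ^ N < A₀) (hρ : 0 < ρ)
    (k : ℕ) {z : Eucl d} (hz : z ∈ μ.support) {s : ℝ}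
    (hsr : s * (ρ * (A₀ ^ (k + 1))⁻¹) ≤ r k (T k z)) :
    ball (T (k + 1) z) (s * (ρ * (A₀ ^ (k + 1))⁻¹)) ⊆ ball (T k z) (100 * r k (T k z)) := by
  have hA0 : 0 < A₀ := lt_trans (by positivity) hA
  apply ball_subset_ball'
  have h1 := h.dist_le k z hz
  have h2 := h.dist_le (k + 1) z hz
  have h3 := (h.net (k + 1)).le' (T (k + 1) z)
  have h4 : 100 ^ N * (ρ * (A₀ ^ (k + 1))⁻¹) ≤ ρ * (A₀ ^ k)⁻¹ := by
    have e : 100 ^ N * (ρ * (A₀ ^ (k + 1))⁻¹) = 100 ^ N / A₀ * (ρ * (A₀ ^ k)⁻¹) := by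
      rw [pow_succ]; field_simp
    rw [e]
    refine mul_le_of_le_one_left (by positivity) ((div_le_one hA0).2 ?_)
    have : (0 : ℝ) < 100 ^ N := by positivity
    linarith
  have h5 := (h.net k).le (T k z)
  have := dist_triangle (T (k + 1) z) z (T k z)
  rw [dist_comm (T (k + 1) z) z] at this
  have := h.radius_pos hA hρ k (T k z)
  linarith

theorem scale_succ_le (h : IsNestedNet μ N A₀ ρ I r T) (hA : 5000 * 100 ^ N < A₀) (hρ : 0 < ρ)
    (k : ℕ) (y : Eucl d) : 5000 * (100 ^ N * (ρ * (A₀ ^ (k + 1))⁻¹)) ≤ r k y := by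
  have hA0 : 0 < A₀ := lt_trans (by positivity) hA
  refine le_trans ?_ ((h.net k).le y)
  have e : 5000 * (100 ^ N * (ρ * (A₀ ^ (k + 1))⁻¹)) =
      (5000 * 100 ^ N) / A₀ * (ρ * (A₀ ^ k)⁻¹) := by
    field_simp
    ring
  rw [e]
  exact mul_le_of_le_one_left (by positivity) ((div_le_one hA0).2 hA.le)

theorem measure_ball_succ_le (h : IsNestedNet μ N A₀ ρ I r T) (hA : 5000 * 100 ^ N < A₀)
    (hρ : 0 < ρ) (k : ℕ) {z : Eucl d} (hz : z ∈ μ.support) :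
    μ (ball (T (k + 1) z) (100 * r (k + 1) (T (k + 1) z))) ≤
      μ (ball (T k z) (100 * r k (T k z))) := by
  have hA0 : 0 < A₀ := lt_trans (by positivity) hA
  refine (measure_mono (ball_subset_ball ?_)).trans (measure_mono
    (h.ball_succ_subset hA hρ k hz (s := 100 * 100 ^ N) ?_))
  · have := (h.net (k + 1)).le' (T (k + 1) z)
    linarith
  · have := h.scale_succ_le hA hρ k (T k z)
    have h0 : 0 < 100 ^ N * (ρ * (A₀ ^ (k + 1))⁻¹) := by positivity
    linarith

/-- If the chosen radius is not doubling, the fast decay alternative of the net holds, and the large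
ball in it, of radius `100 ^ N` times the scale, is inside `100 B` of the parent. -/
theorem measure_ball_succ_le_of_not_doubling (h : IsNestedNet μ N A₀ ρ I r T)
    (hA : 5000 * 100 ^ N < A₀) (hρ : 0 < ρ) (hAN : A₀ ^ (10 * d) ≤ (100 ^ N) ^ (N - 1))
    (k : ℕ) {z : Eucl d} (hz : z ∈ μ.support)
    (hnd : ¬ (netCube μ r T (k + 1) (T (k + 1) z)).Doubling (100 ^ N) μ) :
    ENNReal.ofReal A₀ ^ (10 * d) * μ (ball (T (k + 1) z) (100 * r (k + 1) (T (k + 1) z))) ≤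
      μ (ball (T k z) (100 * r k (T k z))) := by
  have hA0 : 0 < A₀ := lt_trans (by positivity) hA
  have h1 : ENNReal.ofReal A₀ ^ (10 * d) ≤ ENNReal.ofReal (100 ^ N) ^ (N - 1) := by
    rw [← ENNReal.ofReal_pow hA0.le, ← ENNReal.ofReal_pow (by positivity)]
    exact ENNReal.ofReal_le_ofReal hAN
  rcases (h.net (k + 1)).doubling (T (k + 1) z) with h2 | h2
  · refine absurd ?_ hnd
    simpa [Cube.Doubling, netCube, Cube.ballB] using h2
  · refine (mul_le_mul_left h1 _).trans (h2.trans (measure_mono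
      (h.ball_succ_subset hA hρ k hz ?_)))
    have := h.scale_succ_le hA hρ k (T k z)
    have h0 : 0 < 100 ^ N * (ρ * (A₀ ^ (k + 1))⁻¹) := by positivity
    linarith

theorem measure_ball_chain (h : IsNestedNet μ N A₀ ρ I r T)
    (hA : 5000 * 100 ^ N < A₀) (hρ : 0 < ρ) (hAN : A₀ ^ (10 * d) ≤ (100 ^ N) ^ (N - 1))
    (k : ℕ) {z : Eucl d} (hz : z ∈ μ.support) (m : ℕ)
    (hnd : ∀ i, k < i → i ≤ k + m → ¬ (netCube μ r T i (T i z)).Doubling (100 ^ N) μ) :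
    ENNReal.ofReal A₀ ^ (10 * d * m) * μ (ball (T (k + m) z) (100 * r (k + m) (T (k + m) z))) ≤
      μ (ball (T k z) (100 * r k (T k z))) := by
  induction m with
  | zero => simp
  | succ m ih =>
    have h1 := h.measure_ball_succ_le_of_not_doubling hA hρ hAN (k + m) hz
      (hnd (k + m + 1) (by omega) (by omega))
    refine le_trans ?_ (ih fun i hi hi' => hnd i hi (by omega))
    rw [Nat.mul_succ, pow_add, mul_assoc]
    exact mul_le_mul_right h1 _

theorem exists_mem_of_mem_netCubes (h : IsNestedNet μ N A₀ ρ I r T) (hA : 5000 * 100 ^ N < A₀)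
    (hρ : 0 < ρ) {Q : Cube d} (hQ : Q ∈ netCubes μ I r T) :
    Q.center ∈ Q.carrier := by
  obtain ⟨k, y, hy, rfl⟩ := hQ
  exact ⟨(h.net k).sub hy, h.self_eq hA hρ hy⟩

/-- A cube is determined by its generation and any of its points. -/
theorem eq_netCube {Q : Cube d} (hQ : Q ∈ netCubes μ I r T) {z : Eucl d} (hz : z ∈ Q.carrier) :
    Q = netCube μ r T Q.gen (T Q.gen z) := by
  obtain ⟨k, y, hy, rfl⟩ := hQ
  obtain ⟨_, hz⟩ := hz
  subst hz
  rfl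

theorem netCube_mem (h : IsNestedNet μ N A₀ ρ I r T) (k : ℕ) {z : Eucl d} (hz : z ∈ μ.support) :
    netCube μ r T k (T k z) ∈ netCubes μ I r T :=
  ⟨k, _, h.mem k z hz, rfl⟩

theorem netCube_subset (h : IsNestedNet μ N A₀ ρ I r T) {k l : ℕ} (hkl : k ≤ l) {z : Eucl d}
    (hz : z ∈ μ.support) :
    (netCube μ r T l (T l z)).carrier ⊆ (netCube μ r T k (T k z)).carrier := by
  obtain ⟨m, rfl⟩ := Nat.exists_eq_add_of_le hkl
  rintro w ⟨hw, hw'⟩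
  exact ⟨hw, h.nested k m w hw z hz hw'⟩

/-- Each non-doubling generation gains `A₀ ^ (10 * d)` in measure, while the change of radius costs
at most `A₀ ^ d` because `n < d`; the exponent `9 * d` is what remains. -/
theorem density_drop (h : IsNestedNet μ N A₀ ρ I r T)
    (hA : 5000 * 100 ^ N < A₀) (hρ : 0 < ρ) (hAN : A₀ ^ (10 * d) ≤ (100 ^ N) ^ (N - 1))
    {n : ℕ} (hnd : n < d) {Q R : Cube d} (hQ : Q ∈ netCubes μ I r T) (hR : R ∈ netCubes μ I r T)
    (hQR : Q.Sub R)
    (hnon : ∀ S ∈ netCubes μ I r T, Q.SSub S → S.SSub R → ¬ S.Doubling (100 ^ N) μ) :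
    Q.densB n μ 100 ≤
      ENNReal.ofReal
        ((100 ^ N * A₀) ^ d * A₀ ^ (-(9 * (d : ℤ) * ((Q.gen : ℤ) - (R.gen : ℤ) - 1)))) *
        R.densB n μ 100 := by
  have hA0 : 0 < A₀ := lt_trans (by positivity) hA
  have hC1 : (1 : ℝ) ≤ 100 ^ N := one_le_pow₀ (by norm_num)
  have hA1 : 1 ≤ A₀ := by linarith
  have hzQ := h.exists_mem_of_mem_netCubes hA hρ hQ
  set z := Q.center with hzdef
  have hQe := eq_netCube hQ hzQ
  have hRe := eq_netCube hR (hQR.2 hzQ)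
  have hz : z ∈ μ.support := by rw [hQe] at hzQ; exact hzQ.1
  clear_value z
  obtain ⟨m, hm⟩ := Nat.exists_eq_add_of_le hQR.1
  set k := R.gen with hk
  set l := Q.gen with hl
  clear_value k l
  subst hm hQe hRe
  set U := μ (ball (T (k + m) z) (100 * r (k + m) (T (k + m) z))) with hU
  set w := μ (ball (T k z) (100 * r k (T k z))) with hw
  -- `Q` itself may be doubling: only the cubes strictly between gain, and the step from `Q` to its
  -- parent is plain monotonicity.
  have hUw : ENNReal.ofReal A₀ ^ (10 * d * (m - 1)) * U ≤ w := by
    cases m with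
    | zero => simp [hU, hw]
    | succ j =>
      rw [Nat.add_sub_cancel]
      refine le_trans ?_ (h.measure_ball_chain hA hρ hAN k hz j fun i hi hi' => ?_)
      · exact mul_le_mul_right (h.measure_ball_succ_le hA hρ (k + j) hz) _
      · refine hnon _ (h.netCube_mem i hz) ⟨?_, h.netCube_subset (by omega) hz⟩
          ⟨hi, h.netCube_subset hi.le hz⟩
        change i < k + (j + 1)
        omega
  set q := r (k + m) (T (k + m) z) with hq
  set v := r k (T k z) with hv
  have hq0 : 0 < q := h.radius_pos hA hρ _ _
  have hv0 : 0 < v := h.radius_pos hA hρ _ _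
  have hqv : v ≤ 100 ^ N * A₀ ^ m * q := by
    have h1 := (h.net (k + m)).le (T (k + m) z)
    have h2 := (h.net k).le' (T k z)
    calc v ≤ 100 ^ N * (ρ * (A₀ ^ k)⁻¹) := h2
      _ = 100 ^ N * A₀ ^ m * (ρ * (A₀ ^ (k + m))⁻¹) := by rw [pow_add]; field_simp
      _ ≤ _ := by gcongr
  have hqvn : v ^ n ≤ (100 ^ N * A₀ ^ m) ^ d * q ^ n := by
    calc v ^ n ≤ (100 ^ N * A₀ ^ m * q) ^ n := by gcongr
      _ = (100 ^ N * A₀ ^ m) ^ n * q ^ n := mul_pow _ _ _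
      _ ≤ _ := by
        gcongr
        exact one_le_mul_of_one_le_of_one_le hC1 (one_le_pow₀ hA1)
  set K : ℝ := (100 ^ N * A₀) ^ d * A₀ ^ (-(9 * (d : ℤ) * (((k + m : ℕ) : ℤ) - (k : ℤ) - 1)))
    with hK
  have hK0 : 0 < K := by positivity
  -- For `m = 0` the natural subtraction `m - 1` is 0, whereas the integer exponent in `K` becomes
  -- `+9 * d`; this case is therefore separate.
  have hKb : (100 ^ N * A₀ ^ m) ^ d ≤ K * A₀ ^ (10 * d * (m - 1)) := by
    cases m with
    | zero =>
      have e : -(9 * (d : ℤ) * (((k + 0 : ℕ) : ℤ) - (k : ℤ) - 1)) = ((9 * d : ℕ) : ℤ) := by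
        push_cast; ring
      rw [hK, e, zpow_natCast, mul_pow, mul_pow]
      simp only [pow_zero, one_pow, mul_one, Nat.zero_sub, mul_zero]
      have h1 : (1 : ℝ) ≤ A₀ ^ d := one_le_pow₀ hA1
      have h2 : (1 : ℝ) ≤ A₀ ^ (9 * d) := one_le_pow₀ hA1
      have h3 : (0 : ℝ) < (100 ^ N) ^ d := by positivity
      calc ((100 : ℝ) ^ N) ^ d = (100 ^ N) ^ d * 1 * 1 := by ring
        _ ≤ _ := by gcongr
    | succ j =>
      have e : -(9 * (d : ℤ) * (((k + (j + 1) : ℕ) : ℤ) - (k : ℤ) - 1)) = -((9 * d * j : ℕ) : ℤ) := by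
        push_cast; ring
      rw [hK, e, zpow_neg, zpow_natCast, Nat.add_sub_cancel]
      have e2 : A₀ ^ (10 * d * j) = A₀ ^ (9 * d * j) * (A₀ ^ j) ^ d := by
        rw [← pow_mul, ← pow_add]; congr 1; ring
      rw [e2]
      apply le_of_eq
      rw [pow_succ]
      field_simp
      rw [← mul_pow]
      congr 1
      ring
  simp only [Cube.densB, density, netCube]
  change U / ENNReal.ofReal ((100 * q) ^ n) ≤ ENNReal.ofReal K * (w / ENNReal.ofReal ((100 * v) ^ n))
  calc U / ENNReal.ofReal ((100 * q) ^ n)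
      = ENNReal.ofReal (((100 * q) ^ n)⁻¹) * U := by
        rw [ENNReal.ofReal_inv_of_pos (by positivity), ENNReal.div_eq_inv_mul]
    _ ≤ ENNReal.ofReal (K * ((100 * v) ^ n)⁻¹ * A₀ ^ (10 * d * (m - 1))) * U := by
        gcongr
        rw [mul_pow, mul_pow]
        have : (100 ^ n * q ^ n)⁻¹ = (100 ^ n * v ^ n)⁻¹ * (v ^ n / q ^ n) := by
          field_simp
        rw [this, mul_comm K, mul_assoc]
        gcongr
        rw [div_le_iff₀ (by positivity)]
        exact hqvn.trans (by gcongr)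
    _ = ENNReal.ofReal K * ((ENNReal.ofReal A₀ ^ (10 * d * (m - 1)) * U) /
          ENNReal.ofReal ((100 * v) ^ n)) := by
        rw [ENNReal.ofReal_mul (by positivity), ENNReal.ofReal_mul hK0.le,
          ENNReal.ofReal_inv_of_pos (by positivity), ENNReal.div_eq_inv_mul,
          ENNReal.ofReal_pow hA0.le]
        ring
    _ ≤ _ := by gcongr

/-- A point outside all doubling cubes of `R` has only non-doubling cubes below `R`. At depth `m`
such cubes have measure at most `A₀ ^ (-10 * d * m)` times the total, and there are only about `A₀ ^
(d * m)` of them, so the set of these points is null. -/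
theorem doubling_cover (h : IsNestedNet μ N A₀ ρ I r T) [IsFiniteMeasure μ] (hd : 0 < d)
    (hc : IsCompact μ.support)
    (hA : 5000 * 100 ^ N < A₀) (hρ : 0 < ρ) (hdiam : diam μ.support ≤ ρ)
    (hAN : A₀ ^ (10 * d) ≤ (100 ^ N) ^ (N - 1))
    {R : Cube d} (hR : R ∈ netCubes μ I r T) :
    ∃ F ⊆ doublingCubes (100 ^ N) μ (netCubes μ I r T),
      (∀ Q ∈ F, Q.Sub R) ∧ μ (R.carrier \ ⋃ Q ∈ F, Q.carrier) = 0 := by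
  have hA0 : 0 < A₀ := lt_trans (by positivity) hA
  have hC1 : (1 : ℝ) ≤ 100 ^ N := one_le_pow₀ (by norm_num)
  have hA1 : 1 < A₀ := by linarith
  refine ⟨{Q | Q ∈ doublingCubes (100 ^ N) μ (netCubes μ I r T) ∧ Q.Sub R}, fun Q hQ => hQ.1,
    fun Q hQ => hQ.2, ?_⟩
  set S := R.carrier \ ⋃ Q ∈ {Q | Q ∈ doublingCubes (100 ^ N) μ (netCubes μ I r T) ∧ Q.Sub R},
    Q.carrier with hS
  obtain ⟨k, y, hy, rfl⟩ := hR
  have hSE : S ⊆ μ.support := fun z hz => hz.1.1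
  have hSk : ∀ z ∈ S, T k z = y := fun z hz => hz.1.2
  have hnd : ∀ z ∈ S, ∀ i, k ≤ i → ¬ (netCube μ r T i (T i z)).Doubling (100 ^ N) μ := by
    intro z hz i hi hdb
    apply hz.2
    simp only [mem_iUnion, exists_prop]
    refine ⟨netCube μ r T i (T i z), ⟨⟨h.netCube_mem i (hSE hz), hdb⟩, hi, ?_⟩, hSE hz, rfl⟩
    rw [← hSk z hz]
    exact h.netCube_subset hi (hSE hz)
  have hbound : ∀ m : ℕ, μ S ≤
      ENNReal.ofReal ((3 * A₀ ^ k) ^ d * (A₀⁻¹) ^ m) * μ univ := by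
    intro m
    set δ := ρ * (A₀ ^ (k + m))⁻¹ with hδ
    have hδ0 : 0 < δ := by positivity
    have hδρ : δ ≤ ρ := mul_le_of_le_one_right hρ.le (inv_le_one_of_one_le₀ (one_le_pow₀ hA1.le))
    let J : Set (Eucl d) := {u | u ∈ I (k + m) ∧ ∃ z ∈ S, T (k + m) z = u}
    let c : ℝ≥0∞ := ENNReal.ofReal ((A₀ ^ (10 * d * m))⁻¹) * μ univ
    have hcov : S ⊆ ⋃ u ∈ J, (netCube μ r T (k + m) u).carrier := by
      intro z hz
      simp only [mem_iUnion, exists_prop]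
      exact ⟨T (k + m) z, ⟨h.mem _ z (hSE hz), z, hz, rfl⟩, hSE hz, rfl⟩
    have hJ : ∀ u ∈ J, μ (netCube μ r T (k + m) u).carrier ≤ c := by
      rintro u ⟨hu, z, hz, rfl⟩
      have h1 := h.measure_ball_chain hA hρ hAN k (hSE hz) m fun i hi _ => hnd z hz i hi.le
      have h2 : (netCube μ r T (k + m) (T (k + m) z)).carrier ⊆
          ball (T (k + m) z) (100 * r (k + m) (T (k + m) z)) := by
        rintro w ⟨hw, hw'⟩
        have := h.dist_le (k + m) w hw
        rw [hw'] at this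
        have := h.radius_pos hA hρ (k + m) (T (k + m) z)
        rw [mem_ball]; linarith
      refine (measure_mono h2).trans ?_
      have h3 := h1.trans (measure_mono (subset_univ _))
      have e : c = (ENNReal.ofReal A₀ ^ (10 * d * m))⁻¹ * μ univ := by
        simp only [c]
        rw [ENNReal.ofReal_inv_of_pos (by positivity), ENNReal.ofReal_pow hA0.le]
      rw [e, ← ENNReal.div_eq_inv_mul, ENNReal.le_div_iff_mul_le, mul_comm]
      · exact h3
      · left; positivity
      · left; finiteness
    have hJfin : J.Finite := (h.net (k + m)).fin.subset fun u hu => hu.1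
    have hcard := tsum_const_le_of_disjoint_balls J id (fun u => 5 * r (k + m) u) (δ := δ)
      (y := y) (R := 3 * ρ) hδ0 (fun u _ => by
        have := (h.net (k + m)).le u
        linarith) ((h.net (k + m)).disj.subset fun u hu => hu.1) (by positivity) (fun u hu => by
        apply ball_subset_ball'
        have := dist_le_diam_of_mem hc.isBounded ((h.net _).sub hu.1) ((h.net k).sub hy)
        simp only [id]
        linarith) c
    calc μ S ≤ μ (⋃ u ∈ J, (netCube μ r T (k + m) u).carrier) := measure_mono hcov
      _ ≤ ∑' u : J, μ (netCube μ r T (k + m) u).carrier := measure_biUnion_le _ hJfin.countable _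
      _ ≤ ∑' _ : J, c := ENNReal.tsum_le_tsum fun u => hJ u u.2
      _ ≤ _ := hcard
      _ ≤ _ := by
        rw [← mul_assoc, ← ENNReal.ofReal_mul (by positivity), finrank_euclideanSpace_fin]
        refine mul_le_mul_left (ENNReal.ofReal_le_ofReal ?_) _
        have e : 3 * ρ / δ = 3 * A₀ ^ k * A₀ ^ m := by
          rw [hδ, pow_add]; field_simp
        rw [e, mul_pow, mul_assoc]
        gcongr
        rw [← pow_mul, inv_pow, ← div_eq_mul_inv, div_le_iff₀ (by positivity), ← div_eq_inv_mul,
          le_div_iff₀ (by positivity), ← pow_add]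
        exact pow_le_pow_right₀ hA1.le (by nlinarith)
  have hlim : Filter.Tendsto (fun m : ℕ => ENNReal.ofReal ((3 * A₀ ^ k) ^ d * (A₀⁻¹) ^ m) * μ univ)
      Filter.atTop (nhds 0) := by
    have h1 : Filter.Tendsto (fun m : ℕ => (3 * A₀ ^ k) ^ d * (A₀⁻¹) ^ m) Filter.atTop (nhds 0) := by
      have := (tendsto_pow_atTop_nhds_zero_of_lt_one (inv_nonneg.2 hA0.le)
        (inv_lt_one_of_one_lt₀ hA1)).const_mul ((3 * A₀ ^ k) ^ d)
      simpa using this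
    have h2 := ENNReal.Tendsto.mul_const (b := μ univ) (ENNReal.tendsto_ofReal h1)
      (Or.inr (measure_ne_top μ _))
    simpa using h2
  exact le_antisymm (ge_of_tendsto' hlim hbound) zero_le

theorem isDavidMattilaLattice (h : IsNestedNet μ N A₀ ρ I r T) [IsFiniteMeasure μ]
    (hc : IsCompact μ.support)
    (hA : 5000 * 100 ^ N < A₀) (hρ : 0 < ρ) (hdiam : diam μ.support ≤ ρ)
    (hAN : A₀ ^ (10 * d) ≤ (100 ^ N) ^ (N - 1)) {n : ℕ} (hnd : n < d) :
    IsDavidMattilaLattice n (100 ^ N) A₀ ρ μ (netCubes μ I r T) where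
  measurableSet := by
    rintro _ ⟨k, y, hy, rfl⟩
    exact h.meas k y
  cover := by
    intro k
    ext z
    simp only [mem_iUnion, exists_prop]
    constructor
    · rintro ⟨_, ⟨⟨l, y, hy, rfl⟩, _⟩, hz⟩
      exact hz.1
    · intro hz
      exact ⟨_, ⟨h.netCube_mem k hz, rfl⟩, hz, rfl⟩
  disjoint := by
    intro Q hQ R hR hg hne
    rw [Set.disjoint_left]
    intro z hz hz'
    apply hne
    rw [eq_netCube hQ hz, eq_netCube hR hz', hg]
  nested := by
    intro Q hQ R hR hg
    rw [or_iff_not_imp_left, Set.not_disjoint_iff]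
    rintro ⟨z, hz, hz'⟩
    have hzs : z ∈ μ.support := by
      obtain ⟨k, y, hy, rfl⟩ := hQ
      exact hz.1
    rw [eq_netCube hQ hz, eq_netCube hR hz']
    exact h.netCube_subset hg.le hzs
  center_mem Q hQ := h.exists_mem_of_mem_netCubes hA hρ hQ
  le_radius := by
    rintro _ ⟨k, y, hy, rfl⟩
    exact (h.net k).le y
  radius_le := by
    rintro _ ⟨k, y, hy, rfl⟩
    exact (h.net k).le' y
  ball_subset := by
    rintro _ ⟨k, y, hy, rfl⟩ z ⟨hz, hz'⟩
    refine ⟨hz, h.eq_of_dist_lt k z hz y hy ?_⟩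
    simpa [Cube.ballB, netCube] using hz'
  subset_ball := by
    rintro _ ⟨k, y, hy, rfl⟩ z ⟨hz, hz'⟩
    refine ⟨hz, ?_⟩
    have h1 := h.dist_le k z hz
    have h2 := h.radius_pos hA hρ k y
    rw [hz'] at h1
    simp only [Cube.ballB, netCube, mem_ball]
    linarith
  disjoint_balls := by
    rintro _ ⟨k, y, hy, rfl⟩ _ ⟨l, y', hy', rfl⟩ hg hne
    obtain rfl : k = l := hg
    exact (h.net k).disj hy hy' fun e => hne (by rw [show y = y' from e])
  doubling_cover R hR := h.doubling_cover (by omega) hc hA hρ hdiam hAN hR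
  density_drop Q hQ R hR hQR hnon := h.density_drop hA hρ hAN hnd hQ hR hQR hnon

end IsNestedNet

theorem exists_isDavidMattilaLattice {n d : ℕ} (hnd : n < d) {N : ℕ} (hN : 1 ≤ N) {A₀ : ℝ}
    (hA : 5000 * 100 ^ N < A₀) (hAN : A₀ ^ (10 * d) ≤ (100 ^ N) ^ (N - 1))
    (μ : Measure (Eucl d)) [IsLocallyFiniteMeasure μ] (hc : IsCompact μ.support) (hμ : μ ≠ 0)
    {ρ : ℝ} (hρ : 0 < ρ) (hdiam : diam μ.support ≤ ρ) :
    ∃ D : Set (Cube d), IsDavidMattilaLattice n (100 ^ N) A₀ ρ μ D ∧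
      ∃ R₀ ∈ D, R₀.gen = 0 ∧ R₀.carrier = μ.support ∧ R₀.Doubling (100 ^ N) μ := by
  have := isFiniteMeasure_of_isCompact_support μ hc
  obtain ⟨I, r, T, x₀, h, h0⟩ := exists_isNestedNet μ hc hμ hN hA hρ hdiam
  have hx₀ : x₀ ∈ I 0 := by simp [h0]
  refine ⟨_, h.isDavidMattilaLattice hc hA hρ hdiam hAN hnd, netCube μ r T 0 x₀,
    ⟨0, x₀, hx₀, rfl⟩, rfl, ?_, ?_⟩
  · ext z
    refine ⟨fun hz => hz.1, fun hz => ⟨hz, ?_⟩⟩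
    have := h.mem 0 z hz
    rw [h0] at this
    exact this
  · simpa [Cube.Doubling, netCube, Cube.ballB] using h.root_doubling x₀ hx₀

/-- With `5001 ≤ 100 ^ 2` this compares exponents of 100: the right side is quadratic in `N = 100 *
d`, while the left is only about `10 * d * N`. -/
theorem lattice_parameters {d : ℕ} (hd : 0 < d) :
    ((5001 : ℝ) * 100 ^ (100 * d)) ^ (10 * d) ≤ (100 ^ (100 * d)) ^ (100 * d - 1) := by
  calc ((5001 : ℝ) * 100 ^ (100 * d)) ^ (10 * d) ≤ (100 ^ 2 * 100 ^ (100 * d)) ^ (10 * d) := by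
        gcongr; norm_num
    _ = 100 ^ ((2 + 100 * d) * (10 * d)) := by rw [← pow_add, ← pow_mul]
    _ ≤ 100 ^ (100 * d * (100 * d - 1)) := by
        apply pow_le_pow_right₀ (by norm_num)
        obtain ⟨e, rfl⟩ : ∃ e, d = e + 1 := ⟨d - 1, by omega⟩
        have : 100 * (e + 1) - 1 = 100 * e + 99 := by omega
        rw [this]
        nlinarith
    _ = _ := by rw [← pow_mul]

end

/-! ### Scales, distances and densities in a rooted lattice -/

noncomputable section

/-- The size `ρ A₀ ^ (-k)` of the cubes of generation `k`. -/
def scale (A₀ ρ : ℝ) (k : ℕ) : ℝ := ρ * (A₀ ^ k)⁻¹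

theorem measure_ball_eq_density_mul {d : ℕ} (n : ℕ) (μ : Measure (Eucl d)) (x : Eucl d) {r : ℝ}
    (hr : 0 < r) : μ (ball x r) = density n μ x r * ENNReal.ofReal (r ^ n) := by
  have h : 0 < r ^ n := pow_pos hr n
  rw [density, ENNReal.div_mul_cancel (by simpa using h) ENNReal.ofReal_ne_top]

/-- A David-Mattila lattice of a finite measure whose top cube is the support. -/
structure IsRootedLattice {d : ℕ} (n : ℕ) (C₀ A₀ ρ : ℝ) (μ : Measure (Eucl d)) (D : Set (Cube d))
    (R₀ : Cube d) : Prop where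
  lattice : IsDavidMattilaLattice n C₀ A₀ ρ μ D
  one_lt : 1 < C₀
  lt_A : 5000 * C₀ < A₀
  ρ_pos : 0 < ρ
  finite : μ univ ≠ ∞
  root_mem : R₀ ∈ D
  root_gen : R₀.gen = 0
  root_carrier : R₀.carrier = μ.support
  root_doubling : R₀.Doubling C₀ μ

namespace IsRootedLattice

variable {n d : ℕ} {C₀ A₀ ρ : ℝ} {μ : Measure (Eucl d)} {D : Set (Cube d)} {R₀ : Cube d}

theorem A_pos (h : IsRootedLattice n C₀ A₀ ρ μ D R₀) : 0 < A₀ := by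
  linarith [h.one_lt, h.lt_A]

theorem one_lt_A (h : IsRootedLattice n C₀ A₀ ρ μ D R₀) : 1 < A₀ := by
  linarith [h.one_lt, h.lt_A]

theorem C_pos (h : IsRootedLattice n C₀ A₀ ρ μ D R₀) : 0 < C₀ := by
  linarith [h.one_lt]

theorem scale_pos (h : IsRootedLattice n C₀ A₀ ρ μ D R₀) (k : ℕ) : 0 < scale A₀ ρ k := by
  have := h.A_pos
  have := h.ρ_pos
  unfold scale
  positivity

theorem scale_add (h : IsRootedLattice n C₀ A₀ ρ μ D R₀) (k m : ℕ) :
    A₀ ^ m * scale A₀ ρ (k + m) = scale A₀ ρ k := by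
  have := h.A_pos
  unfold scale
  rw [pow_add]
  field_simp

theorem scale_succ (h : IsRootedLattice n C₀ A₀ ρ μ D R₀) (k : ℕ) :
    A₀ * scale A₀ ρ (k + 1) = scale A₀ ρ k := by
  simpa using h.scale_add k 1

theorem scale_strictAnti (h : IsRootedLattice n C₀ A₀ ρ μ D R₀) : StrictAnti (scale A₀ ρ) := by
  refine strictAnti_nat_of_succ_lt fun k => ?_
  rw [← h.scale_succ k]
  exact lt_mul_of_one_lt_left (h.scale_pos _) h.one_lt_A

theorem exists_scale_lt (h : IsRootedLattice n C₀ A₀ ρ μ D R₀) {t : ℝ} (ht : 0 < t) :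
    ∃ k, scale A₀ ρ k < t := by
  have h1 : Filter.Tendsto (fun k : ℕ => ρ * (A₀⁻¹) ^ k) Filter.atTop (nhds 0) := by
    simpa using (tendsto_pow_atTop_nhds_zero_of_lt_one (inv_nonneg.2 h.A_pos.le)
      (inv_lt_one_of_one_lt₀ h.one_lt_A)).const_mul ρ
  obtain ⟨k, hk⟩ := (h1.eventually (gt_mem_nhds ht)).exists
  exact ⟨k, by rwa [scale, ← inv_pow]⟩

theorem scale_le_radius (h : IsRootedLattice n C₀ A₀ ρ μ D R₀) {Q : Cube d} (hQ : Q ∈ D) :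
    scale A₀ ρ Q.gen ≤ Q.radius := h.lattice.le_radius Q hQ

theorem radius_le (h : IsRootedLattice n C₀ A₀ ρ μ D R₀) {Q : Cube d} (hQ : Q ∈ D) :
    Q.radius ≤ C₀ * scale A₀ ρ Q.gen := h.lattice.radius_le Q hQ

theorem radius_pos (h : IsRootedLattice n C₀ A₀ ρ μ D R₀) {Q : Cube d} (hQ : Q ∈ D) :
    0 < Q.radius := (h.scale_pos _).trans_le (h.scale_le_radius hQ)

theorem mem_support (h : IsRootedLattice n C₀ A₀ ρ μ D R₀) {Q : Cube d} (hQ : Q ∈ D)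
    {z : Eucl d} (hz : z ∈ Q.carrier) : z ∈ μ.support := (h.lattice.subset_ball Q hQ hz).1

theorem dist_center_lt (h : IsRootedLattice n C₀ A₀ ρ μ D R₀) {Q : Cube d} (hQ : Q ∈ D)
    {z : Eucl d} (hz : z ∈ Q.carrier) : dist z Q.center < 28 * Q.radius :=
  (h.lattice.subset_ball Q hQ hz).2

theorem eq_of_mem (h : IsRootedLattice n C₀ A₀ ρ μ D R₀) {Q R : Cube d} (hQ : Q ∈ D) (hR : R ∈ D)
    (hg : Q.gen = R.gen) {z : Eucl d} (hz : z ∈ Q.carrier) (hz' : z ∈ R.carrier) : Q = R := by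
  by_contra hne
  exact Set.disjoint_left.1 (h.lattice.disjoint Q hQ R hR hg hne) hz hz'

theorem ssub_of_mem (h : IsRootedLattice n C₀ A₀ ρ μ D R₀) {Q R : Cube d} (hQ : Q ∈ D)
    (hR : R ∈ D) (hg : R.gen < Q.gen) {z : Eucl d} (hz : z ∈ Q.carrier) (hz' : z ∈ R.carrier) :
    Q.SSub R := by
  refine ⟨hg, (h.lattice.nested Q hQ R hR hg).resolve_left fun hd => ?_⟩
  exact Set.disjoint_left.1 hd hz hz'

theorem exists_cube (h : IsRootedLattice n C₀ A₀ ρ μ D R₀) (k : ℕ) {z : Eucl d}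
    (hz : z ∈ μ.support) : ∃ Q ∈ D, Q.gen = k ∧ z ∈ Q.carrier := by
  rw [← h.lattice.cover k] at hz
  simp only [mem_iUnion, exists_prop] at hz
  obtain ⟨Q, ⟨hQ, hk⟩, hz⟩ := hz
  exact ⟨Q, hQ, hk, hz⟩

theorem dist_lt (h : IsRootedLattice n C₀ A₀ ρ μ D R₀) {Q : Cube d} (hQ : Q ∈ D)
    {z w : Eucl d} (hz : z ∈ Q.carrier) (hw : w ∈ Q.carrier) : dist z w < 56 * Q.radius := by
  have h1 := h.dist_center_lt hQ hz
  have h2 := h.dist_center_lt hQ hw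
  have := dist_triangle_right z w Q.center
  linarith

theorem ballB_subset (h : IsRootedLattice n C₀ A₀ ρ μ D R₀) {Q : Cube d} (hQ : Q ∈ D)
    {z : Eucl d} (hz : z ∈ Q.carrier) : Q.ballB (2 * 28) ⊆ ball z (84 * Q.radius) := by
  apply ball_subset_ball'
  have := h.dist_center_lt hQ hz
  rw [dist_comm] at this
  linarith

theorem carrier_subset_ballB (h : IsRootedLattice n C₀ A₀ ρ μ D R₀) {Q : Cube d} (hQ : Q ∈ D) :
    Q.carrier ⊆ Q.ballB (2 * 28) := fun z hz => by
  have := h.dist_center_lt hQ hz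
  have := h.radius_pos hQ
  rw [Cube.ballB, mem_ball]
  linarith

theorem measure_ballB (h : IsRootedLattice n C₀ A₀ ρ μ D R₀) {Q : Cube d} (hQ : Q ∈ D) :
    μ (Q.ballB (2 * 28)) = Q.dens2 n μ * ENNReal.ofReal ((2 * 28 * Q.radius) ^ n) :=
  measure_ball_eq_density_mul n μ _ (by have := h.radius_pos hQ; positivity)

theorem dens2_ne_top (h : IsRootedLattice n C₀ A₀ ρ μ D R₀) {Q : Cube d} (hQ : Q ∈ D) :
    Q.dens2 n μ ≠ ∞ := by
  have := h.radius_pos hQ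
  refine ENNReal.div_ne_top (ne_top_of_le_ne_top h.finite (measure_mono (subset_univ _))) ?_
  have : 0 < (2 * 28 * Q.radius) ^ n := by positivity
  simpa using this

theorem countable (h : IsRootedLattice n C₀ A₀ ρ μ D R₀) : D.Countable := by
  have : D = ⋃ k : ℕ, {Q ∈ D | Q.gen = k} := by
    ext Q; simp
  rw [this]
  refine countable_iUnion fun k => ?_
  refine Set.PairwiseDisjoint.countable_of_isOpen (s := fun Q => Q.ballB 5) ?_ ?_ ?_
  · intro Q hQ R hR hne
    exact h.lattice.disjoint_balls Q hQ.1 R hR.1 (hQ.2.trans hR.2.symm) hne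
  · intro Q hQ; exact isOpen_ball
  · intro Q hQ
    exact nonempty_ball.2 (by have := h.radius_pos hQ.1; positivity)

theorem measure_ballB_one_le (h : IsRootedLattice n C₀ A₀ ρ μ D R₀) {Q : Cube d} (hQ : Q ∈ D) :
    μ (Q.ballB 1) ≤ μ Q.carrier := by
  calc μ (Q.ballB 1) ≤ μ (Q.carrier ∪ μ.supportᶜ) := by
        apply measure_mono
        intro z hz
        by_cases hs : z ∈ μ.support
        · exact Or.inl (h.lattice.ball_subset Q hQ ⟨hs, hz⟩)
        · exact Or.inr hs
    _ ≤ _ := by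
        refine (measure_union_le _ _).trans ?_
        rw [Measure.measure_compl_support, add_zero]

/-- A doubling cube has measure at least comparable to that of `2 B_Q`. -/
theorem dens2_le_of_doubling (h : IsRootedLattice n C₀ A₀ ρ μ D R₀) {Q : Cube d} (hQ : Q ∈ D)
    (hdb : Q.Doubling C₀ μ) :
    Q.dens2 n μ * ENNReal.ofReal ((2 * 28 * Q.radius) ^ n) ≤
      ENNReal.ofReal C₀ * μ Q.carrier := by
  rw [← h.measure_ballB hQ]
  have hr := h.radius_pos hQ
  calc μ (Q.ballB (2 * 28)) ≤ μ (Q.ballB 100) :=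
        measure_mono (ball_subset_ball (by nlinarith))
    _ ≤ _ := hdb
    _ ≤ _ := mul_le_mul_right (h.measure_ballB_one_le hQ) _

theorem measure_carrier_ne_top (h : IsRootedLattice n C₀ A₀ ρ μ D R₀) (Q : Cube d) :
    μ Q.carrier ≠ ∞ := ne_top_of_le_ne_top h.finite (measure_mono (subset_univ _))

end IsRootedLattice

/-- The density of a cube is controlled by the density of its smallest doubling ancestor, up to
this constant. -/
def treeConstant (n d : ℕ) (C₀ A₀ : ℝ) : ℝ := 2 ^ n * ((C₀ * A₀) ^ d * A₀ ^ (9 * d)) * C₀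

namespace IsRootedLattice

variable {n d : ℕ} {C₀ A₀ ρ : ℝ} {μ : Measure (Eucl d)} {D : Set (Cube d)} {R₀ : Cube d}

/-- `density_drop` is stated for the dilation 100, so it is converted to the dilation 56 at both
ends. For `Q` this costs a power of `100 / 56 ≤ 2`; for `P` it costs `C₀`, by doubling. The factor
`A₀ ^ (9 * d)` covers the case `Q.gen = P.gen`. -/
theorem dens2_le_doubling_ancestor (h : IsRootedLattice n C₀ A₀ ρ μ D R₀) {Q P : Cube d}
    (hQ : Q ∈ D) (hP : P ∈ D) (hdb : P.Doubling C₀ μ) (hQP : Q.Sub P)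
    (hnon : ∀ S ∈ D, Q.SSub S → S.SSub P → ¬ S.Doubling C₀ μ) :
    Q.dens2 n μ ≤ ENNReal.ofReal (treeConstant n d C₀ A₀) * P.dens2 n μ := by
  have hrQ := h.radius_pos hQ
  have hrP := h.radius_pos hP
  have hA := h.A_pos
  have hC := h.C_pos
  have h1 : Q.dens2 n μ ≤ ENNReal.ofReal (2 ^ n) * Q.densB n μ 100 := by
    unfold Cube.dens2 Cube.densB density
    rw [ENNReal.div_eq_inv_mul, ENNReal.div_eq_inv_mul, ← mul_assoc,
      ← ENNReal.ofReal_inv_of_pos (by positivity), ← ENNReal.ofReal_inv_of_pos (by positivity),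
      ← ENNReal.ofReal_mul (by positivity)]
    refine mul_le_mul' (ENNReal.ofReal_le_ofReal ?_)
      (measure_mono (ball_subset_ball (by nlinarith)))
    rw [← inv_pow, ← inv_pow, ← mul_pow]
    gcongr
    rw [inv_le_iff_one_le_mul₀ (by positivity)]
    have : 2 * (100 * Q.radius)⁻¹ * (2 * 28 * Q.radius) = 112 / 100 := by field_simp; norm_num
    rw [this]; norm_num
  have h2 := h.lattice.density_drop Q hQ P hP hQP hnon
  have h3 : P.densB n μ 100 ≤ ENNReal.ofReal C₀ * P.dens2 n μ := by
    unfold Cube.dens2 Cube.densB density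
    rw [← mul_div_assoc]
    refine ENNReal.div_le_div ?_ (ENNReal.ofReal_le_ofReal ?_)
    · refine hdb.trans ?_
      gcongr
      exact ball_subset_ball (by nlinarith)
    · gcongr; norm_num
  have h4 : (C₀ * A₀) ^ d * A₀ ^ (-(9 * (d : ℤ) * ((Q.gen : ℤ) - (P.gen : ℤ) - 1))) ≤
      (C₀ * A₀) ^ d * A₀ ^ (9 * d) := by
    gcongr
    rw [← zpow_natCast]
    refine zpow_le_zpow_right₀ h.one_lt_A.le ?_
    have := hQP.1
    push_cast
    have h5 : (P.gen : ℤ) ≤ Q.gen := by exact_mod_cast this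
    nlinarith
  calc Q.dens2 n μ ≤ ENNReal.ofReal (2 ^ n) * (ENNReal.ofReal ((C₀ * A₀) ^ d * A₀ ^ (9 * d)) *
        (ENNReal.ofReal C₀ * P.dens2 n μ)) := by
        refine h1.trans ?_
        gcongr
        refine h2.trans ?_
        gcongr
    _ = _ := by
        rw [treeConstant, ENNReal.ofReal_mul (p := 2 ^ n * ((C₀ * A₀) ^ d * A₀ ^ (9 * d)))
          (by positivity), ENNReal.ofReal_mul (p := 2 ^ n) (by positivity)]
        ring

end IsRootedLattice

end

/-! ### Cones and the lower bound for the conical energy -/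

noncomputable section

theorem infDist_translate_eq {d : ℕ} (V : Submodule ℝ (Eucl d)) (x y : Eucl d) :
    infDist y ((fun v => v + x) '' (V : Set (Eucl d))) =
      ‖Vᗮ.orthogonalProjectionOnto (y - x)‖ := by
  have e : ‖Vᗮ.orthogonalProjectionOnto (y - x)‖ = ‖(y - x) - V.starProjection (y - x)‖ := by
    rw [Submodule.orthogonalProjectionOnto_orthogonal]; rfl
  rw [e]
  apply le_antisymm
  · have hm : V.starProjection (y - x) + x ∈ (fun v => v + x) '' (V : Set (Eucl d)) :=
      ⟨_, Submodule.starProjection_apply_mem V _, rfl⟩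
    refine (infDist_le_dist_of_mem hm).trans (le_of_eq ?_)
    rw [dist_eq_norm]
    congr 1
    abel
  · refine (le_infDist (Set.Nonempty.image _ ⟨0, V.zero_mem⟩)).2 ?_
    rintro _ ⟨v, hv, rfl⟩
    rw [Submodule.starProjection_minimal, dist_eq_norm]
    refine (ciInf_le ⟨0, Set.forall_mem_range.mpr fun _ => norm_nonneg _⟩ (⟨v, hv⟩ : V)).trans
      (le_of_eq ?_)
    simp only
    congr 1
    abel

theorem mem_cone_iff {d : ℕ} {V : Submodule ℝ (Eucl d)} {x y : Eucl d} {α : ℝ} :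
    y ∈ cone x V α ↔ ‖Vᗮ.orthogonalProjectionOnto (y - x)‖ < α * dist x y := by
  rw [← infDist_translate_eq]; rfl

theorem norm_orthogonalProjectionOnto_le {d : ℕ} (V : Submodule ℝ (Eucl d)) (x : Eucl d) :
    ‖V.orthogonalProjectionOnto x‖ ≤ ‖x‖ := by
  have := V.starProjection.le_of_opNorm_le V.starProjection_norm_le x
  rw [one_mul] at this
  exact this

/-- A small ball around a point of a cone is contained in a wider cone. -/
theorem ball_subset_truncCone {d : ℕ} {V : Submodule ℝ (Eucl d)} {z x : Eucl d} {α r : ℝ}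
    (hα : 0 < α) (hα1 : α < 1) (hx : x ∈ cone z V (α / 2)) (hr : 2 * dist z x ≤ r) :
    ball x (α / 4 * dist z x) ⊆ truncCone z V α r := by
  intro y hy
  rw [mem_ball] at hy
  rw [mem_cone_iff] at hx
  have h1 := dist_triangle z x y
  have h2 := dist_triangle z y x
  rw [dist_comm x y] at h1
  have hs : 0 ≤ dist z x := dist_nonneg
  refine ⟨?_, ?_⟩
  · rw [mem_cone_iff]
    have e : y - z = (x - z) + (y - x) := by abel
    rw [e, map_add]
    have h3 := norm_add_le (Vᗮ.orthogonalProjectionOnto (x - z))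
      (Vᗮ.orthogonalProjectionOnto (y - x))
    have h4 := norm_orthogonalProjectionOnto_le Vᗮ (y - x)
    rw [← dist_eq_norm] at h4
    nlinarith
  · rw [mem_ball, dist_comm]
    nlinarith

/-- The integrand of the conical energy. -/
def energyIntegrand {d : ℕ} (n : ℕ) (p : ℝ) (μ : Measure (Eucl d)) (V : Submodule ℝ (Eucl d))
    (α : ℝ) (x : Eucl d) (r : ℝ) : ℝ≥0∞ :=
  (μ (truncCone x V α r) / ENNReal.ofReal (r ^ n)) ^ p / ENNReal.ofReal r

/-- Low density at many scales is the only obstruction to large energy near a pair of points in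
vertical position; the ratio of the scales is at most this constant. -/
def scaleRatio (C₀ A₀ α : ℝ) : ℝ := 336 * C₀ * A₀ / α

/-- The energy threshold. -/
def energyThreshold (n : ℕ) (C₀ A₀ α τ p : ℝ) : ℝ := (τ / scaleRatio C₀ A₀ α ^ n) ^ p / 2

/-- Only the scales in `[2 * s, 4 * s]` are used: there the integrand is at least `θ ^ p / (4 * s)`,
on an interval of length `2 * s`. -/
theorem le_lintegral_energyIntegrand {d n : ℕ} {p : ℝ} (hp : 0 ≤ p) {μ : Measure (Eucl d)}
    {V : Submodule ℝ (Eucl d)} {α : ℝ} {z : Eucl d} {s : ℝ} (hs : 0 < s) {U : Set (Eucl d)}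
    (hU : ∀ r, 2 * s ≤ r → U ⊆ truncCone z V α r) {θ : ℝ≥0∞}
    (hθ : θ * ENNReal.ofReal ((4 * s) ^ n) ≤ μ U) {a b : ℝ} (ha : a ≤ 2 * s) (hb : 4 * s ≤ b) :
    θ ^ p * ENNReal.ofReal (1 / 2) ≤ ∫⁻ r in Icc a b, energyIntegrand n p μ V α z r := by
  calc θ ^ p * ENNReal.ofReal (1 / 2)
      = ∫⁻ _ in Icc (2 * s) (4 * s), θ ^ p / ENNReal.ofReal (4 * s) := by
        rw [setLIntegral_const, Real.volume_Icc, ENNReal.div_eq_inv_mul, mul_comm _ (θ ^ p),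
          mul_assoc, ← ENNReal.ofReal_inv_of_pos (by positivity),
          ← ENNReal.ofReal_mul (by positivity)]
        congr 2
        field_simp
        norm_num
    _ ≤ ∫⁻ r in Icc (2 * s) (4 * s), energyIntegrand n p μ V α z r := by
        refine setLIntegral_mono' measurableSet_Icc fun r hr => ?_
        have hr0 : 0 < r := by linarith [hr.1]
        unfold energyIntegrand
        refine ENNReal.div_le_div (ENNReal.rpow_le_rpow ?_ hp)
          (ENNReal.ofReal_le_ofReal hr.2)
        have hrn : 0 < r ^ n := by positivity
        rw [ENNReal.le_div_iff_mul_le (Or.inl (by simpa using hrn)) (Or.inl ENNReal.ofReal_ne_top)]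
        refine (mul_le_mul_right (ENNReal.ofReal_le_ofReal ?_) _).trans
          (hθ.trans (measure_mono (hU r hr.1)))
        exact pow_le_pow_left₀ hr0.le hr.2 n
    _ ≤ _ := lintegral_mono_set (Icc_subset_Icc ha hb)

namespace IsRootedLattice

variable {n d : ℕ} {C₀ A₀ ρ : ℝ} {μ : Measure (Eucl d)} {D : Set (Cube d)} {R₀ : Cube d}

theorem scaleRatio_pos (h : IsRootedLattice n C₀ A₀ ρ μ D R₀) {α : ℝ} (hα : 0 < α) :
    0 < scaleRatio C₀ A₀ α := by
  have := h.A_pos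
  have := h.C_pos
  unfold scaleRatio
  positivity

/-- Two points of `R` in vertical position with substantial mass near one of them force the
energy at the other one to be large. -/
theorem energy_lower_bound (h : IsRootedLattice n C₀ A₀ ρ μ D R₀) {V : Submodule ℝ (Eucl d)}
    {α τ p : ℝ} (hα : 0 < α) (hα1 : α < 1) (hp : 0 ≤ p) (hτ : 0 < τ) {R : Cube d} (hR : R ∈ D)
    {z x : Eucl d} (hz : z ∈ R.carrier) (hx : x ∈ R.carrier) (hzx : x ∈ cone z V (α / 2))
    (hlow : ∀ P ∈ D, x ∈ P.carrier → P.SSub R →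
      dist z x ≤ scaleRatio C₀ A₀ α * scale A₀ ρ P.gen →
      ENNReal.ofReal τ * R.dens2 n μ ≤ P.dens2 n μ)
    {a : ℝ} (ha : a ≤ 2 * dist z x) :
    ENNReal.ofReal (energyThreshold n C₀ A₀ α τ p) * R.dens2 n μ ^ p ≤
      ∫⁻ r in Icc a (A₀ * scale A₀ ρ R.gen), energyIntegrand n p μ V α z r := by
  have hC := h.C_pos
  have hA := h.A_pos
  have hK := h.scaleRatio_pos hα
  set s := dist z x with hs
  have hs0 : 0 < s := by
    rw [mem_cone_iff] at hzx
    by_contra hcon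
    have : s = 0 := le_antisymm (not_lt.1 hcon) dist_nonneg
    rw [← hs, this, mul_zero] at hzx
    exact absurd hzx (not_lt.2 (norm_nonneg _))
  have hsR : s < 56 * C₀ * scale A₀ ρ R.gen := by
    have h1 := h.dist_lt hR hz hx
    have h2 := h.radius_le hR
    nlinarith
  have hex : ∃ k, 84 * C₀ * scale A₀ ρ k ≤ α / 4 * s := by
    obtain ⟨k, hk⟩ := h.exists_scale_lt (t := α / 4 * s / (84 * C₀)) (by positivity)
    rw [lt_div_iff₀ (by positivity)] at hk
    exact ⟨k, by linarith⟩
  classical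
  -- `j` is the first generation whose cubes around `x` have `2 B_P` inside `ball x (α / 4 * s)`.
  -- Minimality loses one factor `A₀`, so `s` is at most `84 * C₀ * A₀ * (4 / α)` times their scale,
  -- which is `scaleRatio`.
  set j := Nat.find hex with hj
  have hj1 : 84 * C₀ * scale A₀ ρ j ≤ α / 4 * s := Nat.find_spec hex
  have hjR : R.gen < j := by
    rw [← h.scale_strictAnti.lt_iff_gt]
    have h3 := h.scale_pos R.gen
    have : 84 * C₀ * scale A₀ ρ j < 84 * C₀ * scale A₀ ρ R.gen := by
      have : α / 4 * s ≤ s := by nlinarith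
      nlinarith [mul_pos hC h3]
    exact lt_of_mul_lt_mul_left this (by positivity)
  have hjs : s ≤ scaleRatio C₀ A₀ α * scale A₀ ρ j := by
    obtain ⟨i, hi⟩ : ∃ i, j = i + 1 := ⟨j - 1, by omega⟩
    have h4 : ¬ 84 * C₀ * scale A₀ ρ i ≤ α / 4 * s := Nat.find_min hex (by omega)
    rw [not_le, ← h.scale_succ i, ← hi] at h4
    have e : scaleRatio C₀ A₀ α * scale A₀ ρ j = 84 * C₀ * (A₀ * scale A₀ ρ j) * (4 / α) := by
      unfold scaleRatio; field_simp; ring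
    rw [e]
    have h5 : s = α / 4 * s * (4 / α) := by field_simp
    rw [h5]
    gcongr
  obtain ⟨P, hP, hPj, hxP⟩ := h.exists_cube j (h.mem_support hR hx)
  have hPR : P.SSub R := h.ssub_of_mem hP hR (by omega) hxP hx
  have hdens := hlow P hP hxP hPR (by rwa [hPj])
  have hrP := h.radius_pos hP
  have hball : P.ballB (2 * 28) ⊆ ball x (α / 4 * s) := by
    refine (h.ballB_subset hP hxP).trans (ball_subset_ball ?_)
    have := h.radius_le hP
    rw [hPj] at this
    linarith
  -- The set in the cone is `2 B_P`, with mass at least `τ Θ(R) (56 r(P)) ^ n`. Since `s ≤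
  -- scaleRatio * r(P)`, this is `τ Θ(R) / scaleRatio ^ n` times `(4 * s) ^ n` with room to spare.
  have key := le_lintegral_energyIntegrand (n := n) hp hs0 (U := P.ballB (2 * 28))
    (fun r hr => hball.trans (ball_subset_truncCone hα hα1 hzx hr))
    (θ := ENNReal.ofReal (τ / scaleRatio C₀ A₀ α ^ n) * R.dens2 n μ) (μ := μ) (by
      rw [h.measure_ballB hP]
      have hrs : s ≤ scaleRatio C₀ A₀ α * P.radius := by
        refine hjs.trans ?_
        have := h.scale_le_radius hP
        rw [hPj] at this
        gcongr
      calc ENNReal.ofReal (τ / scaleRatio C₀ A₀ α ^ n) * R.dens2 n μ * ENNReal.ofReal ((4 * s) ^ n)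
          = ENNReal.ofReal (τ / scaleRatio C₀ A₀ α ^ n * (4 * s) ^ n) * R.dens2 n μ := by
            rw [ENNReal.ofReal_mul (by positivity)]; ring
        _ ≤ ENNReal.ofReal (τ * (2 * 28 * P.radius) ^ n) * R.dens2 n μ := by
            refine mul_le_mul_left (ENNReal.ofReal_le_ofReal ?_) _
            rw [div_mul_eq_mul_div, div_le_iff₀ (by positivity), mul_assoc, ← mul_pow]
            exact mul_le_mul_of_nonneg_left
              (pow_le_pow_left₀ (by positivity) (by nlinarith) n) hτ.le
        _ = ENNReal.ofReal τ * R.dens2 n μ * ENNReal.ofReal ((2 * 28 * P.radius) ^ n) := by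
            rw [ENNReal.ofReal_mul hτ.le]; ring
        _ ≤ _ := by gcongr)
    ha (b := A₀ * scale A₀ ρ R.gen) (by
      have := h.scale_pos R.gen
      nlinarith [h.lt_A])
  refine le_trans (le_of_eq ?_) key
  rw [ENNReal.mul_rpow_of_nonneg _ _ hp, ENNReal.ofReal_rpow_of_nonneg (by positivity) hp,
    mul_right_comm, ← ENNReal.ofReal_mul (by positivity), energyThreshold]
  congr 2
  ring

end IsRootedLattice

end

/-! ### Lipschitz graphs and stopping cubes -/

noncomputable section

/-- The Lipschitz constant of a graph avoiding vertical cones of aperture `β`. -/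
def graphConstant (m : ℕ) (β : ℝ) : ℝ≥0 :=
  lipschitzExtensionConstant (EuclideanSpace ℝ (Fin m)) * Real.toNNReal β⁻¹

/-- A set without pairs of points in vertical position lies on a Lipschitz graph. -/
theorem exists_isLipschitzGraph {n d : ℕ} (hnd : n ≤ d) {V : Submodule ℝ (Eucl d)}
    (hV : Module.finrank ℝ V = d - n) {β : ℝ} (hβ : 0 < β) {G : Set (Eucl d)}
    (hG : ∀ x ∈ G, ∀ y ∈ G, y ∉ cone x V β) :
    ∃ Γ, IsLipschitzGraph n (graphConstant (d - n) β) Γ ∧ G ⊆ Γ := by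
  have hsum := Submodule.finrank_add_finrank_orthogonal V
  rw [finrank_euclideanSpace_fin, hV] at hsum
  have hW : Module.finrank ℝ Vᗮ = n := by omega
  have hWW : Module.finrank ℝ Vᗮᗮ = d - n := by
    have := Submodule.finrank_add_finrank_orthogonal Vᗮ
    rw [finrank_euclideanSpace_fin, hW] at this
    omega
  -- Orthonormal coordinates on the target make the extension constant depend on its dimension
  -- alone, not on `V`.
  let e : Vᗮᗮ ≃ₗᵢ[ℝ] EuclideanSpace ℝ (Fin (d - n)) :=
    ((stdOrthonormalBasis ℝ Vᗮᗮ).reindex (finCongr hWW)).repr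
  set π := Vᗮ.orthogonalProjectionOnto with hπ
  set σ := Vᗮᗮ.orthogonalProjectionOnto with hσ
  -- Avoiding cones says that the projection to the complement of `V` is injective on `G` with
  -- `β⁻¹`-Lipschitz inverse; the vertical component is then a Lipschitz function on the projection
  -- of `G`, to be extended.
  have hG' : ∀ x ∈ G, ∀ y ∈ G, β * dist x y ≤ ‖π (y - x)‖ := by
    intro x hx y hy
    have := hG x hx y hy
    rwa [mem_cone_iff, not_lt] at this
  have hsel : ∀ w : Vᗮ, ∃ x, w ∈ π '' G → x ∈ G ∧ π x = w := by
    intro w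
    by_cases hw : w ∈ π '' G
    · obtain ⟨x, hx, hxw⟩ := hw
      exact ⟨x, fun _ => ⟨hx, hxw⟩⟩
    · exact ⟨0, fun h => absurd h hw⟩
  choose sel hsel using hsel
  have hlip : LipschitzOnWith (Real.toNNReal β⁻¹) (fun w => e (σ (sel w))) (π '' G) := by
    refine LipschitzOnWith.of_dist_le_mul fun w hw w' hw' => ?_
    obtain ⟨h1, h2⟩ := hsel w hw
    obtain ⟨h1', h2'⟩ := hsel w' hw'
    have h3 := hG' _ h1' _ h1
    rw [map_sub, h2, h2', ← dist_eq_norm] at h3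
    rw [e.dist_map, Real.coe_toNNReal _ (inv_nonneg.2 hβ.le), dist_eq_norm, ← map_sub]
    refine (norm_orthogonalProjectionOnto_le _ _).trans ?_
    rw [← dist_eq_norm, ← div_eq_inv_mul, le_div_iff₀ hβ, mul_comm, dist_comm (sel w)]
    exact h3
  obtain ⟨g, hg, hgG⟩ := hlip.extend_finite_dimension
  refine ⟨_, ⟨Vᗮ, hW, fun w => e.symm (g w), ?_, rfl⟩, ?_⟩
  · have := e.symm.lipschitz.comp hg
    rw [one_mul] at this
    exact this
  · intro x hx
    refine ⟨π x, ?_⟩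
    have hw : π x ∈ π '' G := ⟨x, hx, rfl⟩
    obtain ⟨h1, h2⟩ := hsel _ hw
    have hsx : sel (π x) = x := by
      have h3 := hG' _ h1 _ hx
      rw [map_sub, h2, sub_self, norm_zero] at h3
      have : dist (sel (π x)) x ≤ 0 := by
        by_contra hcon
        exact absurd h3 (not_le.2 (mul_pos hβ (not_le.1 hcon)))
      exact dist_le_zero.1 this
    have h4 : g (π x) = e (σ x) := by rw [← hgG hw]; simp only [hsx]
    simp only
    rw [h4, e.symm_apply_apply]
    exact Submodule.starProjection_add_starProjection_orthogonal _

section StoppingCubes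

variable {d : ℕ}

/-- The density of `Q` is much lower than that of `R`. -/
def LowDensity (n : ℕ) (μ : Measure (Eucl d)) (τ : ℝ) (R Q : Cube d) : Prop :=
  Q.dens2 n μ < ENNReal.ofReal τ * R.dens2 n μ

/-- `Q` is doubling and its density is much higher than that of `R`. -/
def HighDensity (n : ℕ) (C₀ : ℝ) (μ : Measure (Eucl d)) (R Q : Cube d) : Prop :=
  Q.Doubling C₀ μ ∧ 4 * R.dens2 n μ < Q.dens2 n μ

/-- The conical energy between the scales of `Q` and `R` is large at all points of `Q`. -/
def BigEnergy (n : ℕ) (p : ℝ) (μ : Measure (Eucl d)) (V : Submodule ℝ (Eucl d)) (α A₀ ρ ε : ℝ)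
    (R Q : Cube d) : Prop :=
  ∀ z ∈ Q.carrier, ENNReal.ofReal ε * R.dens2 n μ ^ p ≤
    ∫⁻ r in Icc (scale A₀ ρ Q.gen) (A₀ * scale A₀ ρ R.gen), energyIntegrand n p μ V α z r

/-- The maximal cubes strictly contained in `R` with a given property. -/
def stopCubes (D : Set (Cube d)) (bad : Cube d → Cube d → Prop) (R : Cube d) : Set (Cube d) :=
  {S | S ∈ D ∧ S.SSub R ∧ bad R S ∧ ∀ P ∈ D, P.SSub R → bad R P → ¬ S.SSub P}

theorem exists_mem_stopCubes {D : Set (Cube d)} {bad : Cube d → Cube d → Prop} {R S : Cube d}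
    (hS : S ∈ D) (hSR : S.SSub R) (hbad : bad R S) :
    ∃ P ∈ stopCubes D bad R, S.Sub P := by
  classical
  let p : ℕ → Prop := fun k => ∃ P ∈ D, P.gen = k ∧ P.SSub R ∧ bad R P ∧ S.Sub P
  have hex : ∃ k, p k := ⟨S.gen, S, hS, rfl, hSR, hbad, le_rfl, subset_rfl⟩
  obtain ⟨P, hP, hk, hPR, hPbad, hSP⟩ := Nat.find_spec hex
  refine ⟨P, ⟨hP, hPR, hPbad, fun P' hP' hPR' hbad' hPP' => ?_⟩, hSP⟩
  exact Nat.find_min hex (m := P'.gen) (by rw [← hk]; exact hPP'.1)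
    ⟨P', hP', rfl, hPR', hbad', hPP'.1.le.trans hSP.1, hSP.2.trans hPP'.2⟩

end StoppingCubes

namespace IsRootedLattice

variable {n d : ℕ} {C₀ A₀ ρ : ℝ} {μ : Measure (Eucl d)} {D : Set (Cube d)} {R₀ : Cube d}

/-- The points of `R` that lie in no bad cube lie on a Lipschitz graph. -/
theorem exists_graph (h : IsRootedLattice n C₀ A₀ ρ μ D R₀) (hnd : n ≤ d)
    {V : Submodule ℝ (Eucl d)}
    (hV : Module.finrank ℝ V = d - n) {α τ p : ℝ} (hα : 0 < α) (hα1 : α < 1) (hp : 0 ≤ p)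
    (hτ : 0 < τ) {bad : Cube d → Cube d → Prop}
    (hlow : ∀ R Q, LowDensity n μ τ R Q → bad R Q)
    (hen : ∀ R Q, BigEnergy n p μ V α A₀ ρ (energyThreshold n C₀ A₀ α τ p) R Q → bad R Q)
    {R : Cube d} (hR : R ∈ D) :
    ∃ Γ, IsLipschitzGraph n (graphConstant (d - n) (α / 2)) Γ ∧
      R.carrier \ ⋃ S ∈ {S ∈ D | S.SSub R ∧ bad R S}, S.carrier ⊆ Γ := by
  refine exists_isLipschitzGraph hnd hV (half_pos hα) ?_
  rintro x ⟨hx, hxb⟩ y ⟨hy, hyb⟩ hxy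
  simp only [mem_iUnion, exists_prop, not_exists, not_and] at hxb hyb
  -- `BigEnergy` asks for large energy at all points of a cube, so the vertical position of `y`
  -- relative to `x` is first spread to a neighbourhood of `x`.
  have hopen : ∀ᶠ z in nhds x, y ∈ cone z V (α / 2) := by
    have hc1 : Continuous fun z : Eucl d => ‖Vᗮ.orthogonalProjectionOnto (y - z)‖ := by fun_prop
    have hc2 : Continuous fun z : Eucl d => α / 2 * dist z y := by fun_prop
    rw [mem_cone_iff] at hxy
    filter_upwards [hc1.continuousAt.eventually_lt hc2.continuousAt hxy] with z hz
    exact mem_cone_iff.2 hz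
  have hs : 0 < dist x y := by
    rw [mem_cone_iff] at hxy
    by_contra hcon
    have : dist x y = 0 := le_antisymm (not_lt.1 hcon) dist_nonneg
    rw [this, mul_zero] at hxy
    exact absurd hxy (not_lt.2 (norm_nonneg _))
  obtain ⟨δ, hδ, hball⟩ := Metric.eventually_nhds_iff_ball.1 hopen
  have hC := h.C_pos
  -- The first bound puts the cube `P` around `x` inside `ball x δ`; the second keeps its points at
  -- distance from `y` larger than the scale of `P`, so only scales allowed in `BigEnergy` are used.
  obtain ⟨k, hk⟩ := h.exists_scale_lt (t := min (δ / (56 * C₀)) (dist x y / (57 * C₀)))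
    (by positivity)
  obtain ⟨P, hP, hPk, hxP⟩ := h.exists_cube (max k (R.gen + 1)) (h.mem_support hR hx)
  have hPR : P.SSub R := h.ssub_of_mem hP hR (by omega) hxP hx
  have hPscale : scale A₀ ρ P.gen < min (δ / (56 * C₀)) (dist x y / (57 * C₀)) :=
    (h.scale_strictAnti.antitone (by omega)).trans_lt hk
  rw [lt_min_iff, lt_div_iff₀ (by positivity), lt_div_iff₀ (by positivity)] at hPscale
  have hnot : ¬ bad R P := fun hb => hxb P ⟨hP, hPR, hb⟩ hxP
  apply hnot
  apply hen
  intro z hz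
  have hrad := h.radius_le hP
  have hzx : dist z x < 56 * P.radius := h.dist_lt hP hz hxP
  refine h.energy_lower_bound hα hα1 hp hτ hR (hPR.2 hz) hy (hball z ?_) ?_ ?_
  · rw [mem_ball]; linarith
  · intro P' hP' hyP' hPR' _
    by_contra hcon
    exact hyb P' ⟨hP', hPR', hlow _ _ (not_le.1 hcon)⟩ hyP'
  · have h1 := dist_triangle x z y
    have h2 : dist x z < 56 * P.radius := by rwa [dist_comm]
    have h3 := h.scale_pos P.gen
    nlinarith [h.one_lt]

end IsRootedLattice

/-! ### Mass of the low density stopping cubes -/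

noncomputable section

/-- Bound for the mass of the low density cubes close to a given one. -/
def clusterConstant (n d : ℕ) (C₀ A₀ α : ℝ) : ℝ :=
  (56 * C₀) ^ n * (1 + ⌈scaleRatio C₀ A₀ α⌉₊ *
    ((28 * C₀ + scaleRatio C₀ A₀ α + 1) * A₀ ^ ⌈scaleRatio C₀ A₀ α⌉₊) ^ d)

/-- Bound for the total mass of the low density cubes. -/
def lowConstant (n d : ℕ) (C₀ A₀ α : ℝ) : ℝ :=
  clusterConstant n d C₀ A₀ α * ((28 * C₀ + 1) / (α / 8)) ^ n

/-- The low density threshold. -/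
def lowThreshold (n d : ℕ) (C₀ A₀ α : ℝ) : ℝ := (2 * C₀ * lowConstant n d C₀ A₀ α)⁻¹

namespace IsRootedLattice

variable {n d : ℕ} {C₀ A₀ ρ : ℝ} {μ : Measure (Eucl d)} {D : Set (Cube d)} {R₀ : Cube d}

theorem clusterConstant_pos (h : IsRootedLattice n C₀ A₀ ρ μ D R₀) {α : ℝ} (hα : 0 < α) :
    0 < clusterConstant n d C₀ A₀ α := by
  have := h.C_pos
  have := h.A_pos
  have := h.scaleRatio_pos hα
  unfold clusterConstant
  positivity

theorem lowConstant_pos (h : IsRootedLattice n C₀ A₀ ρ μ D R₀) {α : ℝ} (hα : 0 < α) :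
    0 < lowConstant n d C₀ A₀ α := by
  have := h.C_pos
  have := h.clusterConstant_pos hα
  unfold lowConstant
  positivity

theorem lowThreshold_pos (h : IsRootedLattice n C₀ A₀ ρ μ D R₀) {α : ℝ} (hα : 0 < α) :
    0 < lowThreshold n d C₀ A₀ α := by
  have := h.C_pos
  have := h.lowConstant_pos hα
  unfold lowThreshold
  positivity

theorem measure_carrier_le_of_lowDensity (h : IsRootedLattice n C₀ A₀ ρ μ D R₀) {τ : ℝ}
    {R Q : Cube d} (hQ : Q ∈ D) (hlow : LowDensity n μ τ R Q) :
    μ (Q.ballB (2 * 28)) ≤ ENNReal.ofReal τ * R.dens2 n μ *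
      ENNReal.ofReal ((56 * C₀) ^ n * scale A₀ ρ Q.gen ^ n) := by
  rw [h.measure_ballB hQ]
  have := h.radius_pos hQ
  refine mul_le_mul' hlow.le (ENNReal.ofReal_le_ofReal ?_)
  rw [← mul_pow]
  exact pow_le_pow_left₀ (by positivity) (by linarith [h.radius_le hQ]) n

/-- A low density stopping cube `Q` that is not larger than `P` and has a similar projection has to
be close to `P`. -/
theorem dist_lt_of_projection_le (h : IsRootedLattice n C₀ A₀ ρ μ D R₀)
    {V : Submodule ℝ (Eucl d)} {α τ p : ℝ} (hα : 0 < α) (hα1 : α < 1) (hp : 0 ≤ p)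
    (hτ : 0 < τ) {bad : Cube d → Cube d → Prop}
    (hbad : ∀ R Q, LowDensity n μ τ R Q → bad R Q) {R P Q : Cube d} (hR : R ∈ D)
    (hP : P ∈ stopCubes D bad R) (hQ : Q ∈ stopCubes D bad R) {z w : Eucl d}
    (hz : z ∈ P.carrier) (hw : w ∈ Q.carrier)
    (hen : ¬ ENNReal.ofReal (energyThreshold n C₀ A₀ α τ p) * R.dens2 n μ ^ p ≤
      ∫⁻ r in Icc (scale A₀ ρ P.gen) (A₀ * scale A₀ ρ R.gen), energyIntegrand n p μ V α z r)
    (hproj : ‖Vᗮ.orthogonalProjectionOnto (w - z)‖ ≤ α / 4 * scale A₀ ρ P.gen)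
    (hdist : scaleRatio C₀ A₀ α * scale A₀ ρ Q.gen < dist z w) :
    dist z w < scale A₀ ρ P.gen := by
  by_contra hcon
  rw [not_lt] at hcon
  have hs := h.scale_pos P.gen
  refine hen (h.energy_lower_bound hα hα1 hp hτ hR (hP.2.1.2 hz) (hQ.2.1.2 hw) ?_ ?_ ?_)
  · rw [mem_cone_iff]
    nlinarith
  · intro P' hP' hwP' hPR' hle
    -- A cube around `w` of size at least `dist z w / scaleRatio` is strictly larger than `Q`; if it
    -- had low density it would be bad, against the maximality of `Q`.
    by_contra hlow
    have hlt : scale A₀ ρ Q.gen < scale A₀ ρ P'.gen :=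
      lt_of_mul_lt_mul_left (hdist.trans_le hle) (h.scaleRatio_pos hα).le
    rw [h.scale_strictAnti.lt_iff_gt] at hlt
    exact hQ.2.2.2 P' hP' hPR' (hbad _ _ (not_le.1 hlow)) (h.ssub_of_mem hQ.1 hP' hlt hw hwP')
  · linarith

/-- The mass of the low density stopping cubes not larger than `P` with similar projection. -/
theorem measure_cluster_le (h : IsRootedLattice n C₀ A₀ ρ μ D R₀)
    {V : Submodule ℝ (Eucl d)} {α τ p : ℝ} (hα : 0 < α) (hα1 : α < 1) (hp : 0 ≤ p)
    (hτ : 0 < τ) {bad : Cube d → Cube d → Prop}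
    (hbad : ∀ R Q, LowDensity n μ τ R Q → bad R Q) {R P : Cube d} (hR : R ∈ D)
    {S : Set (Cube d)} (hS : S ⊆ stopCubes D bad R) (hlow : ∀ Q ∈ S, LowDensity n μ τ R Q)
    {sel : Cube d → Eucl d} (hsel : ∀ Q ∈ S, sel Q ∈ Q.carrier) (hP : P ∈ S)
    (hen : ¬ ENNReal.ofReal (energyThreshold n C₀ A₀ α τ p) * R.dens2 n μ ^ p ≤
      ∫⁻ r in Icc (scale A₀ ρ P.gen) (A₀ * scale A₀ ρ R.gen), energyIntegrand n p μ V α (sel P) r)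
    (hgen : ∀ Q ∈ S, P.gen ≤ Q.gen)
    (hproj : ∀ Q ∈ S, ‖Vᗮ.orthogonalProjectionOnto (sel Q - sel P)‖ ≤
      α / 4 * scale A₀ ρ P.gen) :
    μ (⋃ Q ∈ S, Q.carrier) ≤ ENNReal.ofReal τ * R.dens2 n μ *
      ENNReal.ofReal (clusterConstant n d C₀ A₀ α * scale A₀ ρ P.gen ^ n) := by
  have hC := h.C_pos
  have hA := h.A_pos
  set K := scaleRatio C₀ A₀ α with hKdef
  have hK : 0 < K := h.scaleRatio_pos hα
  have hK1 : 1 ≤ K := by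
    rw [hKdef, scaleRatio, le_div_iff₀ hα]
    nlinarith [h.one_lt, h.one_lt_A]
  -- After `m` generations the scale has dropped by more than `K`, since `A₀ ^ m ≥ 2 ^ m ≥ m ≥ K`.
  set m := ⌈K⌉₊ with hm
  have hm1 : 1 ≤ m := Nat.one_le_ceil_iff.2 hK
  have hAm : K ≤ A₀ ^ m := by
    calc K ≤ m := Nat.le_ceil K
      _ ≤ 2 ^ m := by exact_mod_cast Nat.lt_two_pow_self.le
      _ ≤ A₀ ^ m := pow_le_pow_left₀ (by norm_num) (by linarith [h.lt_A, h.one_lt]) m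
  set a := scale A₀ ρ P.gen with ha
  have ha0 : 0 < a := h.scale_pos _
  have hPD := (hS hP).1
  set z := sel P with hz
  have hzP : z ∈ P.carrier := hsel P hP
  have hrP := h.scale_le_radius hPD
  set c := ENNReal.ofReal τ * R.dens2 n μ * ENNReal.ofReal ((56 * C₀) ^ n * a ^ n) with hc
  have hdist : ∀ Q ∈ S, K * scale A₀ ρ Q.gen < dist z (sel Q) → dist z (sel Q) < a :=
    fun Q hQ => h.dist_lt_of_projection_le hα hα1 hp hτ hbad hR (hS hP) (hS hQ) hzP (hsel Q hQ)
      hen (hproj Q hQ)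
  have hdist2 : ∀ Q ∈ S, dist z (sel Q) ≤ K * a := by
    intro Q hQ
    have h1 : scale A₀ ρ Q.gen ≤ a := h.scale_strictAnti.antitone (hgen Q hQ)
    by_contra hcon
    have h2 := hdist Q hQ (lt_of_le_of_lt (by gcongr) (not_le.1 hcon))
    nlinarith
  -- Much smaller cubes of the cluster are within distance comparable to `a` and lie in `2 B_P`.
  -- They are not counted: they are disjointness-free, bounded together by the measure of `2 B_P`,
  -- which is small because `P` has low density.
  have hsmall : μ (⋃ Q ∈ {Q ∈ S | P.gen + m ≤ Q.gen}, Q.carrier) ≤ c := by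
    refine (measure_mono ?_).trans (h.measure_carrier_le_of_lowDensity hPD (hlow P hP))
    refine iUnion₂_subset fun Q hQ x hx => ?_
    obtain ⟨hQS, hQg⟩ := hQ
    have hsc : A₀ ^ m * scale A₀ ρ Q.gen ≤ a := by
      rw [ha, ← h.scale_add P.gen m]
      gcongr
      exact h.scale_strictAnti.antitone hQg
    have hsQ := h.scale_pos Q.gen
    have h1 : dist z (sel Q) ≤ a := by
      by_contra hcon
      refine hcon (hdist Q hQS (lt_of_le_of_lt ?_ (not_le.1 hcon))).le
      exact (by gcongr : K * scale A₀ ρ Q.gen ≤ A₀ ^ m * scale A₀ ρ Q.gen).trans hsc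
    have h2 := h.dist_lt (hS hQS).1 hx (hsel Q hQS)
    have h3 := h.radius_le (hS hQS).1
    have h4 : 56 * C₀ * scale A₀ ρ Q.gen ≤ a := by
      have h5 : A₀ ≤ A₀ ^ m := le_self_pow₀ h.one_lt_A.le (by omega)
      have h6 : 56 * C₀ ≤ A₀ ^ m := by linarith [h.lt_A]
      exact (by gcongr : 56 * C₀ * scale A₀ ρ Q.gen ≤ A₀ ^ m * scale A₀ ρ Q.gen).trans hsc
    have h7 := h.dist_center_lt hPD hzP
    rw [Cube.ballB, mem_ball]
    have h8 := dist_triangle x (sel Q) P.center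
    have h9 := dist_triangle (sel Q) z P.center
    rw [dist_comm (sel Q) z] at h9
    linarith
  -- In the remaining `m` generations the cubes have sizes comparable to `a` and lie within a
  -- bounded multiple of `a`, so packing in dimension `d` bounds their number.
  have hlevel : ∀ i < m, μ (⋃ Q ∈ {Q ∈ S | Q.gen = P.gen + i}, Q.carrier) ≤
      ENNReal.ofReal (((28 * C₀ + K + 1) * A₀ ^ m) ^ d) * c := by
    intro i hi
    set J := {Q ∈ S | Q.gen = P.gen + i} with hJ
    have hJD : ∀ Q ∈ J, Q ∈ D := fun Q hQ => (hS hQ.1).1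
    have hle : ∀ Q ∈ J, μ Q.carrier ≤ c := by
      intro Q hQ
      refine (measure_mono (h.carrier_subset_ballB (hJD Q hQ))).trans
        ((h.measure_carrier_le_of_lowDensity (hJD Q hQ) (hlow Q hQ.1)).trans ?_)
      rw [hc]
      have h1 : scale A₀ ρ Q.gen ≤ a := h.scale_strictAnti.antitone (hgen Q hQ.1)
      have h2 := h.scale_pos Q.gen
      refine mul_le_mul_right (ENNReal.ofReal_le_ofReal ?_) _
      gcongr
    set b := scale A₀ ρ (P.gen + i) with hb
    have hb0 : 0 < b := h.scale_pos _
    have hba : b ≤ a := h.scale_strictAnti.antitone (by omega)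
    have hcard := tsum_const_le_of_disjoint_balls J (fun Q => Q.center) (fun Q => 5 * Q.radius)
      (δ := b) (y := z) (R := (28 * C₀ + K + 1) * a) hb0 (fun Q hQ => by
        have := h.scale_le_radius (hJD Q hQ)
        rw [hQ.2] at this
        linarith) (fun Q hQ Q' hQ' hne =>
        h.lattice.disjoint_balls Q (hJD Q hQ) Q' (hJD Q' hQ') (hQ.2.trans hQ'.2.symm) hne)
      (by positivity) (fun Q hQ => by
        apply ball_subset_ball'
        have h1 := h.dist_center_lt (hJD Q hQ) (hsel Q hQ.1)
        have h2 := h.radius_le (hJD Q hQ)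
        have h3 := hdist2 Q hQ.1
        have h4 := dist_triangle Q.center (sel Q) z
        rw [dist_comm Q.center (sel Q), dist_comm (sel Q) z] at h4
        rw [hQ.2] at h2
        have h5 : C₀ * b ≤ C₀ * a := by gcongr
        linarith) c
    have hcount : (J).Countable := h.countable.mono hJD
    refine (measure_biUnion_le _ hcount _).trans
      ((ENNReal.tsum_le_tsum fun Q : J => hle Q Q.2).trans (hcard.trans ?_))
    rw [finrank_euclideanSpace_fin]
    refine mul_le_mul_left (ENNReal.ofReal_le_ofReal ?_) _
    refine pow_le_pow_left₀ (by positivity) ?_ d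
    rw [div_le_iff₀ hb0, mul_assoc]
    gcongr
    rw [ha, ← h.scale_add P.gen i]
    gcongr
    · exact h.one_lt_A.le
  have hcover : ⋃ Q ∈ S, Q.carrier ⊆ (⋃ Q ∈ {Q ∈ S | P.gen + m ≤ Q.gen}, Q.carrier) ∪
      ⋃ i ∈ Finset.range m, ⋃ Q ∈ {Q ∈ S | Q.gen = P.gen + i}, Q.carrier := by
    refine iUnion₂_subset fun Q hQ x hx => ?_
    by_cases hg : P.gen + m ≤ Q.gen
    · exact Or.inl (mem_biUnion (show Q ∈ {Q ∈ S | P.gen + m ≤ Q.gen} from ⟨hQ, hg⟩) hx)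
    · have := hgen Q hQ
      refine Or.inr (mem_biUnion (x := Q.gen - P.gen) (by simp; omega)
        (mem_biUnion (x := Q) ⟨hQ, by omega⟩ hx))
  calc μ (⋃ Q ∈ S, Q.carrier)
      ≤ c + ∑ i ∈ Finset.range m, ENNReal.ofReal (((28 * C₀ + K + 1) * A₀ ^ m) ^ d) * c := by
        refine (measure_mono hcover).trans ((measure_union_le _ _).trans (add_le_add hsmall ?_))
        exact (measure_biUnion_finset_le _ _).trans
          (Finset.sum_le_sum fun i hi => hlevel i (Finset.mem_range.1 hi))
    _ = _ := by
        rw [Finset.sum_const, Finset.card_range, nsmul_eq_mul, clusterConstant, ← hKdef, ← hm]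
        have e1 : (56 * C₀) ^ n * (1 + (m : ℝ) * ((28 * C₀ + K + 1) * A₀ ^ m) ^ d) * a ^ n =
          (1 + (m : ℝ) * ((28 * C₀ + K + 1) * A₀ ^ m) ^ d) * ((56 * C₀) ^ n * a ^ n) := by ring
        rw [e1, ENNReal.ofReal_mul (p := 1 + _) (by positivity),
          ENNReal.ofReal_add (by positivity) (by positivity),
          ENNReal.ofReal_mul (p := (m : ℝ)) (by positivity), ENNReal.ofReal_natCast,
          ENNReal.ofReal_one, hc]
        ring

/-- The low density stopping cubes at which the energy is not large carry little mass. -/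
theorem measure_lowDensity_le (h : IsRootedLattice n C₀ A₀ ρ μ D R₀) (hnd : n ≤ d)
    {V : Submodule ℝ (Eucl d)} (hV : Module.finrank ℝ V = d - n)
    {α τ p : ℝ} (hα : 0 < α) (hα1 : α < 1) (hp : 0 ≤ p)
    (hτ : 0 < τ) {bad : Cube d → Cube d → Prop}
    (hbad : ∀ R Q, LowDensity n μ τ R Q → bad R Q) {R : Cube d} (hR : R ∈ D) :
    μ (⋃ Q ∈ {Q ∈ stopCubes D bad R | LowDensity n μ τ R Q ∧
        ¬ BigEnergy n p μ V α A₀ ρ (energyThreshold n C₀ A₀ α τ p) R Q}, Q.carrier) ≤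
      ENNReal.ofReal τ * R.dens2 n μ *
        ENNReal.ofReal (lowConstant n d C₀ A₀ α * scale A₀ ρ R.gen ^ n) := by
  have hC := h.C_pos
  have hA := h.A_pos
  have hW : Module.finrank ℝ Vᗮ = n := by
    have hsum := Submodule.finrank_add_finrank_orthogonal V
    rw [finrank_euclideanSpace_fin, hV] at hsum
    omega
  set S := {Q ∈ stopCubes D bad R | LowDensity n μ τ R Q ∧
        ¬ BigEnergy n p μ V α A₀ ρ (energyThreshold n C₀ A₀ α τ p) R Q} with hS
  have hSD : ∀ Q ∈ S, Q ∈ D := fun Q hQ => hQ.1.1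
  have hselex : ∀ Q : Cube d, ∃ z, Q ∈ S → z ∈ Q.carrier ∧
      ¬ ENNReal.ofReal (energyThreshold n C₀ A₀ α τ p) * R.dens2 n μ ^ p ≤
      ∫⁻ r in Icc (scale A₀ ρ Q.gen) (A₀ * scale A₀ ρ R.gen), energyIntegrand n p μ V α z r := by
    intro Q
    by_cases hQ : Q ∈ S
    · have := hQ.2.2
      rw [BigEnergy] at this
      push Not at this
      obtain ⟨z, hz, hz'⟩ := this
      exact ⟨z, fun _ => ⟨hz, not_le.2 hz'⟩⟩
    · exact ⟨0, fun hQ' => absurd hQ' hQ⟩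
  choose sel hsel using hselex
  set π := Vᗮ.orthogonalProjectionOnto with hπ
  have hη : 0 < α / 8 := by positivity
  -- Vitali is applied to the projections, not to the cubes, which is what makes the later packing
  -- `n`-dimensional. With ratio 2 and `A₀ > 2`, the selected cube attached to `Q` is never of a
  -- later generation than `Q`.
  obtain ⟨M, hMS, hMdisj, hMcov⟩ := Vitali.exists_disjoint_subfamily_covering_enlargement
    (fun Q : Cube d => closedBall (π (sel Q)) (α / 8 * scale A₀ ρ Q.gen)) S
    (fun Q => scale A₀ ρ Q.gen) 2 one_lt_two (fun Q _ => (h.scale_pos _).le) (scale A₀ ρ 0)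
    (fun Q _ => h.scale_strictAnti.antitone (Nat.zero_le _))
    (fun Q _ => nonempty_closedBall.2 (by have := h.scale_pos Q.gen; positivity))
  let cl : Cube d → Set (Cube d) := fun P => {Q ∈ S | P.gen ≤ Q.gen ∧
    ‖π (sel Q - sel P)‖ ≤ α / 4 * scale A₀ ρ P.gen}
  have hcov : ⋃ Q ∈ S, Q.carrier ⊆ ⋃ P ∈ M, ⋃ Q ∈ cl P, Q.carrier := by
    refine iUnion₂_subset fun Q hQ x hx => ?_
    obtain ⟨P, hP, ⟨w, hw1, hw2⟩, hle⟩ := hMcov Q hQ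
    have hg : P.gen ≤ Q.gen := by
      by_contra hcon
      have h1 : scale A₀ ρ P.gen * A₀ ≤ scale A₀ ρ Q.gen := by
        rw [mul_comm, ← h.scale_succ Q.gen]
        gcongr
        exact h.scale_strictAnti.antitone (by omega)
      have h2 := h.scale_pos P.gen
      have h3 : 2 < A₀ := by linarith [h.lt_A, h.one_lt]
      nlinarith
    refine mem_biUnion hP (mem_biUnion (x := Q) ⟨hQ, hg, ?_⟩ hx)
    have h1 : scale A₀ ρ Q.gen ≤ scale A₀ ρ P.gen := h.scale_strictAnti.antitone hg
    rw [map_sub, ← dist_eq_norm]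
    rw [mem_closedBall] at hw1 hw2
    have := dist_triangle_left (π (sel Q)) (π (sel P)) w
    nlinarith
  have hcl : ∀ P ∈ M, μ (⋃ Q ∈ cl P, Q.carrier) ≤ ENNReal.ofReal τ * R.dens2 n μ *
      ENNReal.ofReal (clusterConstant n d C₀ A₀ α * scale A₀ ρ P.gen ^ n) := by
    intro P hP
    have hPS := hMS hP
    refine h.measure_cluster_le (V := V) (p := p) (sel := sel) hα hα1 hp hτ hbad hR
      (fun Q hQ => hQ.1.1)
      (fun Q hQ => hQ.1.2.1) (fun Q hQ => (hsel Q hQ.1).1) ⟨hPS, le_rfl, ?_⟩ (hsel P hPS).2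
      (fun Q hQ => hQ.2.1) (fun Q hQ => hQ.2.2)
    rw [sub_self, map_zero, norm_zero]
    have := h.scale_pos P.gen
    positivity
  have hpack := tsum_radius_pow_le M (fun Q => π (sel Q)) (fun Q => α / 8 * scale A₀ ρ Q.gen)
    (fun Q _ => by have := h.scale_pos Q.gen; positivity)
    (fun Q hQ Q' hQ' hne => (hMdisj hQ hQ' hne).mono ball_subset_closedBall ball_subset_closedBall)
    (y := π R.center) (R := (28 * C₀ + 1) * scale A₀ ρ R.gen)
    (by have := h.scale_pos R.gen; positivity) (fun Q hQ => by
      apply ball_subset_ball'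
      have hQS := hMS hQ
      have h1 := h.dist_center_lt hR (hQS.1.2.1.2 (hsel Q hQS).1)
      have h2 := h.radius_le hR
      have h3 : scale A₀ ρ Q.gen ≤ scale A₀ ρ R.gen :=
        h.scale_strictAnti.antitone hQS.1.2.1.1.le
      have h4 := h.scale_pos Q.gen
      rw [dist_eq_norm, ← map_sub]
      have h5 := norm_orthogonalProjectionOnto_le Vᗮ (sel Q - R.center)
      rw [← dist_eq_norm] at h5
      have h6 : α / 8 * scale A₀ ρ Q.gen ≤ scale A₀ ρ R.gen := by nlinarith
      linarith)
  rw [hW] at hpack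
  have hcount : M.Countable := h.countable.mono fun Q hQ => hSD Q (hMS hQ)
  have hcc := h.clusterConstant_pos hα
  have hsR := h.scale_pos R.gen
  calc μ (⋃ Q ∈ S, Q.carrier) ≤ ∑' P : M, μ (⋃ Q ∈ cl P, Q.carrier) :=
        (measure_mono hcov).trans (measure_biUnion_le _ hcount _)
    _ ≤ ∑' P : M, ENNReal.ofReal τ * R.dens2 n μ * (ENNReal.ofReal (clusterConstant n d C₀ A₀ α *
          ((α / 8) ^ n)⁻¹) * ENNReal.ofReal ((α / 8 * scale A₀ ρ (P : Cube d).gen) ^ n)) := by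
        refine ENNReal.tsum_le_tsum fun P => (hcl P P.2).trans (le_of_eq ?_)
        rw [← ENNReal.ofReal_mul (by positivity), mul_pow]
        congr 2
        field_simp
    _ ≤ ENNReal.ofReal τ * R.dens2 n μ * (ENNReal.ofReal (clusterConstant n d C₀ A₀ α *
          ((α / 8) ^ n)⁻¹) * ENNReal.ofReal (((28 * C₀ + 1) * scale A₀ ρ R.gen) ^ n)) := by
        rw [ENNReal.tsum_mul_left, ENNReal.tsum_mul_left]
        gcongr
    _ = _ := by
        rw [← ENNReal.ofReal_mul (by positivity), lowConstant, mul_pow, div_pow (28 * C₀ + 1) (α / 8)]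
        congr 2
        field_simp

/-- This is where `lowThreshold` comes from: the doubling of `R` gives `Θ(R) scale(R) ^ n ≤ C₀
μ(R)`, and the threshold is half the inverse of `C₀` times `lowConstant`. -/
theorem measure_lowDensity_le_half (h : IsRootedLattice n C₀ A₀ ρ μ D R₀) (hnd : n ≤ d)
    {V : Submodule ℝ (Eucl d)} (hV : Module.finrank ℝ V = d - n)
    {α p : ℝ} (hα : 0 < α) (hα1 : α < 1) (hp : 0 ≤ p) {bad : Cube d → Cube d → Prop}
    (hbad : ∀ R Q, LowDensity n μ (lowThreshold n d C₀ A₀ α) R Q → bad R Q) {R : Cube d}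
    (hR : R ∈ D) (hdb : R.Doubling C₀ μ) :
    μ (⋃ Q ∈ {Q ∈ stopCubes D bad R | LowDensity n μ (lowThreshold n d C₀ A₀ α) R Q ∧
        ¬ BigEnergy n p μ V α A₀ ρ
          (energyThreshold n C₀ A₀ α (lowThreshold n d C₀ A₀ α) p) R Q}, Q.carrier) ≤
      ENNReal.ofReal (1 / 2) * μ R.carrier := by
  refine (h.measure_lowDensity_le hnd hV hα hα1 hp (h.lowThreshold_pos hα) hbad hR).trans ?_
  have hC := h.C_pos
  have hl := h.lowConstant_pos hα
  have hsR := h.scale_pos R.gen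
  have hτ := h.lowThreshold_pos hα
  calc ENNReal.ofReal (lowThreshold n d C₀ A₀ α) * R.dens2 n μ *
        ENNReal.ofReal (lowConstant n d C₀ A₀ α * scale A₀ ρ R.gen ^ n)
      = ENNReal.ofReal (1 / (2 * C₀)) *
          (R.dens2 n μ * ENNReal.ofReal (scale A₀ ρ R.gen ^ n)) := by
        have e : 1 / (2 * C₀) = lowThreshold n d C₀ A₀ α * lowConstant n d C₀ A₀ α := by
          unfold lowThreshold; field_simp
        rw [e, ENNReal.ofReal_mul hl.le, ENNReal.ofReal_mul hτ.le]
        ring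
    _ ≤ ENNReal.ofReal (1 / (2 * C₀)) *
          (R.dens2 n μ * ENNReal.ofReal ((2 * 28 * R.radius) ^ n)) := by
        gcongr
        have := h.scale_le_radius hR
        linarith
    _ ≤ ENNReal.ofReal (1 / (2 * C₀)) * (ENNReal.ofReal C₀ * μ R.carrier) := by
        exact mul_le_mul_right (h.dens2_le_of_doubling hR hdb) _
    _ = _ := by
        rw [← mul_assoc, ← ENNReal.ofReal_mul (by positivity)]
        congr 2
        field_simp

end IsRootedLattice

end

/-! ### The family of top cubes and its combinatorics -/

noncomputable section

section Top

variable {d : ℕ}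

/-- The doubling cubes contained in some bad cube of `R`. -/
def badDoublingCubes (C₀ : ℝ) (μ : Measure (Eucl d)) (D : Set (Cube d))
    (bad : Cube d → Cube d → Prop) (R : Cube d) : Set (Cube d) :=
  {Q | Q ∈ doublingCubes C₀ μ D ∧ ∃ S ∈ D, S.SSub R ∧ bad R S ∧ Q.Sub S}

/-- The maximal doubling cubes contained in some bad cube of `R`. -/
def nextStop (C₀ : ℝ) (μ : Measure (Eucl d)) (D : Set (Cube d))
    (bad : Cube d → Cube d → Prop) (R : Cube d) : Set (Cube d) :=
  {Q | Q ∈ badDoublingCubes C₀ μ D bad R ∧ ∀ P ∈ badDoublingCubes C₀ μ D bad R, ¬ Q.SSub P}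

/-- The cubes reached from `R₀` by iterating the stopping procedure. -/
def topCubes (C₀ : ℝ) (μ : Measure (Eucl d)) (D : Set (Cube d))
    (bad : Cube d → Cube d → Prop) (R₀ : Cube d) : Set (Cube d) :=
  {Q | Relation.ReflTransGen (fun R Q => Q ∈ nextStop C₀ μ D bad R) R₀ Q}

theorem Cube.Sub.trans_ssub {Q P R : Cube d} (h1 : Q.Sub P) (h2 : P.SSub R) : Q.SSub R :=
  ⟨h2.1.trans_le h1.1, h1.2.trans h2.2⟩

theorem Cube.SSub.sub {Q R : Cube d} (h : Q.SSub R) : Q.Sub R := ⟨h.1.le, h.2⟩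

theorem Cube.Sub.trans {Q P R : Cube d} (h1 : Q.Sub P) (h2 : P.Sub R) : Q.Sub R :=
  ⟨h2.1.trans h1.1, h1.2.trans h2.2⟩

end Top

namespace IsRootedLattice

variable {n d : ℕ} {C₀ A₀ ρ : ℝ} {μ : Measure (Eucl d)} {D : Set (Cube d)} {R₀ : Cube d}
  {bad : Cube d → Cube d → Prop}

theorem ssub_of_mem_nextStop {Q R : Cube d} (hQ : Q ∈ nextStop C₀ μ D bad R) : Q.SSub R := by
  obtain ⟨⟨_, S, _, hSR, _, hQS⟩, _⟩ := hQ
  exact hQS.trans_ssub hSR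

theorem topCubes_subset (h : IsRootedLattice n C₀ A₀ ρ μ D R₀) :
    topCubes C₀ μ D bad R₀ ⊆ doublingCubes C₀ μ D := by
  intro Q hQ
  rcases Relation.ReflTransGen.cases_tail hQ with rfl | ⟨R, _, hQR⟩
  · exact ⟨h.root_mem, h.root_doubling⟩
  · exact hQR.1.1

theorem exists_mem_nextStop {Q R : Cube d} (hQ : Q ∈ badDoublingCubes C₀ μ D bad R) :
    ∃ P ∈ nextStop C₀ μ D bad R, Q.Sub P := by
  classical
  let p : ℕ → Prop := fun k => ∃ P ∈ badDoublingCubes C₀ μ D bad R, P.gen = k ∧ Q.Sub P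
  have hex : ∃ k, p k := ⟨Q.gen, Q, hQ, rfl, le_rfl, subset_rfl⟩
  obtain ⟨P, hP, hk, hQP⟩ := Nat.find_spec hex
  refine ⟨P, ⟨hP, fun P' hP' hPP' => ?_⟩, hQP⟩
  exact Nat.find_min hex (m := P'.gen) (by rw [← hk]; exact hPP'.1)
    ⟨P', hP', rfl, hQP.trans hPP'.sub⟩

theorem nextStop_eq_of_mem (h : IsRootedLattice n C₀ A₀ ρ μ D R₀) {Q Q' R : Cube d}
    (hQ : Q ∈ nextStop C₀ μ D bad R) (hQ' : Q' ∈ nextStop C₀ μ D bad R) {z : Eucl d}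
    (hz : z ∈ Q.carrier) (hz' : z ∈ Q'.carrier) : Q = Q' := by
  rcases lt_trichotomy Q.gen Q'.gen with hg | hg | hg
  · exact absurd (h.ssub_of_mem hQ'.1.1.1 hQ.1.1.1 hg hz' hz) (hQ'.2 Q hQ.1)
  · exact h.eq_of_mem hQ.1.1.1 hQ'.1.1.1 hg hz hz'
  · exact absurd (h.ssub_of_mem hQ.1.1.1 hQ'.1.1.1 hg hz hz') (hQ.2 Q' hQ'.1)

theorem gen_le_of_reflTransGen {P R : Cube d}
    (hP : Relation.ReflTransGen (fun R Q => Q ∈ nextStop C₀ μ D bad R) R P) : P.Sub R := by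
  induction hP with
  | refl => exact ⟨le_rfl, subset_rfl⟩
  | tail _ hbc ih => exact (ssub_of_mem_nextStop hbc).sub.trans ih

/-- By disjointness of the successors of a given cube, a descending chain of top cubes containing
`z` has no choice at any step; the chain from `R₀` to `P` must therefore pass through `R`. -/
theorem reflTransGen_of_mem (h : IsRootedLattice n C₀ A₀ ρ μ D R₀) {P R : Cube d}
    (hP : P ∈ topCubes C₀ μ D bad R₀) (hR : R ∈ topCubes C₀ μ D bad R₀) (hg : R.gen < P.gen)
    {z : Eucl d} (hz : z ∈ P.carrier) (hz' : z ∈ R.carrier) :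
    Relation.ReflTransGen (fun R Q => Q ∈ nextStop C₀ μ D bad R) R P := by
  induction hR with
  | refl => exact hP
  | @tail R' R hR' hRR' ih =>
    have hss := ssub_of_mem_nextStop hRR'
    have h1 := ih (hss.1.trans hg) (hss.2 hz')
    rcases Relation.ReflTransGen.cases_head h1 with rfl | ⟨Q, hQ, hQP⟩
    · exact absurd (hss.1.trans hg) (lt_irrefl _)
    · have hsub := gen_le_of_reflTransGen hQP
      rwa [h.nextStop_eq_of_mem hQ hRR' (hsub.2 hz) hz'] at hQP

theorem exists_nextStop_of_ssub (h : IsRootedLattice n C₀ A₀ ρ μ D R₀) {P R : Cube d}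
    (hP : P ∈ topCubes C₀ μ D bad R₀) (hR : R ∈ topCubes C₀ μ D bad R₀) (hPR : P.SSub R) :
    ∃ Q ∈ nextStop C₀ μ D bad R, P.Sub Q := by
  have hz := h.lattice.center_mem P (h.topCubes_subset hP).1
  rcases Relation.ReflTransGen.cases_head
    (h.reflTransGen_of_mem hP hR hPR.1 hz (hPR.2 hz)) with rfl | ⟨Q, hQ, hQP⟩
  · exact absurd hPR.1 (lt_irrefl _)
  · exact ⟨Q, hQ, gen_le_of_reflTransGen hQP⟩

/-- The maximality in `nextCubes` refers to `Top` alone, while `nextStop` refers to bad cubes. They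
agree because every top cube strictly inside `R` descends from a successor of `R`. -/
theorem nextCubes_topCubes (h : IsRootedLattice n C₀ A₀ ρ μ D R₀) {R : Cube d}
    (hR : R ∈ topCubes C₀ μ D bad R₀) :
    nextCubes (topCubes C₀ μ D bad R₀) R = nextStop C₀ μ D bad R := by
  ext Q
  constructor
  · rintro ⟨hQ, hQR, hmax⟩
    obtain ⟨Q', hQ', hsub⟩ := h.exists_nextStop_of_ssub hQ hR hQR
    have hQ'top : Q' ∈ topCubes C₀ μ D bad R₀ := Relation.ReflTransGen.tail hR hQ'
    rcases hsub.1.lt_or_eq with hg | hg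
    · exact absurd ⟨hg, hsub.2⟩ (hmax Q' hQ'top (ssub_of_mem_nextStop hQ'))
    · have hz := h.lattice.center_mem Q (h.topCubes_subset hQ).1
      rwa [h.eq_of_mem (h.topCubes_subset hQ).1 hQ'.1.1.1 hg.symm hz (hsub.2 hz)]
  · intro hQ
    refine ⟨Relation.ReflTransGen.tail hR hQ, ssub_of_mem_nextStop hQ, fun P hP hPR hQP => ?_⟩
    obtain ⟨Q', hQ', hsub⟩ := h.exists_nextStop_of_ssub hP hR hPR
    have hz := h.lattice.center_mem Q hQ.1.1.1
    have he := h.nextStop_eq_of_mem hQ hQ' hz (hsub.2 (hQP.2 hz))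
    rw [← he] at hsub
    exact absurd (hQP.1.trans_le hsub.1) (lt_irrefl _)

/-- Every bad cube is covered by doubling cubes up to a null set, and each of these lies in a
successor of `R`. -/
theorem measure_goodSet_inter_bad (h : IsRootedLattice n C₀ A₀ ρ μ D R₀) {R : Cube d}
    (hR : R ∈ topCubes C₀ μ D bad R₀) :
    μ (goodSet (topCubes C₀ μ D bad R₀) R ∩ ⋃ S ∈ {S ∈ D | S.SSub R ∧ bad R S}, S.carrier) = 0 := by
  rw [inter_iUnion₂, measure_biUnion_null_iff (h.countable.mono (sep_subset _ _))]
  rintro S ⟨hS, hSR, hbad⟩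
  obtain ⟨F, hF, hFS, hF0⟩ := h.lattice.doubling_cover S hS
  refine measure_mono_null ?_ hF0
  rintro x ⟨⟨_, hx⟩, hxS⟩
  refine ⟨hxS, fun hxF => hx ?_⟩
  simp only [mem_iUnion, exists_prop] at hxF ⊢
  obtain ⟨Q, hQ, hxQ⟩ := hxF
  obtain ⟨P, hP, hQP⟩ := exists_mem_nextStop (bad := bad) (R := R)
    ⟨hF hQ, S, hS, hSR, hbad, hFS Q hQ⟩
  rw [h.nextCubes_topCubes hR]
  exact ⟨P, hP, hQP.2 hxQ⟩

theorem sdiff_bad_subset_goodSet (h : IsRootedLattice n C₀ A₀ ρ μ D R₀) {R : Cube d}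
    (hR : R ∈ topCubes C₀ μ D bad R₀) :
    R.carrier \ ⋃ S ∈ {S ∈ D | S.SSub R ∧ bad R S}, S.carrier ⊆
      goodSet (topCubes C₀ μ D bad R₀) R := by
  rintro x ⟨hx, hxb⟩
  refine ⟨hx, fun hxn => hxb ?_⟩
  rw [h.nextCubes_topCubes hR] at hxn
  simp only [mem_iUnion, exists_prop] at hxn ⊢
  obtain ⟨Q, ⟨⟨_, S, hS, hSR, hbad, hQS⟩, _⟩, hxQ⟩ := hxn
  exact ⟨S, ⟨hS, hSR, hbad⟩, hQS.2 hxQ⟩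

/-- The smallest doubling cube `P` with `Q ⊆ P ⊆ R` controls the density of `Q`. If `P ≠ R` had
density above `4 Θ(R)` it would be bad, hence inside a successor of `R`, and `Q` would be outside
the tree. -/
theorem dens2_le_of_mem_treeCubes (h : IsRootedLattice n C₀ A₀ ρ μ D R₀)
    (hbad : ∀ R Q, HighDensity n C₀ μ R Q → bad R Q) {R Q : Cube d}
    (hR : R ∈ topCubes C₀ μ D bad R₀) (hQ : Q ∈ treeCubes D (topCubes C₀ μ D bad R₀) R) :
    Q.dens2 n μ ≤ ENNReal.ofReal (treeConstant n d C₀ A₀ * 4) * R.dens2 n μ := by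
  classical
  obtain ⟨hQD, hQR, hQn⟩ := hQ
  obtain ⟨hRD, hRdb⟩ := h.topCubes_subset hR
  let p : ℕ → Prop := fun k => ∃ P ∈ D, P.gen = k ∧ P.Doubling C₀ μ ∧ Q.Sub P ∧ P.Sub R
  have hpR : p R.gen := ⟨R, hRD, rfl, hRdb, hQR, le_rfl, subset_rfl⟩
  obtain ⟨P, hP, hPk, hPdb, hQP, hPR⟩ := Nat.findGreatest_spec (P := p) hQR.1 hpR
  have h1 := h.dens2_le_doubling_ancestor hQD hP hPdb hQP (by
    intro S hS hQS hSP hSdb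
    exact Nat.findGreatest_is_greatest (P := p) (n := Q.gen) (k := S.gen)
      (by rw [← hPk]; exact hSP.1) hQS.1.le ⟨S, hS, rfl, hSdb, hQS.sub, hSP.sub.trans hPR⟩)
  have h2 : P.dens2 n μ ≤ 4 * R.dens2 n μ := by
    by_contra hcon
    rcases hPR.1.lt_or_eq with hg | hg
    · have hPb : P ∈ badDoublingCubes C₀ μ D bad R := ⟨⟨hP, hPdb⟩, P, hP, ⟨hg, hPR.2⟩,
        hbad R P ⟨hPdb, not_le.1 hcon⟩, le_rfl, subset_rfl⟩
      obtain ⟨P', hP', hPP'⟩ := exists_mem_nextStop hPb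
      rw [← h.nextCubes_topCubes hR] at hP'
      exact hQn P' hP' (hQP.trans hPP')
    · have hz := h.lattice.center_mem P hP
      rw [h.eq_of_mem hP hRD hg.symm hz (hPR.2 hz)] at hcon
      exact hcon (le_mul_of_one_le_left' (by norm_num))
  have hC := h.C_pos
  have hA := h.A_pos
  have ht : 0 ≤ treeConstant n d C₀ A₀ := by unfold treeConstant; positivity
  calc Q.dens2 n μ ≤ ENNReal.ofReal (treeConstant n d C₀ A₀) * (4 * R.dens2 n μ) :=
        h1.trans (by gcongr)
    _ = _ := by
        rw [ENNReal.ofReal_mul ht, mul_assoc]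
        norm_num

end IsRootedLattice

/-! ### Weighted mass of a single top cube -/

/-- Superadditivity of the Lebesgue integral, without measurability assumptions. -/
theorem tsum_lintegral_le {ι α : Type*} [MeasurableSpace α] (ν : Measure α)
    (f : ι → α → ℝ≥0∞) : ∑' i, ∫⁻ a, f i a ∂ν ≤ ∫⁻ a, ∑' i, f i a ∂ν := by
  classical
  rw [ENNReal.tsum_eq_iSup_sum]
  refine iSup_le fun s => ?_
  have key : ∑ i ∈ s, ∫⁻ a, f i a ∂ν ≤ ∫⁻ a, ∑ i ∈ s, f i a ∂ν := by
    induction s using Finset.induction_on with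
    | empty => simp
    | insert i s hi ih =>
      simp only [Finset.sum_insert hi]
      exact (add_le_add le_rfl ih).trans (le_lintegral_add _ _)
  exact key.trans (lintegral_mono fun a => ENNReal.sum_le_tsum s)

theorem tsum_ite_le_of_subsingleton {ι : Type*} (q : ι → Prop) [DecidablePred q]
    (hq : ∀ i j, q i → q j → i = j) (c : ℝ≥0∞) : ∑' i, (if q i then c else 0) ≤ c := by
  by_cases hex : ∃ i, q i
  · obtain ⟨i, hi⟩ := hex
    rw [tsum_eq_single i fun j hj => if_neg fun hj' => hj (hq j i hj' hi), if_pos hi]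
  · push Not at hex
    simp [hex]

end

noncomputable section

/-- The stopping condition of the corona decomposition. -/
def BadCube {d : ℕ} (n : ℕ) (C₀ A₀ ρ : ℝ) (μ : Measure (Eucl d)) (V : Submodule ℝ (Eucl d))
    (α τ p : ℝ) (R Q : Cube d) : Prop :=
  HighDensity n C₀ μ R Q ∨ LowDensity n μ τ R Q ∨
    BigEnergy n p μ V α A₀ ρ (energyThreshold n C₀ A₀ α τ p) R Q

/-- The points of `R` in stopping cubes with large energy. -/
def bigEnergySet {d : ℕ} (n : ℕ) (A₀ ρ : ℝ) (μ : Measure (Eucl d)) (D : Set (Cube d))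
    (V : Submodule ℝ (Eucl d)) (α p ε : ℝ) (bad : Cube d → Cube d → Prop) (R : Cube d) :
    Set (Eucl d) :=
  ⋃ Q ∈ {Q ∈ stopCubes D bad R | BigEnergy n p μ V α A₀ ρ ε R Q}, Q.carrier

namespace IsRootedLattice

variable {n d : ℕ} {C₀ A₀ ρ : ℝ} {μ : Measure (Eucl d)} {D : Set (Cube d)} {R₀ : Cube d}
  {bad : Cube d → Cube d → Prop}

theorem measurableSet_bigEnergySet (h : IsRootedLattice n C₀ A₀ ρ μ D R₀)
    (V : Submodule ℝ (Eucl d)) (α p ε : ℝ) (R : Cube d) :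
    MeasurableSet (bigEnergySet n A₀ ρ μ D V α p ε bad R) :=
  MeasurableSet.biUnion (h.countable.mono fun _ hQ => hQ.1.1)
    fun Q hQ => h.lattice.measurableSet Q hQ.1.1

/-- A doubling stopping cube needs no further descent: being a maximal bad cube, it is itself a
maximal doubling cube inside a bad cube. Its whole mass thus appears among the successors. -/
theorem highDensity_stop_mem_nextStop {R Q : Cube d} (hQ : Q ∈ stopCubes D bad R)
    (hdb : Q.Doubling C₀ μ) : Q ∈ nextStop C₀ μ D bad R := by
  refine ⟨⟨⟨hQ.1, hdb⟩, Q, hQ.1, hQ.2.1, hQ.2.2.1, le_rfl, subset_rfl⟩, ?_⟩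
  rintro P ⟨_, S, hS, hSR, hbad, hPS⟩ hQP
  exact hQ.2.2.2 S hS hSR hbad ⟨hPS.1.trans_lt hQP.1, hQP.2.trans hPS.2⟩

theorem four_rpow_le {p : ℝ} (hp : 1 ≤ p) {x y : ℝ≥0∞} (hxy : 4 * x ≤ y) :
    x ^ p ≤ ENNReal.ofReal (1 / 4) * y ^ p := by
  have h4 : (4 : ℝ≥0∞) ≤ 4 ^ p := by
    calc (4 : ℝ≥0∞) = 4 ^ (1 : ℝ) := (ENNReal.rpow_one _).symm
      _ ≤ 4 ^ p := ENNReal.rpow_le_rpow_of_exponent_le (by norm_num) hp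
  calc x ^ p = ENNReal.ofReal (1 / 4) * (4 * x ^ p) := by
        rw [← mul_assoc]
        have : ENNReal.ofReal (1 / 4) * 4 = 1 := by
          rw [show (4 : ℝ≥0∞) = ENNReal.ofReal 4 by norm_num,
            ← ENNReal.ofReal_mul (by norm_num)]
          norm_num
        rw [this, one_mul]
    _ ≤ ENNReal.ofReal (1 / 4) * (4 ^ p * x ^ p) := by gcongr
    _ = ENNReal.ofReal (1 / 4) * (4 * x) ^ p := by
        rw [ENNReal.mul_rpow_of_nonneg _ _ (by linarith)]
    _ ≤ _ := by gcongr

/-- The weighted mass of a top cube is controlled by its good part, its part of large energy and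
half of the weighted mass of the next cubes. -/
theorem weighted_mass_le (h : IsRootedLattice n C₀ A₀ ρ μ D R₀) (hnd : n ≤ d)
    {V : Submodule ℝ (Eucl d)} (hV : Module.finrank ℝ V = d - n)
    {α τ p : ℝ} (hα : 0 < α) (hα1 : α < 1) (hp : 1 ≤ p) (hτ : τ = lowThreshold n d C₀ A₀ α)
    (hbad : bad = BadCube n C₀ A₀ ρ μ V α τ p) {R : Cube d}
    (hR : R ∈ topCubes C₀ μ D bad R₀) :
    R.dens2 n μ ^ p * μ R.carrier ≤
      2 * (R.dens2 n μ ^ p * μ (goodSet (topCubes C₀ μ D bad R₀) R)) +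
      2 * (R.dens2 n μ ^ p *
        μ (bigEnergySet n A₀ ρ μ D V α p (energyThreshold n C₀ A₀ α τ p) bad R)) +
      ENNReal.ofReal (1 / 2) * ∑' Q : nextCubes (topCubes C₀ μ D bad R₀) R,
        (Q : Cube d).dens2 n μ ^ p * μ (Q : Cube d).carrier := by
  have hlowbad : ∀ R Q, LowDensity n μ τ R Q → bad R Q := fun R Q hl => by
    rw [hbad]; exact Or.inr (Or.inl hl)
  obtain ⟨hRD, hRdb⟩ := h.topCubes_subset hR
  set ε := energyThreshold n C₀ A₀ α τ p with hε
  set G := goodSet (topCubes C₀ μ D bad R₀) R with hG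
  set B := bigEnergySet n A₀ ρ μ D V α p ε bad R with hB
  set L := ⋃ Q ∈ {Q ∈ stopCubes D bad R | LowDensity n μ τ R Q ∧
    ¬ BigEnergy n p μ V α A₀ ρ ε R Q}, Q.carrier with hL
  set H := {Q ∈ stopCubes D bad R | HighDensity n C₀ μ R Q} with hH
  -- Large energy is tested first, so that `L` contains only low density cubes with a point of small
  -- energy, as the mass estimate requires.
  have hcov : R.carrier ⊆ (G ∪ B) ∪ ((⋃ Q ∈ H, Q.carrier) ∪ L) := by
    intro x hx
    by_cases hxb : x ∈ ⋃ S ∈ {S ∈ D | S.SSub R ∧ bad R S}, S.carrier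
    · simp only [mem_iUnion, exists_prop] at hxb
      obtain ⟨S, ⟨hS, hSR, hSb⟩, hxS⟩ := hxb
      obtain ⟨P, hP, hSP⟩ := exists_mem_stopCubes hS hSR hSb
      have hxP := hSP.2 hxS
      have hPb := hP.2.2.1
      rw [hbad] at hPb
      by_cases hE : BigEnergy n p μ V α A₀ ρ ε R P
      · exact Or.inl (Or.inr (mem_biUnion (x := P) ⟨hP, hE⟩ hxP))
      · rcases hPb with hPb | hPb | hPb
        · exact Or.inr (Or.inl (mem_biUnion (x := P) ⟨hP, hPb⟩ hxP))
        · exact Or.inr (Or.inr (mem_biUnion (x := P) ⟨hP, hPb, hE⟩ hxP))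
        · exact absurd hPb hE
    · exact Or.inl (Or.inl (h.sdiff_bad_subset_goodSet hR ⟨hx, hxb⟩))
  have hLle : μ L ≤ ENNReal.ofReal (1 / 2) * μ R.carrier := by
    have := h.measure_lowDensity_le_half hnd hV (p := p) hα hα1 (by linarith)
      (bad := bad) (by rw [← hτ]; exact hlowbad) hRD hRdb
    rwa [← hτ] at this
  have hHsub : H ⊆ nextCubes (topCubes C₀ μ D bad R₀) R := by
    intro Q hQ
    rw [h.nextCubes_topCubes hR]
    exact highDensity_stop_mem_nextStop hQ.1 hQ.2.1
  have hHle : R.dens2 n μ ^ p * μ (⋃ Q ∈ H, Q.carrier) ≤ ENNReal.ofReal (1 / 4) *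
      ∑' Q : nextCubes (topCubes C₀ μ D bad R₀) R,
        (Q : Cube d).dens2 n μ ^ p * μ (Q : Cube d).carrier := by
    calc R.dens2 n μ ^ p * μ (⋃ Q ∈ H, Q.carrier)
        ≤ R.dens2 n μ ^ p * ∑' Q : H, μ (Q : Cube d).carrier := by
          gcongr
          exact measure_biUnion_le _ (h.countable.mono fun Q hQ => hQ.1.1) _
      _ = ∑' Q : H, R.dens2 n μ ^ p * μ (Q : Cube d).carrier := ENNReal.tsum_mul_left.symm
      _ ≤ ∑' Q : H, ENNReal.ofReal (1 / 4) *
          ((Q : Cube d).dens2 n μ ^ p * μ (Q : Cube d).carrier) := by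
          refine ENNReal.tsum_le_tsum fun Q => ?_
          rw [← mul_assoc]
          gcongr
          exact four_rpow_le hp Q.2.2.2.le
      _ = ENNReal.ofReal (1 / 4) *
          ∑' Q : H, (Q : Cube d).dens2 n μ ^ p * μ (Q : Cube d).carrier := ENNReal.tsum_mul_left
      _ ≤ _ := by
          gcongr
          exact ENNReal.tsum_mono_subtype
            (fun Q : Cube d => Q.dens2 n μ ^ p * μ Q.carrier) hHsub
  set X := ∑' Q : nextCubes (topCubes C₀ μ D bad R₀) R,
        (Q : Cube d).dens2 n μ ^ p * μ (Q : Cube d).carrier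
  set θ := R.dens2 n μ ^ p with hθ
  have hθtop : θ ≠ ∞ := ENNReal.rpow_ne_top_of_nonneg (by linarith) (h.dens2_ne_top hRD)
  -- The low density half is absorbed into the left side, which doubles the coefficient `1 / 4` of
  -- the successors to the final `1 / 2`; this explains the factor 4 in `HighDensity`.
  have hmain : θ * μ R.carrier ≤ (θ * μ G + θ * μ B + ENNReal.ofReal (1 / 4) * X) +
      ENNReal.ofReal (1 / 2) * (θ * μ R.carrier) := by
    calc θ * μ R.carrier ≤ θ * ((μ G + μ B) + (μ (⋃ Q ∈ H, Q.carrier) + μ L)) := by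
          gcongr
          exact (measure_mono hcov).trans ((measure_union_le _ _).trans
            (add_le_add (measure_union_le _ _) (measure_union_le _ _)))
      _ = θ * μ G + θ * μ B + θ * μ (⋃ Q ∈ H, Q.carrier) + θ * μ L := by ring
      _ ≤ θ * μ G + θ * μ B + ENNReal.ofReal (1 / 4) * X +
          θ * (ENNReal.ofReal (1 / 2) * μ R.carrier) := by gcongr
      _ = _ := by ring
  have hfin : θ * μ R.carrier ≠ ∞ := ENNReal.mul_ne_top hθtop (h.measure_carrier_ne_top R)
  set y := θ * μ R.carrier
  have hhalf : ENNReal.ofReal (1 / 2) * y + ENNReal.ofReal (1 / 2) * y = y := by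
    rw [← add_mul, ← ENNReal.ofReal_add (by norm_num) (by norm_num)]
    norm_num
  have hle : ENNReal.ofReal (1 / 2) * y ≤ θ * μ G + θ * μ B + ENNReal.ofReal (1 / 4) * X := by
    have hne : ENNReal.ofReal (1 / 2) * y ≠ ∞ := ENNReal.mul_ne_top ENNReal.ofReal_ne_top hfin
    refine (ENNReal.add_le_add_iff_right hne).1 ?_
    rw [hhalf]
    exact hmain
  calc y = 2 * (ENNReal.ofReal (1 / 2) * y) := by rw [two_mul, hhalf]
    _ ≤ 2 * (θ * μ G + θ * μ B + ENNReal.ofReal (1 / 4) * X) := by gcongr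
    _ = 2 * (θ * μ G) + 2 * (θ * μ B) + (2 * ENNReal.ofReal (1 / 4)) * X := by ring
    _ = _ := by
        congr 2
        rw [show (2 : ℝ≥0∞) = ENNReal.ofReal 2 by norm_num, ← ENNReal.ofReal_mul (by norm_num)]
        norm_num

/-- The densities of cubes at small scales are controlled by the growth of `μ`. -/
theorem dens2_le_of_growth (h : IsRootedLattice n C₀ A₀ ρ μ D R₀) {C₁ : ℝ≥0} {r₀ : ℝ}
    (hgrowth : ∀ x ∈ μ.support, ∀ r : ℝ, 0 < r → r ≤ r₀ →
      μ (ball x r) ≤ C₁ * ENNReal.ofReal (r ^ n)) {Q : Cube d} (hQ : Q ∈ D)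
    (hr : 56 * Q.radius ≤ r₀) : Q.dens2 n μ ≤ C₁ := by
  have hrad := h.radius_pos hQ
  have hpos : 0 < (2 * 28 * Q.radius) ^ n := by positivity
  unfold Cube.dens2 Cube.densB density
  rw [ENNReal.div_le_iff (by simpa using hpos) ENNReal.ofReal_ne_top]
  exact hgrowth _ (h.mem_support hQ (h.lattice.center_mem Q hQ)) _ (by positivity) (by linarith)

/-- A qualitative bound depending on `r₀` and the total mass; it serves only to make sums finite
before absorbing, and does not enter the final constant. -/
theorem dens2_le_global (h : IsRootedLattice n C₀ A₀ ρ μ D R₀) {C₁ : ℝ≥0} {r₀ : ℝ}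
    (hr₀ : 0 < r₀) (hgrowth : ∀ x ∈ μ.support, ∀ r : ℝ, 0 < r → r ≤ r₀ →
      μ (ball x r) ≤ C₁ * ENNReal.ofReal (r ^ n)) {Q : Cube d} (hQ : Q ∈ D) :
    Q.dens2 n μ ≤ C₁ + μ univ / ENNReal.ofReal (r₀ ^ n) := by
  rcases le_or_gt (56 * Q.radius) r₀ with hr | hr
  · exact (h.dens2_le_of_growth hgrowth hQ hr).trans le_self_add
  · refine le_trans ?_ le_add_self
    unfold Cube.dens2 Cube.densB density
    refine ENNReal.div_le_div (measure_mono (subset_univ _)) (ENNReal.ofReal_le_ofReal ?_)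
    exact pow_le_pow_left₀ hr₀.le (by linarith) n

/-- If the good part of `R` has positive measure then the density of `R` is controlled by the
growth of `μ`. -/
theorem weighted_goodSet_le (h : IsRootedLattice n C₀ A₀ ρ μ D R₀) {τ p : ℝ} (hτ : 0 < τ)
    (hp : 0 ≤ p) (hbad : ∀ R Q, LowDensity n μ τ R Q → bad R Q) {C₁ : ℝ≥0} {r₀ : ℝ}
    (hr₀ : 0 < r₀) (hgrowth : ∀ x ∈ μ.support, ∀ r : ℝ, 0 < r → r ≤ r₀ →
      μ (ball x r) ≤ C₁ * ENNReal.ofReal (r ^ n)) {R : Cube d}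
    (hR : R ∈ topCubes C₀ μ D bad R₀) :
    R.dens2 n μ ^ p * μ (goodSet (topCubes C₀ μ D bad R₀) R) ≤
      ENNReal.ofReal (τ⁻¹ ^ p) * C₁ ^ p * μ (goodSet (topCubes C₀ μ D bad R₀) R) := by
  by_cases h0 : μ (goodSet (topCubes C₀ μ D bad R₀) R) = 0
  · simp [h0]
  gcongr
  have hRD := (h.topCubes_subset hR).1
  -- A point of the good set in no bad cube has arbitrarily small cubes around it that are not of
  -- low density; once they are below the scale `r₀`, growth bounds them and hence `Θ(R)`.
  obtain ⟨x, hx, hxb⟩ : ∃ x ∈ goodSet (topCubes C₀ μ D bad R₀) R,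
      x ∉ ⋃ S ∈ {S ∈ D | S.SSub R ∧ bad R S}, S.carrier := by
    by_contra hcon
    push Not at hcon
    apply h0
    exact measure_mono_null (subset_inter subset_rfl hcon) (h.measure_goodSet_inter_bad hR)
  have hC := h.C_pos
  obtain ⟨k, hk⟩ := h.exists_scale_lt (t := r₀ / (56 * C₀)) (by positivity)
  rw [lt_div_iff₀ (by positivity)] at hk
  obtain ⟨Q, hQ, hQk, hxQ⟩ := h.exists_cube (max k (R.gen + 1)) (h.mem_support hRD hx.1)
  have hQR : Q.SSub R := h.ssub_of_mem hQ hRD (by omega) hxQ hx.1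
  have hQscale : scale A₀ ρ Q.gen ≤ scale A₀ ρ k := h.scale_strictAnti.antitone (by omega)
  have h1 : Q.dens2 n μ ≤ C₁ := h.dens2_le_of_growth hgrowth hQ (by
    have := h.radius_le hQ
    have : C₀ * scale A₀ ρ Q.gen ≤ C₀ * scale A₀ ρ k := by gcongr
    linarith)
  have h2 : ENNReal.ofReal τ * R.dens2 n μ ≤ Q.dens2 n μ := by
    by_contra hcon
    exact hxb (mem_biUnion (x := Q) ⟨hQ, hQR, hbad _ _ (not_le.1 hcon)⟩ hxQ)
  have h3 : R.dens2 n μ ≤ ENNReal.ofReal τ⁻¹ * C₁ := by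
    calc R.dens2 n μ = ENNReal.ofReal τ⁻¹ * (ENNReal.ofReal τ * R.dens2 n μ) := by
          rw [← mul_assoc, ← ENNReal.ofReal_mul (by positivity), inv_mul_cancel₀ hτ.ne']
          simp
      _ ≤ _ := by gcongr; exact h2.trans h1
  calc R.dens2 n μ ^ p ≤ (ENNReal.ofReal τ⁻¹ * C₁) ^ p := by gcongr
    _ = _ := by
        rw [ENNReal.mul_rpow_of_nonneg _ _ hp, ENNReal.ofReal_rpow_of_nonneg (by positivity) hp]

theorem measurableSet_goodSet (h : IsRootedLattice n C₀ A₀ ρ μ D R₀) {R : Cube d}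
    (hR : R ∈ topCubes C₀ μ D bad R₀) :
    MeasurableSet (goodSet (topCubes C₀ μ D bad R₀) R) := by
  refine (h.lattice.measurableSet R (h.topCubes_subset hR).1).diff (MeasurableSet.biUnion ?_ ?_)
  · exact h.countable.mono fun Q hQ => (h.topCubes_subset hQ.1).1
  · exact fun Q hQ => h.lattice.measurableSet Q (h.topCubes_subset hQ.1).1

/-- Good sets are disjoint: a top cube strictly inside `R` lies in a successor of `R`, which is
removed from the good set of `R`. -/
theorem tsum_measure_goodSet_le (h : IsRootedLattice n C₀ A₀ ρ μ D R₀) :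
    ∑' R : topCubes C₀ μ D bad R₀, μ (goodSet (topCubes C₀ μ D bad R₀) R) ≤ μ univ := by
  refine (tsum_meas_le_meas_iUnion_of_disjoint μ (fun R => h.measurableSet_goodSet R.2)
    ?_).trans (measure_mono (subset_univ _))
  have key : ∀ R ∈ topCubes C₀ μ D bad R₀, ∀ R' ∈ topCubes C₀ μ D bad R₀, ∀ x,
      x ∈ goodSet (topCubes C₀ μ D bad R₀) R → x ∈ goodSet (topCubes C₀ μ D bad R₀) R' →
      ¬ R.gen < R'.gen := by
    intro R hR R' hR' x hx hx' hg
    obtain ⟨Q, hQ, hsub⟩ := h.exists_nextStop_of_ssub hR' hR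
      (h.ssub_of_mem (h.topCubes_subset hR').1 (h.topCubes_subset hR).1 hg hx'.1 hx.1)
    rw [← h.nextCubes_topCubes hR] at hQ
    exact hx.2 (mem_biUnion hQ (hsub.2 hx'.1))
  intro R R' hne
  rw [Function.onFun, Set.disjoint_left]
  intro x hx hx'
  apply hne
  have h1 := key R R.2 R' R'.2 x hx hx'
  have h2 := key R' R'.2 R R.2 x hx' hx
  exact Subtype.ext (h.eq_of_mem (h.topCubes_subset R.2).1 (h.topCubes_subset R'.2).1
    (by omega) hx.1 hx'.1)

end IsRootedLattice

end

/-! ### Summation over all top cubes -/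

noncomputable section

namespace IsRootedLattice

variable {n d : ℕ} {C₀ A₀ ρ : ℝ} {μ : Measure (Eucl d)} {D : Set (Cube d)} {R₀ : Cube d}
  {bad : Cube d → Cube d → Prop}

/-- A top cube strictly inside `R` lies inside the stopping cube of `R` it meets. -/
theorem gen_stop_le (h : IsRootedLattice n C₀ A₀ ρ μ D R₀) {R R' S : Cube d}
    (hR : R ∈ topCubes C₀ μ D bad R₀) (hR' : R' ∈ topCubes C₀ μ D bad R₀)
    (hg : R.gen < R'.gen) (hS : S ∈ stopCubes D bad R) {z : Eucl d} (hzS : z ∈ S.carrier)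
    (hz' : z ∈ R'.carrier) : S.gen ≤ R'.gen := by
  have hss := h.ssub_of_mem (h.topCubes_subset hR').1 (h.topCubes_subset hR).1 hg hz'
    (hS.2.1.2 hzS)
  obtain ⟨Q, hQ, hsub⟩ := h.exists_nextStop_of_ssub hR' hR hss
  obtain ⟨⟨_, P, hP, hPR, hPb, hQP⟩, _⟩ := hQ
  have hRP := hsub.trans hQP
  by_contra hcon
  rw [not_le] at hcon
  exact hS.2.2.2 P hP hPR hPb (h.ssub_of_mem hS.1 hP (hRP.1.trans_lt hcon) hzS (hRP.2 hz'))

/-- The pairs `(z, r)` at which the energy is used by the top cube `R`. -/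
def energyRegion (A₀ ρ : ℝ) (D : Set (Cube d)) (bad : Cube d → Cube d → Prop) (R : Cube d)
    (z : Eucl d) (r : ℝ) : Prop :=
  ∃ S ∈ stopCubes D bad R, z ∈ S.carrier ∧ scale A₀ ρ S.gen ≤ r ∧ r ≤ A₀ * scale A₀ ρ R.gen

/-- For fixed `z` the top cubes involved are nested, and if `R'` is strictly below `R` then the
stopping cube of `R` at `z` is no smaller than the scale of `R'`, so `scale R' ≤ r`. Hence at most
one cube has `r` below its scale, at most one has `scale ≤ r < A₀ * scale`, and at most one has `r =
A₀ * scale`. -/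
theorem tsum_energyRegion_le (h : IsRootedLattice n C₀ A₀ ρ μ D R₀) (z : Eucl d) (r : ℝ)
    (c : ℝ≥0∞) : ∑' R : topCubes C₀ μ D bad R₀,
      (open scoped Classical in if energyRegion A₀ ρ D bad R z r then c else 0) ≤ 3 * c := by
  classical
  let T := topCubes C₀ μ D bad R₀
  let q : T → Prop := fun R => energyRegion A₀ ρ D bad R z r
  have heq : ∀ R R' : T, q R → q R' → (R : Cube d).gen = (R' : Cube d).gen → R = R' := by
    rintro R R' ⟨S, hS, hz, _⟩ ⟨S', hS', hz', _⟩ hg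
    exact Subtype.ext (h.eq_of_mem (h.topCubes_subset R.2).1 (h.topCubes_subset R'.2).1 hg
      (hS.2.1.2 hz) (hS'.2.1.2 hz'))
  have hlt : ∀ R R' : T, q R → q R' → (R : Cube d).gen < (R' : Cube d).gen →
      scale A₀ ρ (R' : Cube d).gen ≤ r := by
    rintro R R' ⟨S, hS, hz, hSr, _⟩ ⟨S', hS', hz', _⟩ hg
    exact (h.scale_strictAnti.antitone
      (h.gen_stop_le R.2 R'.2 hg hS hz (hS'.2.1.2 hz'))).trans hSr
  have hstep : ∀ R R' : T, (R : Cube d).gen < (R' : Cube d).gen →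
      A₀ * scale A₀ ρ (R' : Cube d).gen ≤ scale A₀ ρ (R : Cube d).gen := by
    intro R R' hg
    rw [← h.scale_succ (R : Cube d).gen]
    have := h.A_pos
    gcongr
    exact h.scale_strictAnti.antitone hg
  have hsub : ∀ P : T → Prop, (∀ R R', P R → P R' → q R → q R' →
      ¬ (R : Cube d).gen < (R' : Cube d).gen) → ∀ R R', (q R ∧ P R) → (q R' ∧ P R') → R = R' := by
    intro P hP R R' hR hR'
    have h1 := hP R R' hR.2 hR'.2 hR.1 hR'.1
    have h2 := hP R' R hR'.2 hR.2 hR'.1 hR.1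
    exact heq R R' hR.1 hR'.1 (by omega)
  have h1 := tsum_ite_le_of_subsingleton (fun R : T => q R ∧ r < scale A₀ ρ (R : Cube d).gen)
    (hsub _ fun R R' _ hR' hq hq' hg => absurd (hlt R R' hq hq' hg) (not_le.2 hR')) c
  have h2 := tsum_ite_le_of_subsingleton
    (fun R : T => q R ∧ (scale A₀ ρ (R : Cube d).gen ≤ r ∧ r < A₀ * scale A₀ ρ (R : Cube d).gen))
    (hsub _ fun R R' hR hR' hq hq' hg => by
      have := hstep R R' hg
      linarith [hR.1, hR'.2]) c
  have h3 := tsum_ite_le_of_subsingleton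
    (fun R : T => q R ∧ r = A₀ * scale A₀ ρ (R : Cube d).gen)
    (hsub _ fun R R' hR hR' hq hq' hg => by
      have h4 := hstep R R' hg
      have h5 := h.scale_pos (R : Cube d).gen
      have h6 := h.one_lt_A
      nlinarith) c
  calc ∑' R : T, (if q R then c else 0)
      ≤ ∑' R : T, ((if q R ∧ r < scale A₀ ρ (R : Cube d).gen then c else 0) +
        (if q R ∧ (scale A₀ ρ (R : Cube d).gen ≤ r ∧ r < A₀ * scale A₀ ρ (R : Cube d).gen)
          then c else 0) +
        (if q R ∧ r = A₀ * scale A₀ ρ (R : Cube d).gen then c else 0)) := by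
        refine ENNReal.tsum_le_tsum fun R => ?_
        by_cases hq : q R
        · rw [if_pos hq]
          have hle : r ≤ A₀ * scale A₀ ρ (R : Cube d).gen := by
            obtain ⟨S, _, _, _, hr⟩ := hq
            exact hr
          rcases lt_or_ge r (scale A₀ ρ (R : Cube d).gen) with hr | hr
          · rw [if_pos ⟨hq, hr⟩, add_assoc]
            exact le_self_add
          · rcases hle.lt_or_eq with hr' | hr'
            · rw [if_pos (c := q R ∧ (_ ∧ _)) ⟨hq, hr, hr'⟩, add_right_comm]
              exact le_add_self
            · rw [if_pos (c := q R ∧ r = _) ⟨hq, hr'⟩]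
              exact le_add_self
        · rw [if_neg hq]
          exact zero_le
    _ ≤ c + c + c := by
        rw [ENNReal.tsum_add, ENNReal.tsum_add]
        exact add_le_add (add_le_add h1 h2) h3
    _ = 3 * c := by ring

/-- On its large energy set, `Θ(R) ^ p` is bounded pointwise by the energy over the region of `R`,
and the regions overlap at most three times. Only the superadditive direction of exchanging sum and
integral is used, so the energy integrand need not be measurable. -/
theorem tsum_weighted_bigEnergySet_le (h : IsRootedLattice n C₀ A₀ ρ μ D R₀)
    (V : Submodule ℝ (Eucl d)) (α p : ℝ) {ε : ℝ} (hε : 0 < ε) :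
    ∑' R : topCubes C₀ μ D bad R₀, (R : Cube d).dens2 n μ ^ p *
      μ (bigEnergySet n A₀ ρ μ D V α p ε bad R) ≤
        ENNReal.ofReal (3 / ε) * conicalEnergy n p μ V α := by
  classical
  let T := topCubes C₀ μ D bad R₀
  let F : Eucl d → ℝ → ℝ≥0∞ := energyIntegrand n p μ V α
  let g : T → Eucl d → ℝ≥0∞ := fun R z =>
    ∫⁻ r in Ioi (0 : ℝ), if energyRegion A₀ ρ D bad R z r then F z r else 0
  have hg : ∀ R : T, ENNReal.ofReal ε * ((R : Cube d).dens2 n μ ^ p *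
      μ (bigEnergySet n A₀ ρ μ D V α p ε bad R)) ≤ ∫⁻ z, g R z ∂μ := by
    intro R
    have hmeas := h.measurableSet_bigEnergySet (bad := bad) V α p ε R
    calc ENNReal.ofReal ε * ((R : Cube d).dens2 n μ ^ p *
          μ (bigEnergySet n A₀ ρ μ D V α p ε bad R))
        = ∫⁻ _ in bigEnergySet n A₀ ρ μ D V α p ε bad R,
            ENNReal.ofReal ε * (R : Cube d).dens2 n μ ^ p ∂μ := by
          rw [setLIntegral_const, mul_assoc]
      _ ≤ ∫⁻ z in bigEnergySet n A₀ ρ μ D V α p ε bad R, g R z ∂μ := by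
          refine setLIntegral_mono' hmeas fun z hz => ?_
          simp only [bigEnergySet, mem_iUnion, exists_prop] at hz
          obtain ⟨S, ⟨hS, hSE⟩, hzS⟩ := hz
          refine (hSE z hzS).trans ?_
          calc ∫⁻ r in Icc (scale A₀ ρ S.gen) (A₀ * scale A₀ ρ (R : Cube d).gen), F z r
              = ∫⁻ r in Icc (scale A₀ ρ S.gen) (A₀ * scale A₀ ρ (R : Cube d).gen),
                  if energyRegion A₀ ρ D bad R z r then F z r else 0 := by
                refine setLIntegral_congr_fun measurableSet_Icc fun r hr => ?_
                rw [if_pos ⟨S, hS, hzS, hr.1, hr.2⟩]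
            _ ≤ g R z := lintegral_mono_set fun r hr => (h.scale_pos _).trans_le hr.1
      _ ≤ _ := setLIntegral_le_lintegral _ _
  have hsum : ∑' R : T, ∫⁻ z, g R z ∂μ ≤ 3 * conicalEnergy n p μ V α := by
    calc ∑' R : T, ∫⁻ z, g R z ∂μ ≤ ∫⁻ z, ∑' R : T, g R z ∂μ := tsum_lintegral_le μ g
      _ ≤ ∫⁻ z, 3 * (∫⁻ r in Ioi (0 : ℝ), F z r) ∂μ := by
          refine lintegral_mono fun z => ?_
          calc ∑' R : T, g R z ≤ ∫⁻ r in Ioi (0 : ℝ), ∑' R : T,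
                if energyRegion A₀ ρ D bad R z r then F z r else 0 := tsum_lintegral_le _ _
            _ ≤ ∫⁻ r in Ioi (0 : ℝ), 3 * F z r :=
                lintegral_mono fun r => h.tsum_energyRegion_le z r (F z r)
            _ = 3 * ∫⁻ r in Ioi (0 : ℝ), F z r := lintegral_const_mul' _ _ (by norm_num)
      _ = _ := lintegral_const_mul' _ _ (by norm_num)
  have hkey : ENNReal.ofReal ε * ∑' R : T, (R : Cube d).dens2 n μ ^ p *
      μ (bigEnergySet n A₀ ρ μ D V α p ε bad R) ≤ 3 * conicalEnergy n p μ V α := by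
    rw [← ENNReal.tsum_mul_left]
    exact (ENNReal.tsum_le_tsum hg).trans hsum
  have he : ENNReal.ofReal ε⁻¹ * ENNReal.ofReal ε = 1 := by
    rw [← ENNReal.ofReal_mul (by positivity), inv_mul_cancel₀ hε.ne', ENNReal.ofReal_one]
  calc ∑' R : T, (R : Cube d).dens2 n μ ^ p * μ (bigEnergySet n A₀ ρ μ D V α p ε bad R)
      = ENNReal.ofReal ε⁻¹ * (ENNReal.ofReal ε * ∑' R : T, (R : Cube d).dens2 n μ ^ p *
          μ (bigEnergySet n A₀ ρ μ D V α p ε bad R)) := by rw [← mul_assoc, he, one_mul]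
    _ ≤ ENNReal.ofReal ε⁻¹ * (3 * conicalEnergy n p μ V α) := by gcongr
    _ = _ := by
        rw [div_eq_inv_mul, ENNReal.ofReal_mul (by positivity), ← mul_assoc]
        norm_num

/-- The sum over next cubes of the cubes in a subfamily is a sum over distinct top cubes. -/
theorem tsum_nextCubes_le (h : IsRootedLattice n C₀ A₀ ρ μ D R₀) {Top A : Set (Cube d)}
    (hTop : Top ⊆ D) (hA : A ⊆ Top) (f : Cube d → ℝ≥0∞) :
    ∑' R : A, ∑' Q : nextCubes Top R, f Q ≤
      ∑' Q : {Q | ∃ R ∈ A, Q ∈ nextCubes Top R}, f Q := by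
  rw [← ENNReal.tsum_sigma (fun (R : A) (Q : nextCubes Top (R : Cube d)) => f Q)]
  let φ : (Σ R : A, nextCubes Top (R : Cube d)) → {Q | ∃ R ∈ A, Q ∈ nextCubes Top R} :=
    fun x => ⟨x.2, x.1, x.1.2, x.2.2⟩
  refine ENNReal.tsum_comp_le_tsum_of_injective (f := φ) ?_
    (fun Q : {Q | ∃ R ∈ A, Q ∈ nextCubes Top R} => f Q)
  have key : ∀ R ∈ A, ∀ R' ∈ A, ∀ Q ∈ nextCubes Top R, Q ∈ nextCubes Top R' →
      ¬ R.gen < R'.gen := by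
    intro R hR R' hR' Q hQ hQ' hg
    have hz := h.lattice.center_mem Q (hTop hQ.1)
    exact hQ.2.2 R' (hA hR') (h.ssub_of_mem (hTop (hA hR')) (hTop (hA hR)) hg
      (hQ'.2.1.2 hz) (hQ.2.1.2 hz)) hQ'.2.1
  rintro ⟨⟨R, hR⟩, ⟨Q, hQ⟩⟩ ⟨⟨R', hR'⟩, ⟨Q', hQ'⟩⟩ he
  have he' : Q = Q' := congrArg Subtype.val he
  subst he'
  have hz := h.lattice.center_mem Q (hTop hQ.1)
  have h1 := key R hR R' hR' Q hQ hQ'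
  have h2 := key R' hR' R hR Q hQ' hQ
  obtain rfl := h.eq_of_mem (hTop (hA hR)) (hTop (hA hR')) (by omega) (hQ.2.1.2 hz)
    (hQ'.2.1.2 hz)
  rfl

theorem tsum_disjoint_le (h : IsRootedLattice n C₀ A₀ ρ μ D R₀) {A : Set (Cube d)} (hA : A ⊆ D)
    (hdisj : ∀ Q ∈ A, ∀ Q' ∈ A, ∀ z ∈ Q.carrier, z ∈ Q'.carrier → ¬ Q.gen < Q'.gen)
    {p : ℝ} (hp : 0 ≤ p) {M : ℝ≥0∞} (hM : ∀ Q ∈ A, Q.dens2 n μ ≤ M) :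
    ∑' Q : A, (Q : Cube d).dens2 n μ ^ p * μ (Q : Cube d).carrier ≤ M ^ p * μ univ := by
  calc ∑' Q : A, (Q : Cube d).dens2 n μ ^ p * μ (Q : Cube d).carrier
      ≤ ∑' Q : A, M ^ p * μ (Q : Cube d).carrier := by
        refine ENNReal.tsum_le_tsum fun Q => ?_
        gcongr
        exact hM Q Q.2
    _ = M ^ p * ∑' Q : A, μ (Q : Cube d).carrier := ENNReal.tsum_mul_left
    _ ≤ M ^ p * μ univ := by
        gcongr
        refine (tsum_meas_le_meas_iUnion_of_disjoint μ
          (fun Q : A => h.lattice.measurableSet Q (hA Q.2)) ?_).trans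
          (measure_mono (subset_univ _))
        intro Q Q' hne
        rw [Function.onFun, Set.disjoint_left]
        intro z hz hz'
        have h1 := hdisj Q Q.2 Q' Q'.2 z hz hz'
        have h2 := hdisj Q' Q'.2 Q Q.2 z hz' hz
        exact hne (Subtype.ext (h.eq_of_mem (hA Q.2) (hA Q'.2) (by omega) hz hz'))

theorem le_two_mul_of_le_add_half {x y : ℝ≥0∞} (hx : x ≠ ∞)
    (hxy : x ≤ y + ENNReal.ofReal (1 / 2) * x) : x ≤ 2 * y := by
  have hhalf : ENNReal.ofReal (1 / 2) * x + ENNReal.ofReal (1 / 2) * x = x := by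
    rw [← add_mul, ← ENNReal.ofReal_add (by norm_num) (by norm_num)]
    norm_num
  have hne : ENNReal.ofReal (1 / 2) * x ≠ ∞ := ENNReal.mul_ne_top ENNReal.ofReal_ne_top hx
  have : ENNReal.ofReal (1 / 2) * x ≤ y := by
    refine (ENNReal.add_le_add_iff_right hne).1 ?_
    rwa [hhalf]
  calc x = 2 * (ENNReal.ofReal (1 / 2) * x) := by rw [two_mul, hhalf]
    _ ≤ 2 * y := by gcongr

/-- Absorption: if the weighted mass of every top cube is at most an error plus half of the
weighted mass of its next cubes, then the total weighted mass is at most twice the total error. -/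
theorem tsum_top_le (h : IsRootedLattice n C₀ A₀ ρ μ D R₀) {Top : Set (Cube d)} (hTop : Top ⊆ D)
    {p : ℝ} (hp : 0 ≤ p) {M : ℝ≥0∞} (hM : M ≠ ∞) (hdens : ∀ Q ∈ Top, Q.dens2 n μ ≤ M)
    (err : Cube d → ℝ≥0∞) (herr : ∀ R ∈ Top, R.dens2 n μ ^ p * μ R.carrier ≤
      err R + ENNReal.ofReal (1 / 2) * ∑' Q : nextCubes Top R,
        (Q : Cube d).dens2 n μ ^ p * μ (Q : Cube d).carrier) :
    ∑' R : Top, (R : Cube d).dens2 n μ ^ p * μ (R : Cube d).carrier ≤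
      2 * ∑' R : Top, err R := by
  by_cases hfin : ∑' R : Top, err R = ∞
  · rw [hfin, ENNReal.mul_top (by norm_num)]
    exact le_top
  let f : Cube d → ℝ≥0∞ := fun Q => Q.dens2 n μ ^ p * μ Q.carrier
  set N := ∑' R : Top, err R with hN
  have hMp : M ^ p * μ univ ≠ ∞ :=
    ENNReal.mul_ne_top (ENNReal.rpow_ne_top_of_nonneg hp hM) h.finite
  have hgeneral : ∀ A ⊆ Top, ∑' R : A, f R ≤
      N + ENNReal.ofReal (1 / 2) * ∑' Q : {Q | ∃ R ∈ A, Q ∈ nextCubes Top R}, f Q := by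
    intro A hA
    calc ∑' R : A, f R ≤ ∑' R : A, (err R + ENNReal.ofReal (1 / 2) *
          ∑' Q : nextCubes Top (R : Cube d), f Q) :=
          ENNReal.tsum_le_tsum fun R => herr R (hA R.2)
      _ = ∑' R : A, err R + ENNReal.ofReal (1 / 2) *
          ∑' R : A, ∑' Q : nextCubes Top (R : Cube d), f Q := by
          rw [ENNReal.tsum_add, ENNReal.tsum_mul_left]
      _ ≤ _ := by
          gcongr
          · exact ENNReal.tsum_mono_subtype err hA
          · exact h.tsum_nextCubes_le hTop hA f
  -- Absorption needs a finite sum, so it is first done up to generation `k`. Successors beyond `k`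
  -- are pairwise disjoint, being next cubes of cubes up to `k`, so they contribute at most `M ^ p *
  -- μ univ` whatever `k` is.
  have htrunc : ∀ k, ∑' R : {R ∈ Top | R.gen ≤ k}, f R ≤ 2 * N + M ^ p * μ univ := by
    intro k
    set A := {R ∈ Top | R.gen ≤ k} with hA
    have hAsub : A ⊆ Top := sep_subset _ _
    set B := {Q | Q ∈ Top ∧ k < Q.gen ∧ ∃ R ∈ A, Q ∈ nextCubes Top R} with hB
    have hAfin : ∑' R : A, f R ≠ ∞ := by
      have hcov : A ⊆ ⋃ i ∈ Finset.range (k + 1), {R ∈ Top | R.gen = i} := fun R hR =>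
        mem_biUnion (x := R.gen) (by simpa [Nat.lt_succ_iff] using hR.2) ⟨hR.1, rfl⟩
      refine ne_top_of_le_ne_top ?_ ((ENNReal.tsum_mono_subtype f hcov).trans
        (ENNReal.tsum_biUnion_le f (Finset.range (k + 1)) fun i => {R ∈ Top | R.gen = i}))
      refine ENNReal.sum_ne_top.2 fun i _ => ne_top_of_le_ne_top hMp
        (h.tsum_disjoint_le (fun R hR => hTop hR.1) ?_ hp fun Q hQ => hdens Q hQ.1)
      intro Q hQ Q' hQ' z _ _ hg
      rw [hQ.2, hQ'.2] at hg
      exact lt_irrefl _ hg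
    have hBle : ∑' Q : B, f Q ≤ M ^ p * μ univ := by
      refine h.tsum_disjoint_le (fun R hR => hTop hR.1) ?_ hp fun Q hQ => hdens Q hQ.1
      rintro Q ⟨hQ, hQk, _⟩ Q' ⟨hQ', hQk', R', hR', hQR'⟩ z hz hz' hg
      have hgR : R'.gen < Q.gen := hR'.2.trans_lt hQk
      exact hQR'.2.2 Q hQ (h.ssub_of_mem (hTop hQ) (hTop hR'.1) hgR hz (hQR'.2.1.2 hz'))
        (h.ssub_of_mem (hTop hQ') (hTop hQ) hg hz' hz)
    have hsplit : ∑' Q : {Q | ∃ R ∈ A, Q ∈ nextCubes Top R}, f Q ≤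
        ∑' Q : A, f Q + M ^ p * μ univ := by
      have hsub : {Q | ∃ R ∈ A, Q ∈ nextCubes Top R} ⊆ A ∪ B := by
        rintro Q ⟨R, hR, hQ⟩
        rcases le_or_gt Q.gen k with hk | hk
        · exact Or.inl ⟨hQ.1, hk⟩
        · exact Or.inr ⟨hQ.1, hk, R, hR, hQ⟩
      exact (ENNReal.tsum_mono_subtype f hsub).trans ((ENNReal.tsum_union_le f A B).trans
        (add_le_add le_rfl hBle))
    have h1 : ∑' R : A, f R ≤ (N + ENNReal.ofReal (1 / 2) * (M ^ p * μ univ)) +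
        ENNReal.ofReal (1 / 2) * ∑' R : A, f R := by
      refine (hgeneral A hAsub).trans ?_
      calc N + ENNReal.ofReal (1 / 2) * ∑' Q : {Q | ∃ R ∈ A, Q ∈ nextCubes Top R}, f Q
          ≤ N + ENNReal.ofReal (1 / 2) * (∑' Q : A, f Q + M ^ p * μ univ) := by gcongr
        _ = _ := by ring
    refine (le_two_mul_of_le_add_half hAfin h1).trans (le_of_eq ?_)
    have h2 : (2 : ℝ≥0∞) * ENNReal.ofReal (1 / 2) = 1 := by
      rw [show (2 : ℝ≥0∞) = ENNReal.ofReal 2 by norm_num, ← ENNReal.ofReal_mul (by norm_num)]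
      norm_num
    rw [mul_add, ← mul_assoc, h2, one_mul]
  have hTopfin : ∑' R : Top, f R ≠ ∞ := by
    refine ne_top_of_le_ne_top (b := 2 * N + M ^ p * μ univ)
      (ENNReal.add_ne_top.2 ⟨ENNReal.mul_ne_top (by norm_num) hfin, hMp⟩) ?_
    rw [ENNReal.tsum_eq_iSup_sum]
    refine iSup_le fun s => ?_
    refine le_trans ?_ (htrunc (s.sup fun R => (R : Cube d).gen))
    let φ : s → {R ∈ Top | R.gen ≤ s.sup fun R => (R : Cube d).gen} := fun R =>
      ⟨R.1, R.1.2, Finset.le_sup (f := fun R : Top => (R : Cube d).gen) R.2⟩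
    have hφ : Function.Injective φ := fun R R' he => by
      have := congrArg Subtype.val he
      exact Subtype.ext (Subtype.ext this)
    have := ENNReal.tsum_comp_le_tsum_of_injective hφ
      (fun R : {R ∈ Top | R.gen ≤ s.sup fun R => (R : Cube d).gen} => f R)
    refine le_trans (le_of_eq ?_) this
    rw [tsum_fintype, ← Finset.sum_coe_sort s]
  -- Once the full sum is known to be finite, absorbing again without truncation removes the
  -- dependence on `M`.
  refine le_two_mul_of_le_add_half hTopfin ((hgeneral Top subset_rfl).trans ?_)
  gcongr
  exact ENNReal.tsum_mono_subtype f (by rintro Q ⟨R, _, hQ⟩; exact hQ.1)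

end IsRootedLattice

end

/-! ### The packing estimate and the conclusion -/

noncomputable section

/-- The constant in the packing estimate. -/
def packingConstant (n d : ℕ) (C₀ A₀ α p : ℝ) : ℝ :=
  4 * (lowThreshold n d C₀ A₀ α)⁻¹ ^ p +
    4 * (3 / energyThreshold n C₀ A₀ α (lowThreshold n d C₀ A₀ α) p)

namespace IsRootedLattice

variable {n d : ℕ} {C₀ A₀ ρ : ℝ} {μ : Measure (Eucl d)} {D : Set (Cube d)} {R₀ : Cube d}

/-- The packing estimate for the top cubes. -/
theorem tsum_topCubes_le (h : IsRootedLattice n C₀ A₀ ρ μ D R₀) (hnd : n ≤ d)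
    {C₁ : ℝ≥0} {r₀ : ℝ} (hr₀ : 0 < r₀) (hgrowth : ∀ x ∈ μ.support, ∀ r : ℝ, 0 < r → r ≤ r₀ →
      μ (ball x r) ≤ C₁ * ENNReal.ofReal (r ^ n))
    {V : Submodule ℝ (Eucl d)} (hV : Module.finrank ℝ V = d - n)
    {α p : ℝ} (hα : 0 < α) (hα1 : α < 1) (hp : 1 ≤ p) {bad : Cube d → Cube d → Prop}
    (hbad : bad = BadCube n C₀ A₀ ρ μ V α (lowThreshold n d C₀ A₀ α) p) :
    ∑' R : topCubes C₀ μ D bad R₀, (R : Cube d).dens2 n μ ^ p * μ (R : Cube d).carrier ≤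
      (packingConstant n d C₀ A₀ α p).toNNReal *
        ((C₁ : ℝ≥0∞) ^ p * μ univ + conicalEnergy n p μ V α) := by
  have hp0 : 0 ≤ p := by linarith
  set τ := lowThreshold n d C₀ A₀ α with hτ
  have hτ0 : 0 < τ := h.lowThreshold_pos hα
  set ε := energyThreshold n C₀ A₀ α τ p with hε
  have hε0 : 0 < ε := by
    have := h.scaleRatio_pos hα
    rw [hε, energyThreshold]
    positivity
  set Top := topCubes C₀ μ D bad R₀ with hTop
  have hTopD : Top ⊆ D := fun Q hQ => (h.topCubes_subset hQ).1
  have hlow : ∀ R Q, LowDensity n μ τ R Q → bad R Q := fun R Q hl => by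
    rw [hbad]; exact Or.inr (Or.inl hl)
  have hM : (C₁ : ℝ≥0∞) + μ univ / ENNReal.ofReal (r₀ ^ n) ≠ ∞ := by
    refine ENNReal.add_ne_top.2 ⟨ENNReal.coe_ne_top, ENNReal.div_ne_top h.finite ?_⟩
    have : 0 < r₀ ^ n := pow_pos hr₀ n
    simpa using this
  have hmain := h.tsum_top_le hTopD hp0 hM
    (fun Q hQ => h.dens2_le_global hr₀ hgrowth (hTopD hQ))
    (fun R => 2 * (R.dens2 n μ ^ p * μ (goodSet Top R)) +
      2 * (R.dens2 n μ ^ p * μ (bigEnergySet n A₀ ρ μ D V α p ε bad R)))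
    (fun R hR => h.weighted_mass_le hnd hV hα hα1 hp hτ hbad hR)
  have hgood : ∑' R : Top, (R : Cube d).dens2 n μ ^ p * μ (goodSet Top R) ≤
      ENNReal.ofReal (τ⁻¹ ^ p) * (C₁ ^ p * μ univ) := by
    calc ∑' R : Top, (R : Cube d).dens2 n μ ^ p * μ (goodSet Top R)
        ≤ ∑' R : Top, ENNReal.ofReal (τ⁻¹ ^ p) * C₁ ^ p * μ (goodSet Top R) :=
          ENNReal.tsum_le_tsum fun R => h.weighted_goodSet_le hτ0 hp0 hlow hr₀ hgrowth R.2
      _ = ENNReal.ofReal (τ⁻¹ ^ p) * C₁ ^ p * ∑' R : Top, μ (goodSet Top R) :=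
          ENNReal.tsum_mul_left
      _ ≤ ENNReal.ofReal (τ⁻¹ ^ p) * C₁ ^ p * μ univ := by
          gcongr
          exact h.tsum_measure_goodSet_le
      _ = _ := mul_assoc _ _ _
  have hbig := h.tsum_weighted_bigEnergySet_le (bad := bad) V α p hε0
  refine hmain.trans ?_
  rw [ENNReal.tsum_add, ENNReal.tsum_mul_left, ENNReal.tsum_mul_left]
  set X := (C₁ : ℝ≥0∞) ^ p * μ univ
  set E := conicalEnergy n p μ V α
  have h4 : (4 : ℝ≥0∞) = ENNReal.ofReal 4 := by norm_num
  calc 2 * (2 * ∑' R : Top, (R : Cube d).dens2 n μ ^ p * μ (goodSet Top R) +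
        2 * ∑' R : Top, (R : Cube d).dens2 n μ ^ p *
          μ (bigEnergySet n A₀ ρ μ D V α p ε bad R))
      ≤ 2 * (2 * (ENNReal.ofReal (τ⁻¹ ^ p) * X) + 2 * (ENNReal.ofReal (3 / ε) * E)) := by
        gcongr
    _ = ENNReal.ofReal (4 * τ⁻¹ ^ p) * X + ENNReal.ofReal (4 * (3 / ε)) * E := by
        rw [ENNReal.ofReal_mul (by norm_num), ENNReal.ofReal_mul (by norm_num), ← h4]
        ring
    _ ≤ ENNReal.ofReal (packingConstant n d C₀ A₀ α p) * X +
        ENNReal.ofReal (packingConstant n d C₀ A₀ α p) * E := by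
        have h1 : 0 ≤ 4 * τ⁻¹ ^ p := by positivity
        have h2 : 0 ≤ 4 * (3 / ε) := by positivity
        have e : packingConstant n d C₀ A₀ α p = 4 * τ⁻¹ ^ p + 4 * (3 / ε) := rfl
        rw [e]
        gcongr <;> linarith
    _ = _ := by rw [← mul_add]; rfl

end IsRootedLattice

end

theorem lemma3p1 (n d : ℕ) (hn : 0 < n) (hnd : n < d) :
    -- parameters of the cubes and implicit constants; they depend on `n`, `d` and on the
    -- displayed arguments: `L` on `α`, `C` on nothing more, `C'` on `α` and `p`
    ∃ C₀ A₀ : ℝ, 1 < C₀ ∧ 5000 * C₀ < A₀ ∧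
    ∃ (L : ℝ → ℝ≥0) (C : ℝ≥0) (C' : ℝ → ℝ → ℝ≥0),
      ∀ (μ : Measure (Eucl d)) [IsLocallyFiniteMeasure μ], IsCompact μ.support → μ ≠ 0 →
      ∀ ρ : ℝ, 0 < ρ → diam μ.support ≤ ρ →
      -- the lattice associated with `μ` at base scale `ρ`, with biggest cube `R₀ = supp μ`
      ∃ D : Set (Cube d), IsDavidMattilaLattice n C₀ A₀ ρ μ D ∧
      ∃ R₀ ∈ D, R₀.gen = 0 ∧ R₀.carrier = μ.support ∧
      ∀ (C₁ : ℝ≥0) (r₀ : ℝ), 0 < r₀ →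
        (∀ x ∈ μ.support, ∀ r : ℝ, 0 < r → r ≤ r₀ →
          μ (ball x r) ≤ C₁ * ENNReal.ofReal (r ^ n)) →
      ∀ V : Submodule ℝ (Eucl d), Module.finrank ℝ V = d - n →
      ∀ α : ℝ, 0 < α → α < 1 → ∀ p : ℝ, 1 ≤ p →
        conicalEnergy n p μ V α < ∞ →
        ∃ Top ⊆ doublingCubes C₀ μ D, R₀ ∈ Top ∧
        ∃ Γ : Cube d → Set (Eucl d),
          (∀ R ∈ Top, IsLipschitzGraph n (L α) (Γ R)) ∧
          (∀ R ∈ Top, μ (goodSet Top R \ Γ R) = 0) ∧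
          (∀ R ∈ Top, ∀ Q ∈ treeCubes D Top R, Q.dens2 n μ ≤ C * R.dens2 n μ) ∧
          ∑' R : Top, (R : Cube d).dens2 n μ ^ p * μ (R : Cube d).carrier ≤
            C' α p * ((C₁ : ℝ≥0∞) ^ p * μ univ + conicalEnergy n p μ V α) := by
  have hd : 0 < d := hn.trans hnd
  have hC : (1 : ℝ) < 100 ^ (100 * d) := one_lt_pow₀ (by norm_num) (by omega)
  have hA : (5000 : ℝ) * 100 ^ (100 * d) < 5001 * 100 ^ (100 * d) := by
    have : (0 : ℝ) < 100 ^ (100 * d) := by positivity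
    linarith
  refine ⟨100 ^ (100 * d), 5001 * 100 ^ (100 * d), hC, hA,
    fun α => graphConstant (d - n) (α / 2),
    (treeConstant n d (100 ^ (100 * d)) (5001 * 100 ^ (100 * d)) * 4).toNNReal,
    fun α p => (packingConstant n d (100 ^ (100 * d)) (5001 * 100 ^ (100 * d)) α p).toNNReal, ?_⟩
  intro μ _ hc hμ ρ hρ hdiam
  obtain ⟨D, hD, R₀, hR₀, hgen, hcar, hdb⟩ := exists_isDavidMattilaLattice hnd
    (N := 100 * d) (by omega) hA (lattice_parameters hd) μ hc hμ hρ hdiam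
  have h : IsRootedLattice n (100 ^ (100 * d)) (5001 * 100 ^ (100 * d)) ρ μ D R₀ :=
    ⟨hD, hC, hA, hρ, (isFiniteMeasure_of_isCompact_support μ hc).measure_univ_lt_top.ne, hR₀, hgen,
      hcar, hdb⟩
  refine ⟨D, hD, R₀, hR₀, hgen, hcar, ?_⟩
  intro C₁ r₀ hr₀ hgrowth V hV α hα hα1 p hp _
  -- The numerical values are forgotten from here on; only the properties recorded in
  -- `IsRootedLattice` matter.
  generalize hC₀ : (100 : ℝ) ^ (100 * d) = C₀ at *
  generalize hA₀ : 5001 * C₀ = A₀ at *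
  set τ := lowThreshold n d C₀ A₀ α
  let bad := BadCube n C₀ A₀ ρ μ V α τ p
  have hlow : ∀ R Q, LowDensity n μ τ R Q → bad R Q := fun R Q hl => Or.inr (Or.inl hl)
  have hhigh : ∀ R Q, HighDensity n C₀ μ R Q → bad R Q := fun R Q hl => Or.inl hl
  have hen : ∀ R Q, BigEnergy n p μ V α A₀ ρ (energyThreshold n C₀ A₀ α τ p) R Q → bad R Q :=
    fun R Q hl => Or.inr (Or.inr hl)
  have hΓ : ∀ R : Cube d, ∃ Γ : Set (Eucl d), R ∈ D →
      IsLipschitzGraph n (graphConstant (d - n) (α / 2)) Γ ∧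
      R.carrier \ ⋃ S ∈ {S ∈ D | S.SSub R ∧ bad R S}, S.carrier ⊆ Γ := by
    intro R
    by_cases hR : R ∈ D
    · obtain ⟨Γ, hΓ⟩ := h.exists_graph hnd.le hV hα hα1 (by linarith) (h.lowThreshold_pos hα)
        hlow hen hR
      exact ⟨Γ, fun _ => hΓ⟩
    · exact ⟨∅, fun hR' => absurd hR' hR⟩
  choose Γ hΓ using hΓ
  refine ⟨topCubes C₀ μ D bad R₀, h.topCubes_subset, Relation.ReflTransGen.refl, Γ, ?_, ?_, ?_, ?_⟩
  · exact fun R hR => (hΓ R (h.topCubes_subset hR).1).1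
  · intro R hR
    refine measure_mono_null ?_ (h.measure_goodSet_inter_bad hR)
    rintro x ⟨hx, hxΓ⟩
    refine ⟨hx, ?_⟩
    by_contra hxb
    exact hxΓ ((hΓ R (h.topCubes_subset hR).1).2 ⟨hx.1, hxb⟩)
  · exact fun R hR Q hQ => h.dens2_le_of_mem_treeCubes hhigh hR hQ
  · exact h.tsum_topCubes_le hnd.le hr₀ hgrowth hV hα hα1 hp rfl
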